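/- **Setting.** Let $\Gamma$ be a countable discrete group acting by measure-preserving transformations on a $\sigma$-finite measure space $(\Omega,\mu)$, and write $\theta_g(f)(\omega)=f(g^{-1}\omega)$. Let $\mathcal L\Gamma=\{\lambda_g\}''\subset\mathcal B(\ell^2\Gamma)$ be the group von Neumann algebra, with trace $\tau(x)=\langle\delta_e,x\delta_e\rangle$. Let $L^\infty(\Omega)\rtimes_\theta\Gamma\subset\mathcal B(L^2(\Omega)\otimes_2\ell^2\Gamma)$ be the crossed product, spanned (weak-$*$) by the operators $f\rtimes\lambda_g$, with trace $\tau_\rtimes=\mu\circ\mathbf E$, where $\mathbf E\big(\sum_g f_g\rtimes\lambda_g\big)=f_e$. Let $L^2(\Omega\rtimes_\theta\Gamma)$ be its $L^2$-space, identified with $L^2(\Omega\times\Gamma)$ through $\sum_g \xi(g)\rtimes\lambda_g\leftrightarrow\sum_g\xi(g)\otimes\delta_g$. Let $\kappa:\Gamma\to L^\infty(\Omega;\mathbf T)$ be a multiplicative $1$-cocycle, that is, $\kappa_{gh}=\kappa_g\,\theta_g(\kappa_h)$ almost everywhere. There is a unique normal $*$-homomorphism $\pi:\mathcal L\Gamma\to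 L^\infty(\Omega)\rtimes_\theta\Gamma$ with $\pi(\lambda_g)=\kappa_g\rtimes\lambda_g$ for all $g\in\Gamma$. **Amenability.** Write $\mathcal N=\mathcal L\Gamma$ and $\mathcal M=L^\infty(\Omega)\rtimes_\theta\Gamma$. The map $\pi$ is called *amenable* if the trivial $\mathcal N$-$\mathcal N$-correspondence $L^2(\mathcal N)$ is weakly contained in $H(\pi)\,\bar\otimes_{\mathcal M}\,\overline{H(\pi)}$. Here $H(\pi)$ is the $\mathcal N$-$\mathcal M$-correspondence generated by vectors $x\otimes y$ with $x\in\mathcal N$ and $y\in\mathcal M\cap L^2(\mathcal M)$, with $\langle x_1\otimes y_1,x_2\otimes y_2\rangle=\tau_\rtimes(y_1^*\pi(x_1^*x_2)y_2)$ and $a\cdot(x\otimes y)\cdot b=ax\otimes yb$; $\overline{H(\pi)}$ is its contragredient, and $\bar\otimes_{\mathcal M}$ is the Connes tensor product. A correspondence $K$ is weakly contained in $H$ if for all $\varepsilon>0$, all finite sets $E,F$ of elements of the left and right algebras and every unit vector $\xi\in K$ there are finitely many $\eta_j\in H$ with $|\langle\xi,x\cdot\xi\cdot y\rangle-\sum_j\langle\eta_j,x\cdot\eta_j\cdot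 y\rangle|<\varepsilon$ for $x\in E$, $y\in F$. **Theorem.** (i) $\pi$ is amenable if and only if there is a sequence of unit vectors $(\xi_n)_n\subset L^2(\Omega\times\Gamma)$ such that for every $h\in\Gamma$ $$\lim_n\big\|(\theta_h\otimes\mathrm{Ad}_h)(\xi_n)-M_{\varpi_h}(\xi_n)\big\|_2=0,\qquad \varpi_h(g,\omega)=\overline{\kappa_h(\omega)}\;\theta_g(\kappa_h)(\omega),$$ where $(\theta_h\otimes\mathrm{Ad}_h)(\xi)(\omega,g)=\xi(h^{-1}\omega,h^{-1}gh)$ and $M_{\varpi_h}$ is pointwise multiplication by $\varpi_h$, and such that for all $n$ and all $h\in\Gamma$ $$\int_\Omega\kappa_h\Big(\sum_{g\in\Gamma}\overline{\xi_n(hg)}\;\theta_h(\xi_n(g))\Big)\,d\mu=\delta_{\{h=e\}}.$$ The same equivalence holds if the last identity is only required in the limit $n\to\infty$, for each $h\in\Gamma$. (ii) Let $\mathcal U$ be a countably incomplete ultrafilter (for instance, a non-principal ultrafilter on $\mathbf N$). Then $\pi$ is amenable and there is an $\mathcal L\Gamma$-bimodular isometry $J:L^2(\mathcal L\Gamma)\to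 L^2(\Omega\rtimes_\theta\Gamma)^{\mathcal U}$, that is, $J(x\,\zeta\,y)=\pi(x)\,J(\zeta)\,\pi(y)$, such that $J\circ T_m=(\mathrm{id}\rtimes T_m)^{\mathcal U}\circ J$ for every $m$ in the Fourier–Stieltjes algebra $B(\Gamma)$, if and only if $\Omega$ has a $\Gamma$-invariant mean, i.e. there is a $\theta$-invariant state on $L^\infty(\Omega)$. Here $T_m(\lambda_g)=m(g)\lambda_g$ and $(\mathrm{id}\rtimes T_m)(f\rtimes\lambda_g)=m(g)\,f\rtimes\lambda_g$. -/

import Mathlib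

open MeasureTheory Filter Topology
open scoped ENNReal ComplexConjugate InnerProductSpace ComplexOrder

set_option linter.unusedSectionVars false

noncomputable section

namespace AmenableHom

/-! ### Operators on `L²` spaces -/

/-- Bounded measurable functions; their classes make up `L^∞`. -/
structure BddMeas {X : Type*} [MeasurableSpace X] (F : X → ℂ) : Prop where
  meas : Measurable F
  bdd : ∃ C : ℝ, ∀ x, ‖F x‖ ≤ C

theorem BddMeas.memLp {X : Type*} [MeasurableSpace X] {F : X → ℂ} (hF : BddMeas F)
    (ν : Measure X) : MemLp F ∞ ν := by
  obtain ⟨C, hC⟩ := hF.bdd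
  exact memLp_top_of_bound hF.meas.aestronglyMeasurable C (ae_of_all _ hC)

theorem BddMeas.conj {X : Type*} [MeasurableSpace X] {F : X → ℂ} (hF : BddMeas F) :
    BddMeas (fun x => conj (F x)) :=
  ⟨Complex.continuous_conj.measurable.comp hF.meas, by simpa using hF.bdd⟩

theorem BddMeas.comp {X Y : Type*} [MeasurableSpace X] [MeasurableSpace Y] {F : X → ℂ}
    (hF : BddMeas F) {T : Y → X} (hT : Measurable T) : BddMeas (fun y => F (T y)) :=
  ⟨hF.meas.comp hT, by obtain ⟨C, hC⟩ := hF.bdd; exact ⟨C, fun y => hC _⟩⟩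

theorem BddMeas.indicator {X : Type*} [MeasurableSpace X] {A : Set X} (hA : MeasurableSet A) :
    BddMeas (A.indicator (fun _ => (1 : ℂ))) :=
  ⟨measurable_const.indicator hA, 1, fun x => by
    by_cases h : x ∈ A <;> simp [h]⟩

/-- The operator of pointwise multiplication by a bounded measurable function on `L²(X, ν)`. -/
def mulOp {X : Type*} [MeasurableSpace X] (ν : Measure X) (F : X → ℂ) (hF : BddMeas F) :
    Lp ℂ 2 ν →L[ℂ] Lp ℂ 2 ν :=
  (ContinuousLinearMap.mul ℂ ℂ).holderL ν ∞ 2 2 ((hF.memLp ν).toLp F)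

theorem mulOp_ae {X : Type*} [MeasurableSpace X] (ν : Measure X) (F : X → ℂ) (hF : BddMeas F)
    (v : Lp ℂ 2 ν) : mulOp ν F hF v =ᵐ[ν] fun x => F x * v x := by
  have h := (ContinuousLinearMap.mul ℂ ℂ).coeFn_holder (r := 2) ((hF.memLp ν).toLp F) v
  filter_upwards [h, (hF.memLp ν).coeFn_toLp] with x hx hx'
  rw [← hx']
  exact hx

/-- The operator of composition with a measure preserving map on `L²(X, ν)`. -/
def compOp {X : Type*} [MeasurableSpace X] (ν : Measure X) (T : X → X)
    (hT : MeasurePreserving T ν ν) : Lp ℂ 2 ν →L[ℂ] Lp ℂ 2 ν :=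
  (Lp.compMeasurePreservingₗᵢ ℂ T hT).toContinuousLinearMap

theorem compOp_ae {X : Type*} [MeasurableSpace X] (ν : Measure X) (T : X → X)
    (hT : MeasurePreserving T ν ν) (v : Lp ℂ 2 ν) :
    compOp ν T hT v =ᵐ[ν] fun x => v (T x) :=
  Lp.coeFn_compMeasurePreserving v hT

theorem star_mulOp {X : Type*} [MeasurableSpace X] (ν : Measure X) (F : X → ℂ)
    (hF : BddMeas F) : star (mulOp ν F hF) = mulOp ν (fun x => conj (F x)) hF.conj := by
  rw [ContinuousLinearMap.star_eq_adjoint]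
  symm
  rw [ContinuousLinearMap.eq_adjoint_iff]
  intro u v
  rw [L2.inner_def, L2.inner_def]
  refine integral_congr_ae ?_
  filter_upwards [mulOp_ae ν F hF v, mulOp_ae ν _ hF.conj u] with x h1 h2
  rw [h1, h2]
  simp only [RCLike.inner_apply, map_mul, Complex.conj_conj]
  ring

theorem star_compOp {X : Type*} [MeasurableSpace X] (ν : Measure X) (T S : X → X)
    (hT : MeasurePreserving T ν ν) (hS : MeasurePreserving S ν ν) (hTS : ∀ x, S (T x) = x) :
    star (compOp ν T hT) = compOp ν S hS := by
  rw [ContinuousLinearMap.star_eq_adjoint]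
  symm
  rw [ContinuousLinearMap.eq_adjoint_iff]
  intro u v
  have hu : compOp ν T hT (compOp ν S hS u) = u := by
    apply Lp.ext
    filter_upwards [compOp_ae ν T hT (compOp ν S hS u),
      hT.quasiMeasurePreserving.ae (compOp_ae ν S hS u)] with x h1 h2
    rw [h1, h2, hTS]
  conv_rhs => rw [← hu]
  exact (LinearIsometry.inner_map_map (𝕜 := ℂ) (E := Lp ℂ 2 ν) (E' := Lp ℂ 2 ν)
    (Lp.compMeasurePreservingₗᵢ ℂ T hT) _ _).symm

/-- The conjugate linear isometry `v ↦ conj (v ∘ σ)` of `L²(X, ν)`. -/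
def conjComp {X : Type*} [MeasurableSpace X] (ν : Measure X) (T : X → X)
    (hT : MeasurePreserving T ν ν) : Lp ℂ 2 ν →ₗᵢ⋆[ℂ] Lp ℂ 2 ν where
  toFun v := star (compOp ν T hT v)
  map_add' u v := by
    rw [map_add]
    apply Lp.ext
    filter_upwards [Lp.coeFn_star (compOp ν T hT u + compOp ν T hT v),
      Lp.coeFn_add (compOp ν T hT u) (compOp ν T hT v),
      Lp.coeFn_add (star (compOp ν T hT u)) (star (compOp ν T hT v)),
      Lp.coeFn_star (compOp ν T hT u), Lp.coeFn_star (compOp ν T hT v)] with x h1 h2 h3 h4 h5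
    rw [h1, h3, Pi.star_apply, h2, Pi.add_apply, Pi.add_apply, h4, h5]
    simp
  map_smul' c v := by
    rw [map_smul]
    apply Lp.ext
    filter_upwards [Lp.coeFn_star (c • compOp ν T hT v), Lp.coeFn_smul c (compOp ν T hT v),
      Lp.coeFn_smul (starRingEnd ℂ c) (star (compOp ν T hT v)),
      Lp.coeFn_star (compOp ν T hT v)] with x h1 h2 h3 h4
    rw [h1, h3, Pi.star_apply, h2, Pi.smul_apply, Pi.smul_apply, h4]
    simp
  norm_map' v := by
    simp only [LinearMap.coe_mk, AddHom.coe_mk]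
    have h : ‖star (compOp ν T hT v)‖ = ‖compOp ν T hT v‖ := by
      rw [Lp.norm_def, Lp.norm_def, eLpNorm_congr_ae (Lp.coeFn_star _), eLpNorm_star]
    rw [h]
    exact (Lp.compMeasurePreservingₗᵢ ℂ T hT).norm_map v

theorem conjComp_ae {X : Type*} [MeasurableSpace X] (ν : Measure X) (T : X → X)
    (hT : MeasurePreserving T ν ν) (v : Lp ℂ 2 ν) :
    conjComp ν T hT v =ᵐ[ν] fun x => conj (v (T x)) := by
  filter_upwards [Lp.coeFn_star (compOp ν T hT v), compOp_ae ν T hT v] with x h1 h2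
  change star (compOp ν T hT v) x = _
  rw [h1, Pi.star_apply, h2]
  rfl

theorem conjComp_conjComp {X : Type*} [MeasurableSpace X] (ν : Measure X) (T : X → X)
    (hT : MeasurePreserving T ν ν) (hTT : ∀ x, T (T x) = x) (v : Lp ℂ 2 ν) :
    conjComp ν T hT (conjComp ν T hT v) = v := by
  apply Lp.ext
  filter_upwards [conjComp_ae ν T hT (conjComp ν T hT v),
    hT.quasiMeasurePreserving.ae (conjComp_ae ν T hT v)] with x h1 h2
  rw [h1, h2, hTT, Complex.conj_conj]

/-! ### von Neumann algebras and correspondences -/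

section Correspondences

universe u u₃ v w w' w₁ w₂ w₃

/-- The von Neumann algebra generated by a set of operators: the bicommutant of `S ∪ S*`. -/
def vnGen {H : Type u} [NormedAddCommGroup H] [InnerProductSpace ℂ H] [CompleteSpace H]
    (S : Set (H →L[ℂ] H)) : VonNeumannAlgebra H where
  toStarSubalgebra :=
    StarSubalgebra.centralizer ℂ (StarSubalgebra.centralizer ℂ S : Set (H →L[ℂ] H))
  centralizer_centralizer' := by
    change Set.centralizer (Set.centralizer
      ((StarSubalgebra.centralizer ℂ (StarSubalgebra.centralizer ℂ S : Set (H →L[ℂ] H)) :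
        StarSubalgebra ℂ (H →L[ℂ] H)) : Set (H →L[ℂ] H))) = _
    rw [StarSubalgebra.coe_centralizer, Set.centralizer_centralizer_centralizer]
    rfl

/-- A map from a von Neumann algebra on `H` to operators on `K` is normal if every vector
functional of it is a countable sum of vector functionals `x ↦ ⟪ζ n, x ζ n⟫` with
`∑ ‖ζ n‖² < ∞`. -/
def IsNormal {H : Type u} [NormedAddCommGroup H] [InnerProductSpace ℂ H] [CompleteSpace H]
    {K : Type v} [NormedAddCommGroup K] [InnerProductSpace ℂ K]
    (N : VonNeumannAlgebra H) (ρ : N.toStarSubalgebra → (K →L[ℂ] K)) : Prop :=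
  ∀ ξ : K, ∃ ζ : ℕ → H, Summable (fun n => ‖ζ n‖ ^ 2) ∧
    ∀ x : N.toStarSubalgebra, HasSum (fun n => ⟪ζ n, (x : H →L[ℂ] H) (ζ n)⟫_ℂ) ⟪ξ, ρ x ξ⟫_ℂ

/-- An `N`-`M`-correspondence: a Hilbert space with commuting normal left action of `N` and
right action of `M`. -/
structure Correspondence {H₁ : Type u} [NormedAddCommGroup H₁] [InnerProductSpace ℂ H₁]
    [CompleteSpace H₁] {H₂ : Type v} [NormedAddCommGroup H₂] [InnerProductSpace ℂ H₂]
    [CompleteSpace H₂] (N : VonNeumannAlgebra H₁) (M : VonNeumannAlgebra H₂) where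
  space : Type w
  [instNormed : NormedAddCommGroup space]
  [instInner : InnerProductSpace ℂ space]
  [instComplete : CompleteSpace space]
  left : N.toStarSubalgebra →⋆ₐ[ℂ] (space →L[ℂ] space)
  right : (M.toStarSubalgebra)ᵐᵒᵖ →⋆ₐ[ℂ] (space →L[ℂ] space)
  left_normal : IsNormal N left
  right_normal : IsNormal M (fun y => right (MulOpposite.op y))
  comm : ∀ x y, Commute (left x) (right y)

attribute [instance] Correspondence.instNormed Correspondence.instInner
  Correspondence.instComplete

section Bimodules

variable {H₁ : Type u} [NormedAddCommGroup H₁] [InnerProductSpace ℂ H₁] [CompleteSpace H₁]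
  {H₂ : Type v} [NormedAddCommGroup H₂] [InnerProductSpace ℂ H₂] [CompleteSpace H₂]
  {N : VonNeumannAlgebra H₁} {M : VonNeumannAlgebra H₂}

/-- The vector `x · ξ · y`. -/
def Correspondence.act (K : Correspondence.{u, v, w} N M) (x : N.toStarSubalgebra)
    (ξ : K.space) (y : M.toStarSubalgebra) : K.space :=
  K.left x (K.right (MulOpposite.op y) ξ)

/-- Weak containment `K ≺ H`: every coefficient of a unit vector of `K` is approximated, on finite
sets, by finite sums of coefficients of `H`. -/
def WeaklyContained (K : Correspondence.{u, v, w} N M) (H : Correspondence.{u, v, w'} N M) :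
    Prop :=
  ∀ ε : ℝ, 0 < ε → ∀ (E : Finset N.toStarSubalgebra) (F : Finset M.toStarSubalgebra),
    ∀ ξ : K.space, ‖ξ‖ = 1 → ∃ (m : ℕ) (η : Fin m → H.space), ∀ x ∈ E, ∀ y ∈ F,
      ‖⟪ξ, K.act x ξ y⟫_ℂ - ∑ j, ⟪η j, H.act x (η j) y⟫_ℂ‖ < ε

/-- `K` is the contragredient of `H`: the conjugate Hilbert space (`c` is the conjugate linear
identification `ξ ↦ ξ̄`) with the actions `x · ξ̄ · y = conj (y* · ξ · x*)`. -/
def IsContragredient (H : Correspondence.{u, v, w} N M) (K : Correspondence.{v, u, w'} M N)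
    (c : H.space ≃ₗᵢ⋆[ℂ] K.space) : Prop :=
  ∀ (x : M.toStarSubalgebra) (ξ : H.space) (y : N.toStarSubalgebra),
    K.act x (c ξ) y = c (H.act (star y) ξ (star x))

/-- `H` is the GNS correspondence `H(Φ)` of a completely positive map `Φ : N → M`: it is generated
by vectors `t x y = x ⊗ y`, with `x ∈ N` and `y` in `𝔑 = M ∩ L²(M)`, whose inner products are
`⟪x₁ ⊗ y₁, x₂ ⊗ y₂⟫ = τ (y₁* Φ(x₁* x₂) y₂)`, and the actions are `a · (x ⊗ y) · b = a x ⊗ y b`.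
Here `L` is the trivial correspondence `L²(M)` and `Λ y v` says that `y ∈ 𝔑` and that `v` is the
vector of `L²(M)` given by `y`, so that `τ (y₁* a y₂) = ⟪v₁, a v₂⟫`.  These requirements determine
`H` up to a unique unitary isomorphism of correspondences. -/
structure IsGNSCorrespondence (L : Correspondence.{v, v, w} M M)
    (Λ : M.toStarSubalgebra → L.space → Prop)
    (Φ : N.toStarSubalgebra → M.toStarSubalgebra) (H : Correspondence.{u, v, w'} N M)
    (t : N.toStarSubalgebra → M.toStarSubalgebra → H.space) : Prop where
  inner_eq : ∀ x₁ x₂ y₁ y₂ v₁ v₂, Λ y₁ v₁ → Λ y₂ v₂ →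
    ⟪t x₁ y₁, t x₂ y₂⟫_ℂ = ⟪v₁, L.left (Φ (star x₁ * x₂)) v₂⟫_ℂ
  dense : (Submodule.span ℂ {ζ | ∃ x y v, Λ y v ∧ ζ = t x y}).topologicalClosure = ⊤
  act_eq : ∀ a x y b v, Λ y v → H.act a (t x y) b = t (a * x) (y * b)

/-- `ξ` is left-bounded: `y ↦ ξ · y` extends to a bounded operator `L_ξ : L²(M) → H`. -/
def LeftBounded (L : Correspondence.{v, v, w} M M) (Λ : M.toStarSubalgebra → L.space → Prop)
    (H : Correspondence.{u, v, w'} N M) (ξ : H.space) : Prop :=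
  ∃ C : ℝ, ∀ y v, Λ y v → ‖H.act 1 ξ y‖ ≤ C * ‖v‖

/-- `a ∈ M` is the `M`-valued inner product `⟪ξ₁, ξ₂⟫_M = L_ξ₁* L_ξ₂`. -/
def IsAlgInner (L : Correspondence.{v, v, w} M M) (Λ : M.toStarSubalgebra → L.space → Prop)
    (H : Correspondence.{u, v, w'} N M) (ξ₁ ξ₂ : H.space) (a : M.toStarSubalgebra) : Prop :=
  ∀ y₁ y₂ v₁ v₂, Λ y₁ v₁ → Λ y₂ v₂ →
    ⟪H.act 1 ξ₁ y₁, H.act 1 ξ₂ y₂⟫_ℂ = ⟪v₁, L.left a v₂⟫_ℂ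

/-- `F` is the Connes tensor product `H ⊗_M K`: it is generated by vectors `t ξ η = ξ ⊗ η`, with
`ξ ∈ H` left-bounded and `η ∈ K`, whose inner products are
`⟪ξ₁ ⊗ η₁, ξ₂ ⊗ η₂⟫ = ⟪η₁, ⟪ξ₁, ξ₂⟫_M · η₂⟫`, and the actions are
`x · (ξ ⊗ η) · y = (x · ξ) ⊗ (η · y)`.  These requirements determine `F` up to a unique unitary
isomorphism of correspondences. -/
structure IsConnesTensor {H₃ : Type u₃} [NormedAddCommGroup H₃] [InnerProductSpace ℂ H₃]
    [CompleteSpace H₃] {Q : VonNeumannAlgebra H₃}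
    (L : Correspondence.{v, v, w} M M) (Λ : M.toStarSubalgebra → L.space → Prop)
    (H : Correspondence.{u, v, w₁} N M) (K : Correspondence.{v, u₃, w₂} M Q)
    (F : Correspondence.{u, u₃, w₃} N Q) (t : H.space → K.space → F.space) : Prop where
  inner_eq : ∀ ξ₁ ξ₂, LeftBounded L Λ H ξ₁ → LeftBounded L Λ H ξ₂ →
    ∃ a, IsAlgInner L Λ H ξ₁ ξ₂ a ∧
      ∀ η₁ η₂, ⟪t ξ₁ η₁, t ξ₂ η₂⟫_ℂ = ⟪η₁, K.left a η₂⟫_ℂ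
  dense : (Submodule.span ℂ {ζ | ∃ ξ η, LeftBounded L Λ H ξ ∧ ζ = t ξ η}).topologicalClosure = ⊤
  act_eq : ∀ x ξ η y, LeftBounded L Λ H ξ →
    F.act x (t ξ η) y = t (H.act x ξ 1) (K.act 1 η y)

/-- Left amenability of an `N`-`M`-correspondence `H`: the trivial correspondence `LN = L²(N)` is
weakly contained in `H ⊗_M H̄`. -/
def Correspondence.LeftAmenable (LN : Correspondence.{u, u, w₁} N N)
    (L : Correspondence.{v, v, w} M M) (Λ : M.toStarSubalgebra → L.space → Prop)
    (H : Correspondence.{u, v, w} N M) : Prop :=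
  ∃ (K : Correspondence.{v, u, w} M N) (c : H.space ≃ₗᵢ⋆[ℂ] K.space)
    (F : Correspondence.{u, u, w} N N) (t : H.space → K.space → F.space),
    IsContragredient H K c ∧ IsConnesTensor L Λ H K F t ∧ WeaklyContained LN F

/-- Left amenability of a map `Φ : N → M`: the correspondence `H(Φ)` is left amenable. -/
def IsAmenableMap (LN : Correspondence.{u, u, w₁} N N)
    (L : Correspondence.{v, v, w} M M) (Λ : M.toStarSubalgebra → L.space → Prop)
    (Φ : N.toStarSubalgebra → M.toStarSubalgebra) : Prop :=
  ∃ (H : Correspondence.{u, v, w} N M) (t : N.toStarSubalgebra → M.toStarSubalgebra → H.space),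
    IsGNSCorrespondence L Λ Φ H t ∧ Correspondence.LeftAmenable LN L Λ H

end Bimodules

/-! #### The trivial correspondence of an algebra in standard form -/

section Standard

variable {H : Type u} [NormedAddCommGroup H] [InnerProductSpace ℂ H] [CompleteSpace H]

/-- The operator `J a J`. -/
def conjBy (J : H →ₗᵢ⋆[ℂ] H) (a : H →L[ℂ] H) : H →L[ℂ] H :=
  (J.toContinuousLinearMap.comp a).comp J.toContinuousLinearMap

@[simp] theorem conjBy_apply (J : H →ₗᵢ⋆[ℂ] H) (a : H →L[ℂ] H) (v : H) :
    conjBy J a v = J (a (J v)) := rfl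

theorem conjBy_conjBy {J : H →ₗᵢ⋆[ℂ] H} (hJ : ∀ v, J (J v) = v) (a : H →L[ℂ] H) :
    conjBy J (conjBy J a) = a := by
  ext v; simp [hJ]

theorem conjBy_mul {J : H →ₗᵢ⋆[ℂ] H} (hJ : ∀ v, J (J v) = v) (a b : H →L[ℂ] H) :
    conjBy J (a * b) = conjBy J a * conjBy J b := by
  ext v; simp [hJ]

theorem inner_conj_conj (J : H →ₗᵢ⋆[ℂ] H) (a b : H) : ⟪J a, J b⟫_ℂ = ⟪b, a⟫_ℂ := by
  have h1 : ∀ x y : H, RCLike.re ⟪J x, J y⟫_ℂ = RCLike.re ⟪x, y⟫_ℂ := by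
    intro x y
    have h := norm_add_sq (𝕜 := ℂ) (J x) (J y)
    have h' := norm_add_sq (𝕜 := ℂ) x y
    rw [← map_add, J.norm_map, J.norm_map, J.norm_map] at h
    linarith
  apply Complex.ext
  · have := h1 a b
    rw [inner_re_symm (𝕜 := ℂ) a b] at this
    exact this
  · have h := h1 a (Complex.I • b)
    rw [map_smulₛₗ, inner_smul_right, inner_smul_right] at h
    have h2 := inner_im_symm (𝕜 := ℂ) a b
    simp at h h2 ⊢
    linarith

theorem inner_conj_left {J : H →ₗᵢ⋆[ℂ] H} (hJ : ∀ v, J (J v) = v) (a b : H) :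
    ⟪J a, b⟫_ℂ = ⟪J b, a⟫_ℂ := by
  conv_lhs => rw [← hJ b]
  exact inner_conj_conj J a (J b)

theorem star_conjBy {J : H →ₗᵢ⋆[ℂ] H} (hJ : ∀ v, J (J v) = v) (a : H →L[ℂ] H) :
    star (conjBy J a) = conjBy J (star a) := by
  rw [ContinuousLinearMap.star_eq_adjoint]
  symm
  rw [ContinuousLinearMap.eq_adjoint_iff]
  intro u v
  rw [conjBy_apply, conjBy_apply, inner_conj_left hJ, ContinuousLinearMap.star_eq_adjoint,
    ContinuousLinearMap.adjoint_inner_right, ← inner_conj_conj J (J u), hJ]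

theorem isNormal_coe (N : VonNeumannAlgebra H) :
    IsNormal N (fun x => (x : H →L[ℂ] H)) := by
  intro ξ
  refine ⟨fun n => if n = 0 then ξ else 0, ?_, fun x => ?_⟩
  · refine summable_of_ne_finset_zero (s := {0}) fun n hn => ?_
    simp at hn
    simp [hn]
  · have := hasSum_single (f := fun n : ℕ => ⟪(if n = 0 then ξ else 0),
      (x : H →L[ℂ] H) (if n = 0 then ξ else 0)⟫_ℂ) 0 (fun n hn => by simp [hn])
    simpa using this

theorem conjBy_commute {S : Set (H →L[ℂ] H)} (hS : ∀ a ∈ S, star a ∈ S) {J : H →ₗᵢ⋆[ℂ] H}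
    (hJ : ∀ v, J (J v) = v) (hc : ∀ a ∈ S, ∀ b ∈ S, Commute (conjBy J a) b)
    {x y : H →L[ℂ] H} (hx : x ∈ vnGen S) (hy : y ∈ vnGen S) : Commute x (conjBy J y) := by
  have hmem : ∀ z ∈ vnGen S, ∀ b : H →L[ℂ] H, (∀ a ∈ S, Commute a b) → Commute b z := by
    intro z hz b hb
    have hz' : z ∈ StarSubalgebra.centralizer ℂ
      (StarSubalgebra.centralizer ℂ S : Set (H →L[ℂ] H)) := hz
    rw [StarSubalgebra.mem_centralizer_iff] at hz'
    refine (hz' b ?_).1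
    rw [SetLike.mem_coe, StarSubalgebra.mem_centralizer_iff]
    exact fun a ha => ⟨hb a ha, hb _ (hS a ha)⟩
  have h1 : ∀ a ∈ S, Commute (conjBy J a) y := fun a ha =>
    hmem y hy _ fun b hb => (hc a ha b hb).symm
  have h2 : ∀ a ∈ S, Commute a (conjBy J y) := by
    intro a ha
    have := congrArg (conjBy J) (h1 a ha).eq
    rw [conjBy_mul hJ, conjBy_mul hJ, conjBy_conjBy hJ] at this
    exact this
  exact (hmem x hx _ h2).symm

/-- The trivial correspondence of a von Neumann algebra in standard form with modular
conjugation `J`: the left action is the given one, the right action is `ξ · y = J y* J ξ`. -/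
def standardCorr (S : Set (H →L[ℂ] H)) (hS : ∀ a ∈ S, star a ∈ S) (J : H →ₗᵢ⋆[ℂ] H)
    (hJ : ∀ v, J (J v) = v) (hc : ∀ a ∈ S, ∀ b ∈ S, Commute (conjBy J a) b) :
    Correspondence.{u, u, u} (vnGen S) (vnGen S) where
  space := H
  left := (vnGen S).toStarSubalgebra.subtype
  right :=
    { toFun := fun y => conjBy J (star (y.unop : H →L[ℂ] H))
      map_one' := by ext v; simp [hJ]
      map_mul' := fun a b => by simp [conjBy_mul hJ]
      map_zero' := by ext v; simp
      map_add' := fun a b => by ext v; simp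
      commutes' := fun r => by
        ext v
        simp [Algebra.algebraMap_eq_smul_one, map_smulₛₗ, hJ]
      map_star' := fun a => by
        rw [star_conjBy hJ]
        simp }
  left_normal := isNormal_coe _
  right_normal := by
    intro ξ
    obtain ⟨ζ, h1, h2⟩ := isNormal_coe (vnGen S) (J ξ)
    refine ⟨ζ, h1, fun x => ?_⟩
    convert h2 x using 1
    change ⟪ξ, conjBy J (star (x : H →L[ℂ] H)) ξ⟫_ℂ = _
    rw [conjBy_apply, ← inner_conj_conj J, hJ, ContinuousLinearMap.star_eq_adjoint,
      ContinuousLinearMap.adjoint_inner_left]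
  comm := fun x y => conjBy_commute hS hJ hc x.2 (star_mem y.unop.2)

end Standard

end Correspondences

theorem compOp_commute {X : Type*} [MeasurableSpace X] (ν : Measure X) {T S : X → X}
    (hT : MeasurePreserving T ν ν) (hS : MeasurePreserving S ν ν)
    (h : ∀ x, T (S x) = S (T x)) : Commute (compOp ν T hT) (compOp ν S hS) := by
  ext1 v
  apply Lp.ext
  change compOp ν T hT (compOp ν S hS v) =ᵐ[ν] compOp ν S hS (compOp ν T hT v)
  filter_upwards [compOp_ae ν T hT (compOp ν S hS v), compOp_ae ν S hS (compOp ν T hT v),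
    hT.quasiMeasurePreserving.ae (compOp_ae ν S hS v),
    hS.quasiMeasurePreserving.ae (compOp_ae ν T hT v)] with x h1 h2 h3 h4
  rw [h1, h2, h3, h4, h]

theorem mulOp_commute {X : Type*} [MeasurableSpace X] (ν : Measure X) {F G : X → ℂ}
    (hF : BddMeas F) (hG : BddMeas G) : Commute (mulOp ν F hF) (mulOp ν G hG) := by
  ext1 v
  apply Lp.ext
  change mulOp ν F hF (mulOp ν G hG v) =ᵐ[ν] mulOp ν G hG (mulOp ν F hF v)
  filter_upwards [mulOp_ae ν F hF (mulOp ν G hG v), mulOp_ae ν G hG (mulOp ν F hF v),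
    mulOp_ae ν G hG v, mulOp_ae ν F hF v] with x h1 h2 h3 h4
  rw [h1, h2, h3, h4]
  ring

theorem compOp_mulOp_commute {X : Type*} [MeasurableSpace X] (ν : Measure X) {T : X → X}
    {F : X → ℂ} (hT : MeasurePreserving T ν ν) (hF : BddMeas F) (h : ∀ x, F (T x) = F x) :
    Commute (compOp ν T hT) (mulOp ν F hF) := by
  ext1 v
  apply Lp.ext
  change compOp ν T hT (mulOp ν F hF v) =ᵐ[ν] mulOp ν F hF (compOp ν T hT v)
  filter_upwards [compOp_ae ν T hT (mulOp ν F hF v), mulOp_ae ν F hF (compOp ν T hT v),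
    hT.quasiMeasurePreserving.ae (mulOp_ae ν F hF v), compOp_ae ν T hT v] with x h1 h2 h3 h4
  rw [h1, h2, h3, h4, h]

theorem conjBy_compOp {X : Type*} [MeasurableSpace X] (ν : Measure X) {σ T S : X → X}
    (hσ : MeasurePreserving σ ν ν) (hT : MeasurePreserving T ν ν) (hS : MeasurePreserving S ν ν)
    (h : ∀ x, σ (T (σ x)) = S x) :
    conjBy (conjComp ν σ hσ) (compOp ν T hT) = compOp ν S hS := by
  ext1 v
  apply Lp.ext
  rw [conjBy_apply]
  filter_upwards [conjComp_ae ν σ hσ (compOp ν T hT (conjComp ν σ hσ v)), compOp_ae ν S hS v,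
    hσ.quasiMeasurePreserving.ae (compOp_ae ν T hT (conjComp ν σ hσ v)),
    (hT.comp hσ).quasiMeasurePreserving.ae (conjComp_ae ν σ hσ v)] with x h1 h2 h3 h4
  rw [h1, h2, h3]
  simp only [Function.comp_apply] at h4
  rw [h4, Complex.conj_conj, h]

theorem conjBy_mulOp {X : Type*} [MeasurableSpace X] (ν : Measure X) {σ : X → X} {F G : X → ℂ}
    (hσ : MeasurePreserving σ ν ν) (hF : BddMeas F) (hG : BddMeas G) (hσσ : ∀ x, σ (σ x) = x)
    (h : ∀ x, conj (F (σ x)) = G x) :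
    conjBy (conjComp ν σ hσ) (mulOp ν F hF) = mulOp ν G hG := by
  ext1 v
  apply Lp.ext
  rw [conjBy_apply]
  filter_upwards [conjComp_ae ν σ hσ (mulOp ν F hF (conjComp ν σ hσ v)), mulOp_ae ν G hG v,
    hσ.quasiMeasurePreserving.ae (mulOp_ae ν F hF (conjComp ν σ hσ v)),
    hσ.quasiMeasurePreserving.ae (conjComp_ae ν σ hσ v)] with x h1 h2 h3 h4
  rw [h1, h2, h3, map_mul, h4, hσσ, Complex.conj_conj, h]

/-! ### The group von Neumann algebra -/

section GroupAlgebra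

variable {Γ : Type*} [Group Γ] [Countable Γ] [MeasurableSpace Γ] [DiscreteMeasurableSpace Γ]

theorem measurePreserving_count {Γ : Type*} [MeasurableSpace Γ] [DiscreteMeasurableSpace Γ]
    (e : Γ ≃ Γ) : MeasurePreserving e (Measure.count : Measure Γ) Measure.count := by
  refine ⟨Measurable.of_discrete, ?_⟩
  ext s hs
  rw [Measure.map_apply Measurable.of_discrete hs, ← Measure.count_injective_image e.injective,
    Set.image_preimage_eq _ e.surjective]

variable (Γ) in
/-- `ℓ²(Γ)`, as the `L²` space of the counting measure. -/
abbrev ell2 : Type _ := Lp ℂ 2 (Measure.count : Measure Γ)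

/-- The left regular representation, `λ_g δ_h = δ_{gh}`. -/
def lam (g : Γ) : ell2 Γ →L[ℂ] ell2 Γ :=
  compOp Measure.count (fun h => g⁻¹ * h) (measurePreserving_count (Equiv.mulLeft g⁻¹))

variable (Γ) in
/-- The modular conjugation of `ℒΓ`, `(J ξ)(g) = conj (ξ (g⁻¹))`. -/
def groupJ : ell2 Γ →ₗᵢ⋆[ℂ] ell2 Γ :=
  conjComp Measure.count (fun h => h⁻¹) (measurePreserving_count (Equiv.inv Γ))

theorem star_lam (g : Γ) : star (lam g) = lam g⁻¹ :=
  star_compOp _ _ _ _ _ fun x => by simp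

theorem groupJ_groupJ (v : ell2 Γ) : groupJ Γ (groupJ Γ v) = v :=
  conjComp_conjComp _ _ _ (by simp) v

theorem groupJ_commute : ∀ a ∈ Set.range (lam (Γ := Γ)), ∀ b ∈ Set.range (lam (Γ := Γ)),
    Commute (conjBy (groupJ Γ) a) b := by
  rintro _ ⟨g, rfl⟩ _ ⟨h, rfl⟩
  have := conjBy_compOp Measure.count (measurePreserving_count (Equiv.inv Γ))
    (measurePreserving_count (Equiv.mulLeft g⁻¹)) (measurePreserving_count (Equiv.mulRight g))
    (by simp)
  rw [groupJ, lam]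
  refine this.symm ▸ compOp_commute _ _ _ fun x => ?_
  simp [mul_assoc]

variable (Γ) in
/-- The group von Neumann algebra `ℒΓ = {λ_g}''` on `ℓ²(Γ)`. -/
def groupVN : VonNeumannAlgebra (ell2 Γ) := vnGen (Set.range lam)

theorem mem_vnGen {H : Type*} [NormedAddCommGroup H] [InnerProductSpace ℂ H] [CompleteSpace H]
    {S : Set (H →L[ℂ] H)} {a : H →L[ℂ] H} (ha : a ∈ S) : a ∈ vnGen S := by
  change a ∈ StarSubalgebra.centralizer ℂ (StarSubalgebra.centralizer ℂ S : Set (H →L[ℂ] H))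
  rw [StarSubalgebra.mem_centralizer_iff]
  intro g hg
  have h1 := (StarSubalgebra.mem_centralizer_iff ℂ).1 hg a ha
  have h2 := (StarSubalgebra.mem_centralizer_iff ℂ).1 (star_mem hg) a ha
  exact ⟨h1.1.symm, h2.1.symm⟩

/-- `λ_g` as an element of `ℒΓ`. -/
def lamVN (g : Γ) : (groupVN Γ).toStarSubalgebra := ⟨lam g, mem_vnGen ⟨g, rfl⟩⟩

variable (Γ) in
/-- The trivial correspondence `L²(ℒΓ)`.  The GNS space of the trace `τ x = ⟪δ_e, x δ_e⟫` is
identified with `ℓ²(Γ)` by `x ↦ x δ_e`, that is, `λ_g ↦ δ_g`. -/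
def L2Group : Correspondence (groupVN Γ) (groupVN Γ) :=
  standardCorr (Set.range lam) (by rintro _ ⟨g, rfl⟩; exact ⟨g⁻¹, (star_lam g).symm⟩)
    (groupJ Γ) groupJ_groupJ groupJ_commute

end GroupAlgebra

/-! ### The crossed product -/

section CrossedProduct

variable {Γ : Type*} [Group Γ] [Countable Γ] [MeasurableSpace Γ] [DiscreteMeasurableSpace Γ]
  {Ω : Type*} [MeasurableSpace Ω] [MulAction Γ Ω] [MeasurableConstSMul Γ Ω]
  (μ : Measure Ω) [SigmaFinite μ] [SMulInvariantMeasure Γ Ω μ]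

variable (Γ) in
/-- The measure of `Ω × Γ`: the product of `μ` and the counting measure. -/
abbrev prodMeasure {Ω : Type*} [MeasurableSpace Ω] (μ : Measure Ω) : Measure (Ω × Γ) :=
  μ.prod Measure.count

variable (Γ) in
/-- `L²(Ω × Γ) = L²(Ω) ⊗ ℓ²(Γ)`. -/
abbrev L2Prod {Ω : Type*} [MeasurableSpace Ω] (μ : Measure Ω) : Type _ :=
  Lp ℂ 2 (prodMeasure Γ μ)

theorem mp_snd (e : Γ ≃ Γ) :
    MeasurePreserving (fun p : Ω × Γ => (p.1, e p.2)) (prodMeasure Γ μ) (prodMeasure Γ μ) :=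
  (MeasurePreserving.id μ).prod (measurePreserving_count e)

theorem mp_prod (g : Γ) (e : Γ ≃ Γ) :
    MeasurePreserving (fun p : Ω × Γ => (g • p.1, e p.2)) (prodMeasure Γ μ) (prodMeasure Γ μ) :=
  (measurePreserving_smul g μ).prod (measurePreserving_count e)

theorem measurable_act : Measurable (fun p : Ω × Γ => p.2 • p.1) :=
  measurable_from_prod_countable_left fun g => measurable_const_smul g

theorem mp_flip :
    MeasurePreserving (fun p : Ω × Γ => (p.2 • p.1, p.2⁻¹)) (prodMeasure Γ μ)
      (prodMeasure Γ μ) := by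
  have h1 : MeasurePreserving (fun p : Γ × Ω => (p.1⁻¹, p.1 • p.2))
      ((Measure.count : Measure Γ).prod μ) (Measure.count.prod μ) :=
    (measurePreserving_count (Equiv.inv Γ)).skew_product (g := fun (g : Γ) (ω : Ω) => g • ω)
      ((measurable_act (Γ := Γ) (Ω := Ω)).comp measurable_swap)
      (ae_of_all _ fun g => (measurePreserving_smul g μ).map_eq)
  exact (Measure.measurePreserving_swap.comp h1).comp Measure.measurePreserving_swap

/-- `1 ⊗ λ_g`. -/
def translOp (g : Γ) : L2Prod Γ μ →L[ℂ] L2Prod Γ μ :=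
  compOp _ (fun p => (p.1, g⁻¹ * p.2)) (mp_snd μ (Equiv.mulLeft g⁻¹))

/-- The operator `∑_h θ_{h⁻¹}(f) ⊗ e_{h,h}` for `f ∈ L^∞(Ω)`, where
`θ_g(f)(ω) = f (g⁻¹ • ω)`: multiplication by `(ω, h) ↦ f (h • ω)`. -/
def diagOp (f : Ω → ℂ) (hf : BddMeas f) : L2Prod Γ μ →L[ℂ] L2Prod Γ μ :=
  mulOp _ (fun p => f (p.2 • p.1)) (hf.comp measurable_act)

variable (Γ) in
/-- The generators of the crossed product. -/
def crossedGens : Set (L2Prod Γ μ →L[ℂ] L2Prod Γ μ) :=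
  {a | (∃ g, a = translOp μ g) ∨ ∃ f hf, a = diagOp μ f hf}

variable (Γ) in
/-- The crossed product `L^∞(Ω) ⋊ Γ`, acting on `L²(Ω) ⊗ ℓ²(Γ)`. -/
def crossedVN : VonNeumannAlgebra (L2Prod Γ μ) := vnGen (crossedGens Γ μ)

variable (Γ) in
/-- The modular conjugation of the crossed product, `(J v)(ω, g) = conj (v (g • ω, g⁻¹))`. -/
def crossedJ : L2Prod Γ μ →ₗᵢ⋆[ℂ] L2Prod Γ μ :=
  conjComp _ (fun p => (p.2 • p.1, p.2⁻¹)) (mp_flip μ)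

theorem star_mem_crossedGens : ∀ a ∈ crossedGens Γ μ, star a ∈ crossedGens Γ μ := by
  rintro _ (⟨g, rfl⟩ | ⟨f, hf, rfl⟩)
  · exact Or.inl ⟨g⁻¹, star_compOp _ _ _ _ _ fun x => by simp⟩
  · exact Or.inr ⟨_, hf.conj, star_mulOp _ _ _⟩

theorem crossedJ_crossedJ (v : L2Prod Γ μ) : crossedJ Γ μ (crossedJ Γ μ v) = v :=
  conjComp_conjComp _ _ _ (by simp) v

theorem conjBy_translOp (g : Γ) : conjBy (crossedJ Γ μ) (translOp μ g) =
    compOp _ (fun p => (g⁻¹ • p.1, p.2 * g)) (mp_prod μ g⁻¹ (Equiv.mulRight g)) :=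
  conjBy_compOp _ (mp_flip μ) (mp_snd μ (Equiv.mulLeft g⁻¹))
    (mp_prod μ g⁻¹ (Equiv.mulRight g)) fun x => by simp [mul_smul]

theorem conjBy_diagOp (f : Ω → ℂ) (hf : BddMeas f) : conjBy (crossedJ Γ μ) (diagOp μ f hf) =
    mulOp (prodMeasure Γ μ) (fun p : Ω × Γ => conj (f p.1))
      (hf.conj.comp (T := Prod.fst) measurable_fst) :=
  conjBy_mulOp _ (mp_flip μ) (hf.comp measurable_act)
    (hf.conj.comp (T := Prod.fst) measurable_fst) (by simp) (by simp)

theorem crossedJ_commute (a : L2Prod Γ μ →L[ℂ] L2Prod Γ μ) (ha : a ∈ crossedGens Γ μ)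
    (b : L2Prod Γ μ →L[ℂ] L2Prod Γ μ) (hb : b ∈ crossedGens Γ μ) :
    Commute (conjBy (crossedJ Γ μ) a) b := by
  rcases ha with ⟨g, rfl⟩ | ⟨f, hf, rfl⟩
  · rw [conjBy_translOp]
    rcases hb with ⟨h, rfl⟩ | ⟨k, hk, rfl⟩
    · exact compOp_commute _ (mp_prod μ g⁻¹ (Equiv.mulRight g)) (mp_snd μ (Equiv.mulLeft h⁻¹))
        fun x => by simp [mul_assoc]
    · exact compOp_mulOp_commute _ (mp_prod μ g⁻¹ (Equiv.mulRight g)) (hk.comp measurable_act)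
        fun x => by simp [mul_smul]
  · rw [conjBy_diagOp]
    rcases hb with ⟨h, rfl⟩ | ⟨k, hk, rfl⟩
    · exact (compOp_mulOp_commute _ (mp_snd μ (Equiv.mulLeft h⁻¹))
        (hf.conj.comp (T := Prod.fst) measurable_fst) fun x => by simp).symm
    · exact mulOp_commute _ (hf.conj.comp (T := Prod.fst) measurable_fst) (hk.comp measurable_act)

variable (Γ) in
/-- The trivial correspondence `L²(Ω ⋊ Γ)` of the crossed product.  The GNS space of the trace
`τ_⋊ = μ ∘ E` is identified with `L²(Ω × Γ)` so that the left action is the defining one: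
`f ⋊ λ_g ↦ θ_{g⁻¹}(f) ⊗ δ_g` for `f ∈ L^∞(Ω) ∩ L²(Ω)`. -/
def L2Crossed : Correspondence (crossedVN Γ μ) (crossedVN Γ μ) :=
  standardCorr (crossedGens Γ μ) (star_mem_crossedGens μ) (crossedJ Γ μ) (crossedJ_crossedJ μ)
    (crossedJ_commute μ)

variable (Γ) in
/-- Multiplication by `1_A ⊗ 1`. -/
def cutOp {A : Set Ω} (hA : MeasurableSet A) : L2Prod Γ μ →L[ℂ] L2Prod Γ μ :=
  mulOp _ (fun p => A.indicator (fun _ => (1 : ℂ)) p.1)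
    ((BddMeas.indicator hA).comp measurable_fst)

variable (Γ) in
/-- The vector `1_A ⊗ δ_e`. -/
def cutVec {A : Set Ω} (hA : MeasurableSet A) (hμA : μ A ≠ ∞) : L2Prod Γ μ :=
  indicatorConstLp 2 (s := A ×ˢ {(1 : Γ)}) (hA.prod (measurableSet_singleton 1))
    (by rw [Measure.prod_prod]; simpa using hμA) (1 : ℂ)

variable (Γ) in
/-- The canonical trace `τ_⋊ x = ∫ E(x) dμ` for `x ≥ 0` in the crossed product, where `E = id ⊗ τ`
is the conditional expectation onto `L^∞(Ω)`: as `∫_A E(x) dμ = ⟪1_A ⊗ δ_e, x (1_A ⊗ δ_e)⟫`, it is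
the supremum of these numbers over the sets `A` of finite measure. -/
def crossedTrace (x : L2Prod Γ μ →L[ℂ] L2Prod Γ μ) : ℝ≥0∞ :=
  ⨆ (A : Set Ω) (hA : MeasurableSet A) (hμA : μ A ≠ ∞),
    ENNReal.ofReal (RCLike.re ⟪cutVec Γ μ hA hμA, x (cutVec Γ μ hA hμA)⟫_ℂ)

variable (Γ) in
/-- `x ∈ L^∞(Ω) ⋊ Γ` is square integrable and `v ∈ L²(Ω ⋊ Γ)` is its GNS vector: the component of
`v` over each set `A` of finite measure, `v · 1_A`, is `x (1_A ⊗ δ_e)`. -/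
def GNSVec (x : (crossedVN Γ μ).toStarSubalgebra) (v : L2Prod Γ μ) : Prop :=
  ∀ (A : Set Ω) (hA : MeasurableSet A) (hμA : μ A ≠ ∞),
    (x : L2Prod Γ μ →L[ℂ] L2Prod Γ μ) (cutVec Γ μ hA hμA) = cutOp Γ μ hA v

theorem enorm_cutOp_sq {A : Set Ω} (hA : MeasurableSet A) (v : L2Prod Γ μ) :
    ENNReal.ofReal (‖cutOp Γ μ hA v‖ ^ 2) = ∫⁻ p in A ×ˢ Set.univ, ‖v p‖ₑ ^ 2 ∂(prodMeasure Γ μ) := by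
  have h0 : ENNReal.ofReal (‖cutOp Γ μ hA v‖ ^ 2) =
      eLpNorm (cutOp Γ μ hA v) 2 (prodMeasure Γ μ) ^ 2 := by
    rw [ENNReal.ofReal_pow (norm_nonneg _), Lp.norm_def, ENNReal.ofReal_toReal (Lp.eLpNorm_ne_top _)]
  have h1 : cutOp Γ μ hA v =ᵐ[prodMeasure Γ μ] (A ×ˢ (Set.univ : Set Γ)).indicator v := by
    filter_upwards [mulOp_ae (prodMeasure Γ μ) (fun p => A.indicator (fun _ => (1 : ℂ)) p.1)
      ((BddMeas.indicator hA).comp measurable_fst) v] with p hp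
    refine hp.trans ?_
    by_cases h : p.1 ∈ A <;> simp [h]
  rw [h0, eLpNorm_congr_ae h1, eLpNorm_indicator_eq_eLpNorm_restrict (hA.prod .univ),
    eLpNorm_eq_lintegral_rpow_enorm_toReal (by simp) (by simp), ← ENNReal.rpow_natCast,
    ← ENNReal.rpow_mul]
  simp

/-- `‖v‖² = τ_⋊(x* x)` for the GNS vector `v` of `x`. -/
theorem GNSVec.crossedTrace_eq {x : (crossedVN Γ μ).toStarSubalgebra} {v : L2Prod Γ μ}
    (h : GNSVec Γ μ x v) :
    crossedTrace Γ μ (star (x : L2Prod Γ μ →L[ℂ] L2Prod Γ μ) * x) = ENNReal.ofReal (‖v‖ ^ 2) := by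
  have key : ∀ (A : Set Ω) (hA : MeasurableSet A) (hμA : μ A ≠ ∞),
      ENNReal.ofReal (RCLike.re ⟪cutVec Γ μ hA hμA,
        (star (x : L2Prod Γ μ →L[ℂ] L2Prod Γ μ) * x) (cutVec Γ μ hA hμA)⟫_ℂ) =
      ∫⁻ p in A ×ˢ Set.univ, ‖v p‖ₑ ^ 2 ∂(prodMeasure Γ μ) := by
    intro A hA hμA
    rw [← enorm_cutOp_sq μ hA, ← h A hA hμA, mul_apply_eq_comp,
      ContinuousLinearMap.star_eq_adjoint, ContinuousLinearMap.adjoint_inner_right,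
      inner_self_eq_norm_sq]
  have huniv : ENNReal.ofReal (‖v‖ ^ 2) = ∫⁻ p, ‖v p‖ₑ ^ 2 ∂(prodMeasure Γ μ) := by
    rw [ENNReal.ofReal_pow (norm_nonneg _), Lp.norm_def,
      ENNReal.ofReal_toReal (Lp.eLpNorm_ne_top _),
      eLpNorm_eq_lintegral_rpow_enorm_toReal (by simp) (by simp), ← ENNReal.rpow_natCast,
      ← ENNReal.rpow_mul]
    simp
  rw [crossedTrace, huniv]
  simp_rw [key]
  apply le_antisymm
  · exact iSup_le fun A => iSup_le fun hA => iSup_le fun _ => setLIntegral_le_lintegral _ _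
  · have hU : (⋃ n, spanningSets μ n ×ˢ (Set.univ : Set Γ)) = Set.univ := by
      rw [← Set.iUnion_prod_const, iUnion_spanningSets, Set.univ_prod_univ]
    rw [← setLIntegral_univ, ← hU, setLIntegral_iUnion_of_directed]
    · refine iSup_le fun n => ?_
      exact le_iSup_of_le (spanningSets μ n) (le_iSup_of_le (measurableSet_spanningSets μ n)
        (le_iSup_of_le (measure_spanningSets_lt_top μ n).ne le_rfl))
    · exact Monotone.directed_le fun i j hij => Set.prod_mono (monotone_spanningSets μ hij) le_rfl

/-! ### Cocycles, amenability, ultrapowers, multipliers and invariant means -/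

variable (Γ) in
/-- A multiplicative 1-cocycle `κ : Γ → L^∞(Ω; 𝕋)` (given by measurable representatives):
`κ_{gh} = κ_g θ_g(κ_h)` almost everywhere. -/
structure TorusCocycle where
  toFun : Γ → Ω → ℂ
  measurable' : ∀ g, Measurable (toFun g)
  norm_eq_one' : ∀ g ω, ‖toFun g ω‖ = 1
  cocycle' : ∀ g h, ∀ᵐ ω ∂μ, toFun (g * h) ω = toFun g ω * toFun h (g⁻¹ • ω)

theorem TorusCocycle.bddMeas (κ : TorusCocycle Γ μ) (g : Γ) : BddMeas (κ.toFun g) :=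
  ⟨κ.measurable' g, 1, fun ω => (κ.norm_eq_one' g ω).le⟩

/-- `π` is the normal `*`-homomorphism `ℒΓ → L^∞(Ω) ⋊ Γ` with `π(λ_g) = κ_g ⋊ λ_g`. -/
def IsTwistedHom (κ : TorusCocycle Γ μ)
    (π : (groupVN Γ).toStarSubalgebra →⋆ₐ[ℂ] (crossedVN Γ μ).toStarSubalgebra) : Prop :=
  IsNormal (groupVN Γ) (fun x => (π x : L2Prod Γ μ →L[ℂ] L2Prod Γ μ)) ∧
    ∀ g : Γ, (π (lamVN g) : L2Prod Γ μ →L[ℂ] L2Prod Γ μ) =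
      diagOp μ (κ.toFun g) (κ.bddMeas μ g) * translOp μ g

/-- Left amenability of `π : ℒΓ → L^∞(Ω) ⋊ Γ`. -/
def IsAmenableHom
    (π : (groupVN Γ).toStarSubalgebra →⋆ₐ[ℂ] (crossedVN Γ μ).toStarSubalgebra) : Prop :=
  IsAmenableMap (L2Group Γ) (L2Crossed Γ μ) (GNSVec Γ μ) π

variable (Γ) in
/-- `Ω` has a `Γ`-invariant mean: a state on `L^∞(Ω)` which is invariant under
`θ_g(f)(ω) = f (g⁻¹ • ω)`. -/
def HasInvariantMean : Prop :=
  ∃ φ : Lp ℂ ∞ μ →ₗ[ℂ] ℂ,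
    (∀ f : Lp ℂ ∞ μ, 0 ≤ᵐ[μ] f → 0 ≤ φ f) ∧
    φ ((memLp_top_const (1 : ℂ)).toLp (fun _ => (1 : ℂ))) = 1 ∧
    ∀ (g : Γ) (f : Lp ℂ ∞ μ),
      φ (Lp.compMeasurePreserving (fun ω => g⁻¹ • ω) (measurePreserving_smul g⁻¹ μ) f) = φ f

end CrossedProduct

/-! #### Ultrapowers of Hilbert spaces -/

section Ultrapower

variable {ι : Type*} (U : Ultrafilter ι) (H : Type*) [NormedAddCommGroup H]
  [InnerProductSpace ℂ H]

/-- The bounded families which tend to `0` along `U`. -/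
def nullFamilies : Submodule ℂ (lp (fun _ : ι => H) ∞) where
  carrier := {x | Tendsto (fun i => x i) (U : Filter ι) (𝓝 0)}
  zero_mem' := by
    change Tendsto (fun _ => (0 : H)) (U : Filter ι) (𝓝 0)
    exact tendsto_const_nhds
  add_mem' := fun {x y} hx hy => by
    have h : Tendsto (fun i => x i + y i) (U : Filter ι) (𝓝 (0 + 0)) := Tendsto.add hx hy
    rw [add_zero] at h
    exact h
  smul_mem' := fun c x hx => by
    have h : Tendsto (fun i => c • x i) (U : Filter ι) (𝓝 (c • 0)) := Tendsto.const_smul hx c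
    rw [smul_zero] at h
    exact h

/-- The ultrapower `H^U`: bounded families modulo those tending to `0` along `U`, with the
quotient norm, `‖[x]‖ = lim_U ‖x i‖`. -/
abbrev Ultrapower : Type _ := lp (fun _ : ι => H) ∞ ⧸ nullFamilies U H

variable {H}

/-- The coordinatewise action of an operator on bounded families. -/
def lpMap (ι : Type*) (T : H →L[ℂ] H) :
    lp (fun _ : ι => H) ∞ →ₗ[ℂ] lp (fun _ : ι => H) ∞ where
  toFun x := ⟨fun i => T (x i), by
    obtain ⟨C, hC⟩ := memℓp_infty_iff.1 (lp.memℓp x)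
    refine memℓp_infty_iff.2 ⟨‖T‖ * C, ?_⟩
    rintro _ ⟨i, rfl⟩
    exact (T.le_opNorm _).trans (mul_le_mul_of_nonneg_left (hC ⟨i, rfl⟩) (norm_nonneg _))⟩
  map_add' x y := by
    ext i
    exact map_add T _ _
  map_smul' c x := by
    ext i
    exact map_smul T _ _

/-- The ultrapower `T^U` of a bounded operator `T`, `[x_i] ↦ [T x_i]`. -/
def ultraMap (T : H →L[ℂ] H) : Ultrapower U H →ₗ[ℂ] Ultrapower U H :=
  (nullFamilies U H).mapQ (nullFamilies U H) (lpMap ι T) (fun x hx => by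
    have hx' : Tendsto (fun i => x i) (U : Filter ι) (𝓝 0) := hx
    have h : Tendsto (fun i => T (x i)) (U : Filter ι) (𝓝 (T 0)) := (T.continuous.tendsto 0).comp hx'
    rw [map_zero] at h
    exact h)

end Ultrapower

/-! #### Fourier multipliers -/

section Multipliers

/-- A function of positive type on a group: the matrices `[m (g_i⁻¹ g_j)]` are positive. -/
def IsPositiveType {Γ : Type*} [Group Γ] (m : Γ → ℂ) : Prop :=
  ∀ (n : ℕ) (g : Fin n → Γ), (Matrix.of fun i j => m ((g i)⁻¹ * g j)).PosSemidef

/-- The Fourier–Stieltjes algebra `B(Γ)` of a discrete group: the linear span of the functions of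
positive type. -/
def fourierStieltjes (Γ : Type*) [Group Γ] : Submodule ℂ (Γ → ℂ) :=
  Submodule.span ℂ {m | IsPositiveType m}

theorem IsPositiveType.norm_le {Γ : Type*} [Group Γ] {m : Γ → ℂ} (hm : IsPositiveType m) (g : Γ) :
    ‖m g‖ ≤ ‖m 1‖ := by
  have h := hm 2 ![1, g]
  have hd := h.det_nonneg
  have h1 := h.isHermitian.apply 0 1
  have h0 := h.isHermitian.apply 0 0
  simp [Matrix.det_fin_two] at hd h1 h0
  have e1 : m 1 * m 1 = ((‖m 1‖ ^ 2 : ℝ) : ℂ) := by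
    have := Complex.conj_mul' (m 1)
    rw [h0] at this
    rw [this]
    push_cast
    rfl
  have e2 : conj (m g⁻¹) * m g⁻¹ = ((‖m g‖ ^ 2 : ℝ) : ℂ) := by
    rw [Complex.conj_mul', ← h1, RCLike.norm_conj]
    push_cast
    rfl
  rw [← h1, e1, e2] at hd
  have hd' : ‖m g‖ ^ 2 ≤ ‖m 1‖ ^ 2 := by exact_mod_cast hd
  exact le_of_sq_le_sq hd' (norm_nonneg _)

theorem bddMeas_fourierStieltjes {Γ : Type*} [Group Γ] [MeasurableSpace Γ]
    [DiscreteMeasurableSpace Γ] {m : Γ → ℂ} (hm : m ∈ fourierStieltjes Γ) : BddMeas m := by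
  refine ⟨Measurable.of_discrete, ?_⟩
  induction hm using Submodule.span_induction with
  | mem m hm => exact ⟨‖m 1‖, hm.norm_le⟩
  | zero => exact ⟨0, fun g => by simp⟩
  | add x y _ _ hx hy =>
    obtain ⟨C, hC⟩ := hx
    obtain ⟨D, hD⟩ := hy
    exact ⟨C + D, fun g => (norm_add_le _ _).trans (add_le_add (hC g) (hD g))⟩
  | smul c x _ hx =>
    obtain ⟨C, hC⟩ := hx
    refine ⟨‖c‖ * C, fun g => ?_⟩
    rw [Pi.smul_apply, norm_smul]
    exact mul_le_mul_of_nonneg_left (hC g) (norm_nonneg _)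

variable {Γ : Type*} [Group Γ] [Countable Γ] [MeasurableSpace Γ] [DiscreteMeasurableSpace Γ]
  {Ω : Type*} [MeasurableSpace Ω] [MulAction Γ Ω] [MeasurableConstSMul Γ Ω]
  (μ : Measure Ω) [SigmaFinite μ] [SMulInvariantMeasure Γ Ω μ]

/-- The Fourier multiplier `T_m`, `λ_g ↦ m(g) λ_g`, on `L²(ℒΓ) = ℓ²(Γ)`. -/
def groupMultiplier {m : Γ → ℂ} (hm : m ∈ fourierStieltjes Γ) : ell2 Γ →L[ℂ] ell2 Γ :=
  mulOp Measure.count m (bddMeas_fourierStieltjes hm)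

/-- The multiplier `id ⋊ T_m`, `f ⋊ λ_g ↦ m(g) f ⋊ λ_g`, on `L²(Ω ⋊ Γ) = L²(Ω × Γ)`. -/
def crossedMultiplier {m : Γ → ℂ} (hm : m ∈ fourierStieltjes Γ) :
    L2Prod Γ μ →L[ℂ] L2Prod Γ μ :=
  mulOp (prodMeasure Γ μ) (fun p : Ω × Γ => m p.2)
    ((bddMeas_fourierStieltjes hm).comp (T := Prod.snd) measurable_snd)

/-- `J : L²(ℒΓ) → L²(Ω ⋊ Γ)^U` is bimodular:
`J (x · ζ · y) = π(x) · J ζ · π(y)` for all `x, y ∈ ℒΓ`. -/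
def IsBimodular
    (π : (groupVN Γ).toStarSubalgebra →⋆ₐ[ℂ] (crossedVN Γ μ).toStarSubalgebra)
    {ι : Type*} (U : Ultrafilter ι) (J : ell2 Γ →ₗᵢ[ℂ] Ultrapower U (L2Prod Γ μ)) : Prop :=
  ∀ (x y : (groupVN Γ).toStarSubalgebra) (ζ : ell2 Γ),
    J ((L2Group Γ).act x ζ y) =
      ultraMap U (H := L2Prod Γ μ) ((L2Crossed Γ μ).left (π x))
        (ultraMap U (H := L2Prod Γ μ) ((L2Crossed Γ μ).right (MulOpposite.op (π y))) (J ζ))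

/-- `J : L²(ℒΓ) → L²(Ω ⋊ Γ)^U` intertwines `T_m` and `(id ⋊ T_m)^U` for every `m ∈ B(Γ)`. -/
def IntertwinesMultipliers {ι : Type*} (U : Ultrafilter ι)
    (J : ell2 Γ →ₗᵢ[ℂ] Ultrapower U (L2Prod Γ μ)) : Prop :=
  ∀ (m : Γ → ℂ) (hm : m ∈ fourierStieltjes Γ) (ζ : ell2 Γ),
    J (groupMultiplier hm ζ) = ultraMap U (crossedMultiplier μ hm) (J ζ)

/-- The vectors `ξ n ∈ L²(Ω × Γ)` are asymptotically invariant: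
`‖(θ_h ⊗ Ad_h) ξ_n - M_{ϖ_h} ξ_n‖₂ → 0` with `ϖ_h(g, ω) = conj (κ_h(ω)) θ_g(κ_h)(ω)`.
Here `ξ ∈ L²(Ω × Γ)` stands for `∑_g ξ(g) ⋊ λ_g`. -/
def AsympInvariant (κ : TorusCocycle Γ μ) (ξ : ℕ → L2Prod Γ μ) : Prop :=
  ∀ h : Γ, Tendsto (fun n => eLpNorm (fun p : Ω × Γ =>
      ξ n (h⁻¹ • p.1, h⁻¹ * p.2 * h)
        - conj (κ.toFun h p.1) * κ.toFun h (p.2⁻¹ • p.1) * ξ n p) 2 (prodMeasure Γ μ))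
    atTop (𝓝 0)

/-- `∫ κ_h (∑_g conj (ξ(hg)) θ_h(ξ(g))) dμ`, the value `τ_⋊(ξ* π(λ_h) ξ)` for
`ξ = ∑_g ξ(g) ⋊ λ_g`. -/
def traceCoeff (κ : TorusCocycle Γ μ) (ξ : L2Prod Γ μ) (h : Γ) : ℂ :=
  ∫ ω, κ.toFun h ω * ∑' g : Γ, conj (ξ (ω, h * g)) * ξ (h⁻¹ • ω, g) ∂μ

end Multipliers

end AmenableHom
end

noncomputable section

namespace AmenableHom

/-! ### Extension of densely defined operators -/

section Span

/-! Every condition in the theorem is equivalent to the existence of a `Γ`-invariant mean on `Ω`,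
whatever the cocycle `κ` is, and the proof passes through that property.

Amenability is first made concrete. In standard form, `x ⊗ y ↦ π(x) y` embeds `H(π)` in `L²(M)`,
left-bounded vectors become operators on `L²(M)`, and `H(π) ⊗_M H̄(π)` becomes a part of `L²(M)`
with both actions taken through `π`. Hence `isAmenableHom_iff`: amenability means that `L²(ℒΓ)` is
weakly contained in `twistedCorr`. The analytic input is the commutation theorem
`commute_of_commutants` for the crossed product, which yields `isStandardForm_L2Crossed`.

From weak containment to a mean: `δ_e` is fixed by conjugation with every `λ_h`, so there are unit
vectors `v_n` in `L²(Ω × Γ)` almost fixed by `v ↦ π(λ_h) v π(λ_h)*`. Up to a unimodular factor this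
operator is `θ_h ⊗ Ad_h`, and the numbers `⟪v_n, (F ⊗ 1) v_n⟫` do not see such a factor; their limit
along an ultrafilter is an invariant mean (`hasInvariantMean_of_tendsto`). The sequences of (i) are
treated in the same way.

From a mean to almost invariant unit vectors of `L²(Ω)`: without them the operators `∑ (1 + θ_g)`
would have a norm gap, and a Neumann series would give `F > 0` with `∑_{h ∈ S} θ_h F ≤ c |S| F`, `c
< 1`, for a finite symmetric `S`. The functions `log θ_h F - log F` are bounded and their sum over
`S` has mean `0`, whereas `log t ≤ t - 1` bounds this sum by `|S| log c < 0`
(`HasInvariantMean.not_supersolution`).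

From almost invariant real vectors `f_n` to everything else: the isometries `v ↦ κ_h(hω) f_n(ω)
v(h)` (`twistTensor`) intertwine the left actions and the Fourier multipliers exactly and the
modular conjugations asymptotically. They give the weak containment and the isometry into the
ultrapower, while `f_n ⊗ δ_e` satisfies (i) with the exact normalisation. -/

theorem ext_of_span_closure {E F : Type*} [NormedAddCommGroup E] [InnerProductSpace ℂ E]
    [TopologicalSpace F] [T2Space F] [AddCommMonoid F] [Module ℂ F] {S : Set E}
    (hS : (Submodule.span ℂ S).topologicalClosure = ⊤)
    {f g : E →L[ℂ] F} (h : ∀ x ∈ S, f x = g x) : f = g :=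
  ContinuousLinearMap.ext_on (Submodule.dense_iff_topologicalClosure_eq_top.2 hS) h

end Span

/-! ### Isometries determined by Gram matrices. -/

section Gram

variable {E E' : Type*} [NormedAddCommGroup E] [InnerProductSpace ℂ E] [NormedAddCommGroup E']
  [InnerProductSpace ℂ E']

theorem inner_linearCombination {ι : Type*} (a : ι → E) (c d : ι →₀ ℂ) :
    ⟪Finsupp.linearCombination ℂ a c, Finsupp.linearCombination ℂ a d⟫_ℂ =
      c.sum fun i r => d.sum fun j s => conj r * s * ⟪a i, a j⟫_ℂ := by
  simp only [Finsupp.linearCombination_apply, Finsupp.sum, sum_inner]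
  refine Finset.sum_congr rfl fun i _ => ?_
  rw [inner_sum]
  refine Finset.sum_congr rfl fun j _ => ?_
  rw [inner_smul_left, inner_smul_right, mul_assoc]

/-- A map between total families of vectors preserving the inner products extends to a linear
isometry. -/
theorem exists_linearIsometry_of_gram [CompleteSpace E'] {ι : Type*} (a : ι → E) (b : ι → E')
    (hab : ∀ i j, ⟪a i, a j⟫_ℂ = ⟪b i, b j⟫_ℂ)
    (ha : (Submodule.span ℂ (Set.range a)).topologicalClosure = ⊤) :
    ∃ T : E →ₗᵢ[ℂ] E', ∀ i, T (a i) = b i := by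
  have hnorm : ∀ c, ‖Finsupp.linearCombination ℂ b c‖ = ‖Finsupp.linearCombination ℂ a c‖ := by
    intro c
    rw [norm_eq_sqrt_re_inner (𝕜 := ℂ), norm_eq_sqrt_re_inner (𝕜 := ℂ),
      inner_linearCombination, inner_linearCombination]
    simp only [hab]
  have hd : DenseRange (Finsupp.linearCombination ℂ a) := by
    rw [DenseRange, ← LinearMap.coe_range, Finsupp.range_linearCombination]
    exact Submodule.dense_iff_topologicalClosure_eq_top.2 ha
  have hext := LinearMap.extendOfNorm_eq (f := Finsupp.linearCombination ℂ b) hd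
    ⟨1, fun c => by rw [hnorm, one_mul]⟩
  refine ⟨⟨(LinearMap.extendOfNorm (Finsupp.linearCombination ℂ b)
    (Finsupp.linearCombination ℂ a)).toLinearMap, ?_⟩, fun i => ?_⟩
  · intro x
    refine hd.induction_on (p := fun x => ‖(LinearMap.extendOfNorm
      (Finsupp.linearCombination ℂ b) (Finsupp.linearCombination ℂ a)) x‖ = ‖x‖) x
      (isClosed_eq (by fun_prop) (by fun_prop)) fun c => ?_
    rw [hext, hnorm]
  · have := hext (Finsupp.single i 1)
    simpa using this

end Gram

/-! ### Pullbacks of correspondences -/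

section Pullback

universe u u₃ v w w' w₁ w₂ w₃

variable {H₁ : Type u} [NormedAddCommGroup H₁] [InnerProductSpace ℂ H₁] [CompleteSpace H₁]
  {H₂ : Type v} [NormedAddCommGroup H₂] [InnerProductSpace ℂ H₂] [CompleteSpace H₂]
  {H₃ : Type u₃} [NormedAddCommGroup H₃] [InnerProductSpace ℂ H₃] [CompleteSpace H₃]
  {N : VonNeumannAlgebra H₁} {M : VonNeumannAlgebra H₂} {Q : VonNeumannAlgebra H₃}

/-- Restriction of the left action along a `*`-homomorphism. -/
abbrev Correspondence.comapLeft (K : Correspondence.{v, u₃, w} M Q)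
    (π : N.toStarSubalgebra →⋆ₐ[ℂ] M.toStarSubalgebra)
    (h : IsNormal N (fun x => K.left (π x))) : Correspondence.{u, u₃, w} N Q where
  space := K.space
  left := K.left.comp π
  right := K.right
  left_normal := h
  right_normal := K.right_normal
  comm x y := K.comm (π x) y

/-- Restriction of the right action along a `*`-homomorphism. -/
abbrev Correspondence.comapRight (K : Correspondence.{u₃, v, w} Q M)
    (π : N.toStarSubalgebra →⋆ₐ[ℂ] M.toStarSubalgebra)
    (h : IsNormal N (fun y => K.right (MulOpposite.op (π y)))) :
    Correspondence.{u₃, u, w} Q N where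
  space := K.space
  left := K.left
  right := K.right.comp
    { toFun := fun y => MulOpposite.op (π y.unop)
      map_one' := by simp
      map_mul' := fun a b => by simp
      map_zero' := by simp
      map_add' := fun a b => by simp
      commutes' := fun r => by
        simp only [MulOpposite.algebraMap_apply, MulOpposite.unop_op, AlgHomClass.commutes]
      map_star' := fun a => by simp [map_star] }
  left_normal := K.left_normal
  right_normal := h
  comm x y := K.comm x (MulOpposite.op (π y.unop))

theorem Correspondence.left_right_comm (K : Correspondence.{u, v, w} N M)
    (x : N.toStarSubalgebra) (y : (M.toStarSubalgebra)ᵐᵒᵖ) (ξ : K.space) :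
    K.left x (K.right y ξ) = K.right y (K.left x ξ) :=
  congrArg (fun T => T ξ) (K.comm x y).eq

@[simp] theorem Correspondence.act_one_left (K : Correspondence.{u, v, w} N M) (ξ : K.space)
    (y : M.toStarSubalgebra) : K.act 1 ξ y = K.right (MulOpposite.op y) ξ := by
  simp [Correspondence.act]

@[simp] theorem Correspondence.act_one_right (K : Correspondence.{u, v, w} N M)
    (x : N.toStarSubalgebra) (ξ : K.space) : K.act x ξ 1 = K.left x ξ := by
  simp [Correspondence.act]

/-- The properties of the standard form of `M` (`L = L²(M)`, `Λ y v` says that `v` is the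
vector given by the square integrable element `y`). -/
structure IsStandardForm (L : Correspondence.{v, v, w} M M)
    (Λ : M.toStarSubalgebra → L.space → Prop) (J : L.space →ₗᵢ⋆[ℂ] L.space) : Prop where
  zero : Λ 0 0
  add : ∀ {y y' v v'}, Λ y v → Λ y' v' → Λ (y + y') (v + v')
  smul : ∀ (c : ℂ) {y v}, Λ y v → Λ (c • y) (c • v)
  unique : ∀ {y v v'}, Λ y v → Λ y v' → v = v'
  dense : (Submodule.span ℂ {v | ∃ y, Λ y v}).topologicalClosure = ⊤
  left : ∀ b {y v}, Λ y v → Λ (b * y) (L.left b v)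
  right : ∀ b {y v}, Λ y v → Λ (y * b) (L.right (MulOpposite.op b) v)
  total : (Submodule.span ℂ {ζ | ∃ y v η, Λ y v ∧ ζ = L.left y η}).topologicalClosure = ⊤
  commutant : ∀ T : L.space →L[ℂ] L.space, (∀ b, Commute T (L.right (MulOpposite.op b))) →
    ∃ a, L.left a = T
  conj_conj : ∀ v, J (J v) = v
  conj_left : ∀ a v, J (L.left a v) = L.right (MulOpposite.op (star a)) (J v)

namespace IsStandardForm

variable {L : Correspondence.{v, v, w} M M} {Λ : M.toStarSubalgebra → L.space → Prop}
  {J : L.space →ₗᵢ⋆[ℂ] L.space}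

theorem conj_right (h : IsStandardForm L Λ J) (a : M.toStarSubalgebra) (v : L.space) :
    J (L.right (MulOpposite.op a) v) = L.left (star a) (J v) := by
  have := h.conj_left (star a) (J v)
  rw [star_star, h.conj_conj] at this
  rw [← this, h.conj_conj]

/-- The graph of `Λ` as a subspace. -/
def graph (h : IsStandardForm L Λ J) : Submodule ℂ (M.toStarSubalgebra × L.space) where
  carrier := {p | Λ p.1 p.2}
  zero_mem' := h.zero
  add_mem' := h.add
  smul_mem' := fun c _ hp => h.smul c hp

theorem dense_graph (h : IsStandardForm L Λ J) :
    DenseRange ((LinearMap.snd ℂ M.toStarSubalgebra L.space).comp h.graph.subtype) := by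
  have hr : Set.range ((LinearMap.snd ℂ M.toStarSubalgebra L.space).comp h.graph.subtype) =
      {v | ∃ y, Λ y v} := by
    ext v
    constructor
    · rintro ⟨⟨⟨y, v'⟩, hy⟩, rfl⟩
      exact ⟨y, hy⟩
    · rintro ⟨y, hy⟩
      exact ⟨⟨(y, v), hy⟩, rfl⟩
  have hs : (Submodule.span ℂ {v | ∃ y, Λ y v} : Set L.space) = {v | ∃ y, Λ y v} := by
    rw [← hr, ← LinearMap.coe_range, Submodule.span_eq]
  rw [DenseRange, hr, ← hs]
  exact Submodule.dense_iff_topologicalClosure_eq_top.2 h.dense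

/-- Two operators agreeing on the vectors given by elements of `M` are equal. -/
theorem ext_vec (h : IsStandardForm L Λ J) {F : Type*} [NormedAddCommGroup F]
    [InnerProductSpace ℂ F] {S T : L.space →L[ℂ] F} (hST : ∀ y v, Λ y v → S v = T v) : S = T :=
  ext_of_span_closure h.dense (by rintro v ⟨y, hy⟩; exact hST y v hy)

/-- Left-bounded vectors give bounded operators. -/
theorem exists_leftMul (h : IsStandardForm L Λ J) {H : Correspondence.{u, v, w'} N M} {ξ : H.space}
    (hξ : LeftBounded L Λ H ξ) :
    ∃ T : L.space →L[ℂ] H.space, ∀ y v, Λ y v → T v = H.right (MulOpposite.op y) ξ := by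
  obtain ⟨C, hC⟩ := hξ
  let f : h.graph →ₗ[ℂ] H.space :=
    { toFun := fun p => H.right (MulOpposite.op (p : M.toStarSubalgebra × L.space).1) ξ
      map_add' := fun p q => by simp
      map_smul' := fun c p => by simp }
  refine ⟨f.extendOfNorm ((LinearMap.snd ℂ M.toStarSubalgebra L.space).comp h.graph.subtype),
    fun y v hy => ?_⟩
  exact LinearMap.extendOfNorm_eq (f := f) h.dense_graph
    ⟨C, fun p => by have := hC _ _ p.2; rw [Correspondence.act_one_left] at this; exact this⟩ ⟨(y, v), hy⟩

end IsStandardForm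

end Pullback

/-! ### Amenability of a homomorphism as a weak containment in `L²(M)`. -/

section AmenableMaps

universe u u₃ v w w' w₁ w₂ w₃

variable {H₁ : Type u} [NormedAddCommGroup H₁] [InnerProductSpace ℂ H₁] [CompleteSpace H₁]
  {H₂ : Type v} [NormedAddCommGroup H₂] [InnerProductSpace ℂ H₂] [CompleteSpace H₂]
  {N : VonNeumannAlgebra H₁} {M : VonNeumannAlgebra H₂}
  {L : Correspondence.{v, v, w} M M} {Λ : M.toStarSubalgebra → L.space → Prop}
  {J : L.space →ₗᵢ⋆[ℂ] L.space}

theorem IsStandardForm.ext_inner (h : IsStandardForm L Λ J) {z z' : L.space}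
    (hz : ∀ y v, Λ y v → ⟪v, z⟫_ℂ = ⟪v, z'⟫_ℂ) : z = z' := by
  have : innerSL ℂ (z - z') = 0 := h.ext_vec fun y v hy => by
    have := congrArg conj (hz y v hy)
    rw [inner_conj_symm, inner_conj_symm] at this
    simp [this]
  have h2 := congrArg (fun T => T (z - z')) this
  rw [← sub_eq_zero, ← inner_self_eq_zero (𝕜 := ℂ)]
  exact h2

theorem Correspondence.inner_left_left (K : Correspondence.{u, v, w'} N M)
    (x y : N.toStarSubalgebra) (ξ η : K.space) :
    ⟪K.left x ξ, K.left y η⟫_ℂ = ⟪ξ, K.left (star x * y) η⟫_ℂ := by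
  rw [map_mul, map_star, ContinuousLinearMap.star_eq_adjoint]
  exact (ContinuousLinearMap.adjoint_inner_right _ _ _).symm

theorem Correspondence.right_right (K : Correspondence.{u, v, w'} N M)
    (x y : M.toStarSubalgebra) (ξ : K.space) :
    K.right (MulOpposite.op y) (K.right (MulOpposite.op x) ξ) =
      K.right (MulOpposite.op (x * y)) ξ := by
  rw [MulOpposite.op_mul, map_mul]
  rfl

variable (h : IsStandardForm L Λ J) (π : N.toStarSubalgebra →⋆ₐ[ℂ] M.toStarSubalgebra)

include h in
/-- The GNS correspondence of `π` embeds in `L²(M)`. -/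
theorem IsStandardForm.exists_embedding {H : Correspondence.{u, v, w'} N M}
    {t : N.toStarSubalgebra → M.toStarSubalgebra → H.space}
    (hG : IsGNSCorrespondence L Λ π H t) :
    ∃ U : H.space →ₗᵢ[ℂ] L.space, ∀ a ζ b,
      U (H.act a ζ b) = L.left (π a) (L.right (MulOpposite.op b) (U ζ)) := by
  have := L.instComplete
  obtain ⟨U, hU⟩ := exists_linearIsometry_of_gram
    (ι := {p : N.toStarSubalgebra × M.toStarSubalgebra × L.space // Λ p.2.1 p.2.2})
    (fun p => t p.1.1 p.1.2.1) (fun p => L.left (π p.1.1) p.1.2.2)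
    (fun p q => by
      rw [hG.inner_eq _ _ _ _ _ _ p.2 q.2, L.inner_left_left, map_mul, map_star])
    (by
      rw [← hG.dense]
      congr 2
      ext ζ
      constructor
      · rintro ⟨⟨⟨x, y, v⟩, hy⟩, rfl⟩
        exact ⟨x, y, v, hy, rfl⟩
      · rintro ⟨x, y, v, hy, rfl⟩
        exact ⟨⟨⟨x, y, v⟩, hy⟩, rfl⟩)
  have hU' : ∀ x y v, Λ y v → U (t x y) = L.left (π x) v := fun x y v hy => hU ⟨(x, y, v), hy⟩
  refine ⟨U, fun a ζ b => ?_⟩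
  have key : U.toContinuousLinearMap ∘L (H.left a ∘L H.right (MulOpposite.op b)) =
      (L.left (π a) ∘L L.right (MulOpposite.op b)) ∘L U.toContinuousLinearMap := by
    refine ext_of_span_closure hG.dense ?_
    rintro _ ⟨x, y, v, hy, rfl⟩
    change U (H.act a (t x y) b) = L.left (π a) (L.right (MulOpposite.op b) (U (t x y)))
    rw [hG.act_eq a x y b v hy, hU' _ _ _ hy, hU' _ _ _ (h.right b hy), map_mul, map_mul,
      ← L.left_right_comm]
    rfl
  exact congrArg (fun T => T ζ) key

include h in
-- The map `ξ ⊗ c ζ ↦ T_ξ (J (U ζ))`, where `U` embeds `H(π)` in `L²(M)` and `T_ξ` is the operator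
-- of the left-bounded vector `ξ`, is an isometric bimodule embedding of the Connes tensor product
-- into `L²(M)`. Coefficients of a subcorrespondence are coefficients of the larger one, so
-- surjectivity is not needed.
theorem IsStandardForm.weaklyContained_of_isAmenableMap {LN : Correspondence.{u, u, w₁} N N}
    (hl : IsNormal N (fun x => L.left (π x)))
    (hr : IsNormal N (fun y => (L.comapLeft π hl).right (MulOpposite.op (π y))))
    (ha : IsAmenableMap LN L Λ π) :
    WeaklyContained LN ((L.comapLeft π hl).comapRight π hr) := by
  obtain ⟨H, t, hG, K, c, F, s, hc, hF, hw⟩ := ha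
  obtain ⟨U, hU⟩ := h.exists_embedding π hG
  have hUr : ∀ b ξ, U (H.right (MulOpposite.op b) ξ) = L.right (MulOpposite.op b) (U ξ) := by
    intro b ξ
    have := hU 1 ξ b
    rw [H.act_one_left] at this
    rw [this, map_one, map_one]
    rfl
  have hUl : ∀ a ξ, U (H.left a ξ) = L.left (π a) (U ξ) := by
    intro a ξ
    have := hU a ξ 1
    rw [H.act_one_right] at this
    rw [this, MulOpposite.op_one, map_one]
    rfl
  have hT : ∀ ξ : {ξ // LeftBounded L Λ H ξ}, ∃ T : L.space →L[ℂ] L.space,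
      ∀ y v, Λ y v → T v = L.right (MulOpposite.op y) (U ξ) := by
    intro ξ
    obtain ⟨T, hT⟩ := h.exists_leftMul ξ.2
    refine ⟨U.toContinuousLinearMap ∘L T, fun y v hy => ?_⟩
    rw [← hUr, ← hT y v hy]
    rfl
  choose T hT using hT
  let V : K.space →ₗᵢ[ℂ] L.space :=
    J.comp (U.comp c.symm.toLinearIsometry : K.space →ₗᵢ⋆[ℂ] L.space)
  have hV : ∀ ξ, V (c ξ) = J (U ξ) := fun ξ => by
    change J (U (c.symm (c ξ))) = _
    rw [c.symm_apply_apply]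
  have hVl : ∀ a η, V (K.left a η) = L.left a (V η) := by
    intro a η
    obtain ⟨ξ, rfl⟩ := c.surjective η
    have := hc a ξ 1
    rw [K.act_one_right, star_one, H.act_one_left] at this
    rw [this, hV, hV, hUr, h.conj_right, star_star]
  have hVr : ∀ b η, V (K.right (MulOpposite.op b) η) =
      L.right (MulOpposite.op (π b)) (V η) := by
    intro b η
    obtain ⟨ξ, rfl⟩ := c.surjective η
    have := hc 1 ξ b
    rw [K.act_one_left, star_one, H.act_one_right] at this
    rw [this, hV, hV, hUl, h.conj_left, map_star, star_star]
  have hTr : ∀ ξ b v, T ξ (L.right (MulOpposite.op b) v) = L.right (MulOpposite.op b) (T ξ v) := by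
    intro ξ b v
    have : T ξ ∘L L.right (MulOpposite.op b) = L.right (MulOpposite.op b) ∘L T ξ :=
      h.ext_vec fun y v hy => by
        change T ξ (L.right (MulOpposite.op b) v) = L.right (MulOpposite.op b) (T ξ v)
        rw [hT _ _ _ (h.right b hy), hT _ _ _ hy, L.right_right]
    exact congrArg (fun S => S v) this
  have hlb : ∀ x ξ, LeftBounded L Λ H ξ → LeftBounded L Λ H (H.left x ξ) := by
    rintro x ξ ⟨C, hC⟩
    refine ⟨‖H.left x‖ * C, fun y v hy => ?_⟩
    rw [H.act_one_left, ← H.left_right_comm, mul_assoc]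
    refine ((H.left x).le_opNorm _).trans (mul_le_mul_of_nonneg_left ?_ (norm_nonneg _))
    rw [← H.act_one_left]
    exact hC y v hy
  have hTl : ∀ x ξ hξ v, T ⟨H.left x ξ, hlb x ξ hξ⟩ v = L.left (π x) (T ⟨ξ, hξ⟩ v) := by
    intro x ξ hξ v
    have : T ⟨H.left x ξ, hlb x ξ hξ⟩ = L.left (π x) ∘L T ⟨ξ, hξ⟩ :=
      h.ext_vec fun y v hy => by
        change _ = L.left (π x) (T ⟨ξ, hξ⟩ v)
        rw [hT _ _ _ hy, hT _ _ _ hy, hUl, L.left_right_comm]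
    exact congrArg (fun S => S v) this
  obtain ⟨Ψ, hΨ⟩ := exists_linearIsometry_of_gram
    (ι := {p : H.space × K.space // LeftBounded L Λ H p.1})
    (fun p => s p.1.1 p.1.2) (fun p => T ⟨p.1.1, p.2⟩ (V p.1.2))
    (fun p q => by
      obtain ⟨a, ha, hin⟩ := hF.inner_eq _ _ p.2 q.2
      rw [hin, ← V.inner_map_map, hVl, ← ContinuousLinearMap.adjoint_inner_right]
      congr 1
      -- The `M`-valued inner product is `T_ξ* T_ξ'`: both operators have the same coefficients
      -- between vectors coming from square integrable elements, and these vectors are dense.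
      suffices L.left a = (ContinuousLinearMap.adjoint (T ⟨p.1.1, p.2⟩)) ∘L T ⟨q.1.1, q.2⟩ by
        rw [this]; rfl
      refine h.ext_vec fun y₂ v₂ hy₂ => h.ext_inner fun y₁ v₁ hy₁ => ?_
      rw [← ha _ _ _ _ hy₁ hy₂]
      change _ = ⟪v₁, (ContinuousLinearMap.adjoint (T ⟨p.1.1, p.2⟩)) (T ⟨q.1.1, q.2⟩ v₂)⟫_ℂ
      rw [ContinuousLinearMap.adjoint_inner_right, hT _ _ _ hy₁, hT _ _ _ hy₂, ← hUr, ← hUr,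
        U.inner_map_map, H.act_one_left, H.act_one_left])
    (by
      rw [← hF.dense]
      congr 2
      ext ζ
      constructor
      · rintro ⟨⟨⟨ξ, η⟩, hξ⟩, rfl⟩
        exact ⟨ξ, η, hξ, rfl⟩
      · rintro ⟨ξ, η, hξ, rfl⟩
        exact ⟨⟨⟨ξ, η⟩, hξ⟩, rfl⟩)
  have hΨ' : ∀ ξ η (hξ : LeftBounded L Λ H ξ), Ψ (s ξ η) = T ⟨ξ, hξ⟩ (V η) :=
    fun ξ η hξ => hΨ ⟨(ξ, η), hξ⟩
  have hΨb : ∀ x ζ y, Ψ (F.act x ζ y) =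
      L.left (π x) (L.right (MulOpposite.op (π y)) (Ψ ζ)) := by
    intro x ζ y
    have key : Ψ.toContinuousLinearMap ∘L (F.left x ∘L F.right (MulOpposite.op y)) =
        (L.left (π x) ∘L L.right (MulOpposite.op (π y))) ∘L Ψ.toContinuousLinearMap := by
      refine ext_of_span_closure hF.dense ?_
      rintro _ ⟨ξ, η, hξ, rfl⟩
      change Ψ (F.act x (s ξ η) y) = L.left (π x) (L.right (MulOpposite.op (π y)) (Ψ (s ξ η)))
      rw [hF.act_eq x ξ η y hξ, H.act_one_right, K.act_one_left, hΨ' _ _ (hlb x ξ hξ),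
        hΨ' _ _ hξ, hTl, hVr, hTr]
    exact congrArg (fun T => T ζ) key
  intro ε hε E E' ξ hξ
  obtain ⟨m, η, hη⟩ := hw ε hε E E' ξ hξ
  refine ⟨m, fun j => Ψ (η j), fun x hx y hy => ?_⟩
  convert hη x hx y hy using 4 with j
  rw [← Ψ.inner_map_map, hΨb]
  rfl

include h in
-- All the required correspondences can be realised on `L²(M)` itself: `x ⊗ y` is `π(x) y`, the
-- contragredient is given by `J`, and `ξ ⊗ η` is `T_ξ η`, where `T_ξ ∈ M` is left multiplication by
-- the left-bounded vector `ξ`.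
theorem IsStandardForm.isAmenableMap_of_weaklyContained {LN : Correspondence.{u, u, w₁} N N}
    (hl : IsNormal N (fun x => L.left (π x)))
    (hr : IsNormal N (fun y => (L.comapLeft π hl).right (MulOpposite.op (π y))))
    (hw : WeaklyContained LN ((L.comapLeft π hl).comapRight π hr)) :
    IsAmenableMap LN L Λ π := by
  classical
  -- The value `0` outside the square integrable elements is harmless: the axioms of
  -- `IsGNSCorrespondence` only evaluate `t x y` when `Λ y v` holds.
  let vec : M.toStarSubalgebra → L.space := fun y => if hy : ∃ v, Λ y v then hy.choose else 0
  have hvec : ∀ y v, Λ y v → vec y = v := by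
    intro y v hy
    have hy' : ∃ v, Λ y v := ⟨v, hy⟩
    simp only [vec, dif_pos hy']
    exact h.unique hy'.choose_spec hy
  have hop1 : L.right (MulOpposite.op 1) = 1 := by rw [MulOpposite.op_one, map_one]
  refine ⟨L.comapLeft π hl, fun x y => L.left (π x) (vec y), ⟨?_, ?_, ?_⟩, ?_⟩
  · intro x₁ x₂ y₁ y₂ v₁ v₂ h₁ h₂
    rw [hvec _ _ h₁, hvec _ _ h₂, map_mul, map_star]
    exact L.inner_left_left _ _ _ _
  · rw [eq_top_iff, ← h.dense]
    refine Submodule.topologicalClosure_mono (Submodule.span_mono ?_)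
    rintro v ⟨y, hy⟩
    exact ⟨1, y, v, hy, by rw [hvec _ _ hy, map_one, map_one]; rfl⟩
  · intro a x y b v hy
    rw [hvec _ _ hy, hvec _ _ (h.right b hy), map_mul, map_mul]
    change L.left (π a) (L.right (MulOpposite.op b) (L.left (π x) v)) = _
    rw [← L.left_right_comm]
    rfl
  have hT : ∀ ξ : {ξ : L.space // LeftBounded L Λ (L.comapLeft π hl) ξ},
      ∃ a : M.toStarSubalgebra, ∀ y v, Λ y v → L.left a v = L.right (MulOpposite.op y) ξ := by
    intro ξ
    obtain ⟨T, hT⟩ := h.exists_leftMul ξ.2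
    have hT' : ∀ y v, Λ y v → T v = L.right (MulOpposite.op y) ξ := hT
    -- Left multiplication by `ξ` commutes with the right action, so the commutation theorem places
    -- it in `M`.
    obtain ⟨a, ha⟩ := h.commutant T fun b => h.ext_vec fun y v hy => by
      change T (L.right (MulOpposite.op b) v) = L.right (MulOpposite.op b) (T v)
      rw [hT' _ _ (h.right b hy), hT' _ _ hy, L.right_right]
    exact ⟨a, by rw [ha]; exact hT'⟩
  choose T hT using hT
  let mul : L.space → L.space → L.space := fun ξ η =>
    if hξ : LeftBounded L Λ (L.comapLeft π hl) ξ then L.left (T ⟨ξ, hξ⟩) η else 0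
  have hmul : ∀ ξ (hξ : LeftBounded L Λ (L.comapLeft π hl) ξ) η,
      mul ξ η = L.left (T ⟨ξ, hξ⟩) η := fun ξ hξ η => by simp only [mul, dif_pos hξ]
  have hone : ∀ (ξ : (L.comapLeft π hl).space) y,
      (L.comapLeft π hl).act 1 ξ y = L.right (MulOpposite.op y) ξ :=
    fun ξ y => (L.comapLeft π hl).act_one_left ξ y
  let c : L.space ≃ₗᵢ⋆[ℂ] L.space :=
    { LinearEquiv.ofInvolutive J.toLinearMap h.conj_conj with norm_map' := J.norm_map }
  have hc : ∀ v, c v = J v := fun _ => rfl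
  refine ⟨L.comapRight π hr, c, (L.comapLeft π hl).comapRight π hr, mul, ?_, ⟨?_, ?_, ?_⟩, hw⟩
  · intro x ξ y
    rw [hc, hc]
    change L.left x (L.right (MulOpposite.op (π y)) (J ξ)) =
      J (L.left (π (star y)) (L.right (MulOpposite.op (star x)) ξ))
    rw [h.conj_left, h.conj_right, map_star, star_star, star_star, L.left_right_comm]
  · intro ξ₁ ξ₂ h₁ h₂
    refine ⟨star (T ⟨ξ₁, h₁⟩) * T ⟨ξ₂, h₂⟩, ?_, fun η₁ η₂ => ?_⟩
    · intro y₁ y₂ v₁ v₂ hy₁ hy₂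
      rw [← L.inner_left_left, hT _ _ _ hy₁, hT _ _ _ hy₂, hone, hone]
    · rw [hmul _ h₁, hmul _ h₂]
      exact L.inner_left_left _ _ _ _
  · rw [eq_top_iff, ← h.total]
    refine Submodule.topologicalClosure_mono (Submodule.span_mono ?_)
    rintro _ ⟨y, v, η, hy, rfl⟩
    -- A vector `v` coming from `y ∈ M` is left-bounded with operator `y`, since `v · y'` and `y ·
    -- v'` are both the vector of `y y'`.
    have hvy : ∀ y' v', Λ y' v' → L.right (MulOpposite.op y') v = L.left y v' :=
      fun y' v' hy' => h.unique (h.right y' hy) (h.left y hy')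
    have hb : LeftBounded L Λ (L.comapLeft π hl) v := by
      refine ⟨‖L.left y‖, fun y' v' hy' => ?_⟩
      rw [hone, hvy _ _ hy']
      exact (L.left y).le_opNorm _
    refine ⟨v, η, hb, ?_⟩
    rw [hmul _ hb]
    congr 1
    refine h.ext_vec fun y' v' hy' => ?_
    rw [hT _ _ _ hy', hvy _ _ hy']
  · intro x ξ η y hξ
    have hb : LeftBounded L Λ (L.comapLeft π hl) ((L.comapLeft π hl).act x ξ 1) := by
      obtain ⟨C, hC⟩ := hξ
      refine ⟨‖L.left (π x)‖ * C, fun y v hy => ?_⟩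
      rw [hone]
      change ‖L.right _ (L.left (π x) (L.right (MulOpposite.op 1) ξ))‖ ≤ _
      rw [← L.left_right_comm, hop1, mul_assoc]
      refine ((L.left (π x)).le_opNorm _).trans (mul_le_mul_of_nonneg_left ?_ (norm_nonneg _))
      have := hC y v hy
      rwa [hone] at this
    have hx : L.left (T ⟨_, hb⟩) = L.left (π x * T ⟨ξ, hξ⟩) := by
      refine h.ext_vec fun y v hy => ?_
      rw [hT _ _ _ hy, map_mul]
      change L.right _ (L.left (π x) (L.right (MulOpposite.op 1) ξ)) =
        L.left (π x) (L.left (T ⟨ξ, hξ⟩) v)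
      rw [hT _ _ _ hy, hop1, L.left_right_comm]
      rfl
    rw [hmul _ hξ, hmul _ hb, hx, map_mul]
    change L.left (π x) (L.right (MulOpposite.op (π y)) (L.left (T ⟨ξ, hξ⟩) η)) =
      L.left (π x) (L.left (T ⟨ξ, hξ⟩) (L.left 1 (L.right (MulOpposite.op (π y)) η)))
    rw [map_one, ← L.left_right_comm]
    rfl

end AmenableMaps

/-! ### Amplifications and normal maps -/

section Amplification

variable {H : Type*} [NormedAddCommGroup H] [InnerProductSpace ℂ H] [CompleteSpace H]

/-- For self-adjoint `S`, commuting with `S` already implies commuting with `S*`, so the commutant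
in the definition of `vnGen` is the ordinary one. -/
theorem commute_of_mem_vnGen {S : Set (H →L[ℂ] H)} (hS : ∀ a ∈ S, star a ∈ S) {x : H →L[ℂ] H}
    (hx : x ∈ vnGen S) {b : H →L[ℂ] H} (hb : ∀ a ∈ S, Commute a b) : Commute b x := by
  have hx' : x ∈ StarSubalgebra.centralizer ℂ
    (StarSubalgebra.centralizer ℂ S : Set (H →L[ℂ] H)) := hx
  rw [StarSubalgebra.mem_centralizer_iff] at hx'
  refine (hx' b ?_).1
  rw [SetLike.mem_coe, StarSubalgebra.mem_centralizer_iff]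
  exact fun a ha => ⟨hb a ha, hb _ (hS a ha)⟩

theorem mem_vnGen_of_commute {S : Set (H →L[ℂ] H)} {x : H →L[ℂ] H}
    (hx : ∀ b, (∀ a ∈ S, Commute a b) → Commute b x) : x ∈ vnGen S := by
  change x ∈ StarSubalgebra.centralizer ℂ (StarSubalgebra.centralizer ℂ S : Set (H →L[ℂ] H))
  rw [StarSubalgebra.mem_centralizer_iff]
  intro g hg
  have hg' := star_mem hg
  rw [SetLike.mem_coe] at hg
  rw [StarSubalgebra.mem_centralizer_iff] at hg hg'
  exact ⟨hx g fun a ha => (hg a ha).1, hx _ fun a ha => (hg' a ha).1⟩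

/-- The Hilbert space `ℓ²(I) ⊗ H`. -/
abbrev ampSpace (I : Type*) (H : Type*) [NormedAddCommGroup H] [InnerProductSpace ℂ H] :
    Type _ := lp (fun _ : I => H) 2

/-- The amplification `1 ⊗ x`. -/
def amp (I : Type*) (x : H →L[ℂ] H) : ampSpace I H →L[ℂ] ampSpace I H :=
  lp.mapCLM 2 (fun _ => x) (norm_nonneg x) (fun _ => le_rfl)

@[simp] theorem amp_apply (I : Type*) (x : H →L[ℂ] H) (f : ampSpace I H) (i : I) :
    amp I x f i = x (f i) := rfl

/-- The amplification `x ↦ 1 ⊗ x` as a `*`-homomorphism. -/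
def ampHom (I : Type*) (H : Type*) [NormedAddCommGroup H] [InnerProductSpace ℂ H]
    [CompleteSpace H] : (H →L[ℂ] H) →⋆ₐ[ℂ] (ampSpace I H →L[ℂ] ampSpace I H) where
  toFun := amp I
  map_one' := by ext f i; rfl
  map_mul' x y := by ext f i; rfl
  map_zero' := by ext f i; rfl
  map_add' x y := by ext f i; rfl
  commutes' r := by ext f i; rfl
  map_star' x := by
    rw [ContinuousLinearMap.star_eq_adjoint, ContinuousLinearMap.star_eq_adjoint,
      ContinuousLinearMap.eq_adjoint_iff]
    intro f g
    rw [lp.inner_eq_tsum, lp.inner_eq_tsum]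
    refine tsum_congr fun i => ?_
    exact ContinuousLinearMap.adjoint_inner_left _ _ _

theorem amp_star (I : Type*) (x : H →L[ℂ] H) : amp I (star x) = star (amp I x) :=
  map_star (ampHom I H) x

/-- An operator commuting with the amplification of `S` commutes with that of `S''`. -/
theorem commute_amp {I : Type*} {S : Set (H →L[ℂ] H)} (hS : ∀ a ∈ S, star a ∈ S)
    {T : ampSpace I H →L[ℂ] ampSpace I H} (hT : ∀ a ∈ S, Commute (amp I a) T)
    {x : H →L[ℂ] H} (hx : x ∈ vnGen S) : Commute T (amp I x) := by
  classical
  have hsingle : ∀ (a : H →L[ℂ] H) j v,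
      amp I a (lp.single 2 j v) = lp.single 2 j (a v) := by
    intro a j v
    ext i
    rw [amp_apply]
    by_cases h : i = j
    · subst h; simp
    · rw [lp.single_apply_ne _ _ _ h, lp.single_apply_ne _ _ _ h, map_zero]
  -- The matrix entries of `T` lie in the commutant of `S`, hence commute with all of `S''`; an
  -- operator on `ℓ²(I) ⊗ H` is determined by its entries.
  let t : I → I → H →L[ℂ] H := fun i j =>
    (lp.evalCLM ℂ (fun _ : I => H) 2 i ∘L T) ∘L lp.singleContinuousLinearMap ℂ (fun _ : I => H) 2 j
  have ht : ∀ i j v, t i j v = T (lp.single 2 j v) i := fun i j v => rfl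
  have hc : ∀ i j, Commute (t i j) x := fun i j => by
    refine commute_of_mem_vnGen hS hx fun a ha => ?_
    ext v
    change a (t i j v) = t i j (a v)
    rw [ht, ht, ← hsingle]
    have := congrArg (fun R => R (lp.single 2 j v) i) (hT a ha).eq
    exact this
  refine lp.ext_continuousLinearMap (by simp) fun j => ?_
  ext v i
  change T (amp I x (lp.single 2 j v)) i = x (T (lp.single 2 j v) i)
  rw [hsingle, ← ht, ← ht]
  exact congrArg (fun R => R v) (hc i j).eq

/-- A subspace invariant under both `T` and `T*` is reducing for `T`. -/
theorem commute_starProjection {E : Type*} [NormedAddCommGroup E] [InnerProductSpace ℂ E]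
    [CompleteSpace E] (K : Submodule ℂ E) [K.HasOrthogonalProjection] {T : E →L[ℂ] E}
    (h : ∀ v ∈ K, T v ∈ K) (h' : ∀ v ∈ K, star T v ∈ K) : Commute T K.starProjection := by
  ext v
  change T (K.starProjection v) = K.starProjection (T v)
  symm
  refine Submodule.eq_starProjection_of_mem_of_inner_eq_zero
    (h _ (Submodule.starProjection_apply_mem _ _)) fun w hw => ?_
  rw [← map_sub, ← ContinuousLinearMap.adjoint_inner_right]
  exact Submodule.inner_left_of_mem_orthogonal (h' w hw)
    (Submodule.sub_starProjection_mem_orthogonal v)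

/-- `S'' ζ` is in the closure of the span of `S ζ`, also after amplification. -/
theorem amp_mem_closure_span {I : Type*} {S : Set (H →L[ℂ] H)} (h1 : 1 ∈ S)
    (hmul : ∀ a ∈ S, ∀ b ∈ S, a * b ∈ S) (hS : ∀ a ∈ S, star a ∈ S) (ζ : ampSpace I H)
    {x : H →L[ℂ] H} (hx : x ∈ vnGen S) :
    amp I x ζ ∈ (Submodule.span ℂ ((fun a => amp I a ζ) '' S)).topologicalClosure := by
  set K := (Submodule.span ℂ ((fun a => amp I a ζ) '' S)).topologicalClosure with hK
  have : CompleteSpace K := (Submodule.isClosed_topologicalClosure _).completeSpace_coe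
  have hinv : ∀ a ∈ S, ∀ v ∈ K, amp I a v ∈ K := by
    intro a ha
    have : Submodule.span ℂ ((fun a => amp I a ζ) '' S) ≤ K.comap (amp I a).toLinearMap := by
      rw [Submodule.span_le]
      rintro _ ⟨b, hb, rfl⟩
      exact Submodule.le_topologicalClosure _
        (Submodule.subset_span ⟨a * b, hmul a ha b hb, rfl⟩)
    intro v hv
    exact Submodule.topologicalClosure_minimal _ this
      ((Submodule.isClosed_topologicalClosure _).preimage (amp I a).continuous) hv
  -- The double commutant argument: the projection onto `K` commutes with `1 ⊗ S`, hence with `1 ⊗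
  -- S''`, and it fixes `ζ` because `1 ∈ S`.
  have hP : ∀ a ∈ S, Commute (amp I a) K.starProjection := fun a ha =>
    commute_starProjection K (hinv a ha) (by rw [← amp_star]; exact hinv _ (hS a ha))
  have hc := commute_amp hS hP hx
  have hζ : ζ ∈ K := Submodule.le_topologicalClosure _ (Submodule.subset_span ⟨1, h1, rfl⟩)
  rw [← Submodule.starProjection_eq_self_iff (K := K)]
  have := congrArg (fun R => R ζ) hc.eq
  refine this.trans ?_
  exact congrArg (amp I x) (Submodule.starProjection_eq_self_iff.2 hζ)

/-- Normal maps are determined by their values on a generating self-adjoint monoid. -/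
theorem IsNormal.ext {K : Type*} [NormedAddCommGroup K] [InnerProductSpace ℂ K]
    {S : Set (H →L[ℂ] H)} (h1 : 1 ∈ S) (hmul : ∀ a ∈ S, ∀ b ∈ S, a * b ∈ S)
    (hS : ∀ a ∈ S, star a ∈ S) {ρ ρ' : (vnGen S).toStarSubalgebra → (K →L[ℂ] K)}
    (hρ : IsNormal (vnGen S) ρ) (hρ' : IsNormal (vnGen S) ρ')
    (h : ∀ a (ha : a ∈ S), ρ ⟨a, mem_vnGen ha⟩ = ρ' ⟨a, mem_vnGen ha⟩) : ρ = ρ' := by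
  funext x
  -- Over `ℂ` an operator is determined by its quadratic form.
  rw [← ContinuousLinearMap.coe_inj, ← ext_inner_map]
  intro ξ
  change ⟪ρ x ξ, ξ⟫_ℂ = ⟪ρ' x ξ, ξ⟫_ℂ
  rw [← inner_conj_symm, ← inner_conj_symm (ρ' x ξ)]
  congr 1
  change ⟪ξ, ρ x ξ⟫_ℂ = ⟪ξ, ρ' x ξ⟫_ℂ
  obtain ⟨ζ, hζ, hζs⟩ := hρ ξ
  obtain ⟨ζ', hζ', hζs'⟩ := hρ' ξ
  have hmem : ∀ ζ₁ ζ₂ : ℕ → H, Summable (fun n => ‖ζ₁ n‖ ^ 2) → Summable (fun n => ‖ζ₂ n‖ ^ 2) →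
      Memℓp (E := fun _ : ℕ ⊕ ℕ => H) (Sum.elim ζ₁ ζ₂) 2 := by
    intro ζ₁ ζ₂ h₁ h₂
    refine memℓp_gen ?_
    refine Summable.sum _ ?_ ?_
    · simpa [Function.comp_def] using h₁
    · simpa [Function.comp_def] using h₂
  -- Concatenating the two sequences, with a sign on the second half of `Z'`, turns the difference
  -- of the two vector functionals into the single coefficient `⟪Z', (1 ⊗ x) Z⟫`. It vanishes on
  -- `S`, hence on the closed span of `(1 ⊗ S) Z`, which contains `(1 ⊗ x) Z`.
  let Z : ampSpace (ℕ ⊕ ℕ) H := ⟨Sum.elim ζ ζ', hmem ζ ζ' hζ hζ'⟩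
  let Z' : ampSpace (ℕ ⊕ ℕ) H := ⟨Sum.elim ζ (-ζ'), hmem ζ (-ζ') hζ (by simpa using hζ')⟩
  have hin : ∀ y : (vnGen S).toStarSubalgebra,
      ⟪Z', amp (ℕ ⊕ ℕ) (y : H →L[ℂ] H) Z⟫_ℂ = ⟪ξ, ρ y ξ⟫_ℂ - ⟪ξ, ρ' y ξ⟫_ℂ := by
    intro y
    refine (lp.hasSum_inner Z' (amp (ℕ ⊕ ℕ) (y : H →L[ℂ] H) Z)).unique ?_
    rw [sub_eq_add_neg]
    refine HasSum.sum ?_ ?_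
    · exact hζs y
    · have h2 : HasSum (fun n => -⟪ζ' n, (y : H →L[ℂ] H) (ζ' n)⟫_ℂ) (-⟪ξ, ρ' y ξ⟫_ℂ) :=
        (hζs' y).neg
      simp only [← inner_neg_left] at h2 ⊢
      exact h2
  have hK : (Submodule.span ℂ ((fun a => amp (ℕ ⊕ ℕ) a Z) '' S)).topologicalClosure ≤
      LinearMap.ker (innerSL ℂ Z').toLinearMap := by
    refine Submodule.topologicalClosure_minimal _ ?_ (innerSL ℂ Z').isClosed_ker
    rw [Submodule.span_le]
    rintro _ ⟨a, ha, rfl⟩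
    change ⟪Z', amp (ℕ ⊕ ℕ) a Z⟫_ℂ = 0
    rw [hin ⟨a, mem_vnGen ha⟩, h a ha, sub_self]
  have := hK (amp_mem_closure_span h1 hmul hS Z x.2)
  rw [← sub_eq_zero, ← hin]
  exact this

/-- Vector functionals of an amplification are normal. -/
theorem exists_hasSum_amp {I : Type*} (Ξ : ampSpace I H) :
    ∃ ζ : ℕ → H, Summable (fun n => ‖ζ n‖ ^ 2) ∧
      ∀ x : H →L[ℂ] H, HasSum (fun n => ⟪ζ n, x (ζ n)⟫_ℂ) ⟪Ξ, amp I x Ξ⟫_ℂ := by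
  have hsum : Summable fun i => ‖Ξ i‖ ^ 2 := by
    simpa using (lp.memℓp Ξ).summable (by simp)
  -- The index set may be uncountable, but a square summable family has countable support; the
  -- support is injected into `ℕ` and the family is extended by `0`.
  have hcount : (Function.support fun i => ‖Ξ i‖ ^ 2).Countable := hsum.countable_support
  set s := Function.support fun i => ‖Ξ i‖ ^ 2 with hs
  obtain ⟨e, he⟩ := Set.countable_iff_exists_injective.1 hcount
  let ζ : ℕ → H := Function.extend e (fun i : s => Ξ i) 0
  have hζ : ∀ i : s, ζ (e i) = Ξ i := fun i => he.extend_apply _ _ _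
  have hζ0 : ∀ n, n ∉ Set.range e → ζ n = 0 := fun n hn => by
    simp only [ζ]
    rw [Function.extend_apply' _ _ _ (by simpa using hn)]
    rfl
  have hΞ0 : ∀ i, i ∉ s → Ξ i = 0 := fun i hi => by
    simpa [hs] using hi
  refine ⟨ζ, ?_, fun x => ?_⟩
  · rw [← he.summable_iff (fun n hn => by simp [hζ0 n hn])]
    have := hsum.subtype s
    refine this.congr fun i => ?_
    simp [hζ]
  · rw [← he.hasSum_iff (fun n hn => by simp [hζ0 n hn])]
    have h1 := lp.hasSum_inner (𝕜 := ℂ) Ξ (amp I x Ξ)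
    rw [← hasSum_subtype_iff_of_support_subset (s := s)] at h1
    · have h2 : ((fun n => ⟪ζ n, x (ζ n)⟫_ℂ) ∘ e) =
          (fun i => ⟪Ξ i, amp I x Ξ i⟫_ℂ) ∘ ((↑) : s → I) := by
        funext i
        simp only [Function.comp_apply, hζ]
        rfl
      rw [h2]
      exact h1
    · intro i hi
      by_contra h
      simp [hΞ0 i h] at hi

end Amplification

/-! ### Tensors in `L²(Ω × Γ)` -/

section Tensor

variable {Γ : Type*} [Group Γ] [Countable Γ] [MeasurableSpace Γ] [DiscreteMeasurableSpace Γ]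
  {Ω : Type*} [MeasurableSpace Ω] (μ : Measure Ω) [SigmaFinite μ]

/-- `Γ` is countable, so null sets of `Ω × Γ` are those whose slices are all null. No measurability
of `P` is needed. -/
theorem ae_prodMeasure_iff {P : Ω × Γ → Prop} :
    (∀ᵐ p ∂(prodMeasure Γ μ), P p) ↔ ∀ g : Γ, ∀ᵐ ω ∂μ, P (ω, g) := by
  constructor
  · intro h
    rw [← ae_all_iff]
    filter_upwards [Measure.ae_ae_of_ae_prod h] with ω hω
    exact Measure.ae_count_iff.1 hω
  · intro h
    rw [ae_iff]
    have hsub : {p : Ω × Γ | ¬ P p} ⊆ ⋃ g : Γ, {ω | ¬ P (ω, g)} ×ˢ {g} := by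
      rintro ⟨ω, g⟩ hp
      exact Set.mem_iUnion.2 ⟨g, hp, rfl⟩
    refine measure_mono_null hsub (measure_iUnion_null fun g => ?_)
    rw [Measure.prod_prod, ae_iff.1 (h g), zero_mul]

theorem memLp_slice (v : L2Prod Γ μ) (g : Γ) : MemLp (fun ω => v (ω, g)) 2 μ := by
  have hm : StronglyMeasurable fun ω => v (ω, g) :=
    (Lp.stronglyMeasurable v).comp_measurable measurable_prodMk_right
  rw [memLp_two_iff_integrable_sq_norm hm.aestronglyMeasurable]
  have h := (memLp_two_iff_integrable_sq_norm (Lp.aestronglyMeasurable v)).1 (Lp.memLp v)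
  exact Measure.ae_count_iff.1 h.prod_left_ae g

/-- The vector `1_A ⊗ δ_g`. -/
def indVec {A : Set Ω} (hA : MeasurableSet A) (hμA : μ A ≠ ∞) (g : Γ) : L2Prod Γ μ :=
  indicatorConstLp 2 (s := A ×ˢ {g}) (hA.prod (measurableSet_singleton g))
    (by rw [Measure.prod_prod]; simpa using hμA) (1 : ℂ)

theorem indVec_ae {A : Set Ω} (hA : MeasurableSet A) (hμA : μ A ≠ ∞) (g : Γ) :
    indVec μ hA hμA g =ᵐ[prodMeasure Γ μ] (A ×ˢ {g}).indicator fun _ => (1 : ℂ) :=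
  indicatorConstLp_coeFn

theorem inner_indVec {A : Set Ω} (hA : MeasurableSet A) (hμA : μ A ≠ ∞) (g : Γ)
    (v : L2Prod Γ μ) : ⟪indVec μ hA hμA g, v⟫_ℂ = ∫ ω in A, v (ω, g) ∂μ := by
  have hfin : prodMeasure Γ μ (A ×ˢ {g}) ≠ ∞ := by
    rw [Measure.prod_prod]; simpa using hμA
  rw [indVec, L2.inner_indicatorConstLp_one, setIntegral_prod]
  · simp [Measure.restrict_singleton]
  · exact integrableOn_Lp_of_measure_ne_top v (by norm_num) hfin

/-- The vectors `1_A ⊗ δ_g` separate the points of `L²(Ω × Γ)`. -/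
theorem eq_zero_of_inner_indVec {v : L2Prod Γ μ}
    (h : ∀ (A : Set Ω) (hA : MeasurableSet A) (hμA : μ A ≠ ∞) (g : Γ),
      ⟪indVec μ hA hμA g, v⟫_ℂ = 0) : v = 0 := by
  rw [Lp.eq_zero_iff_ae_eq_zero]
  refine (ae_prodMeasure_iff μ (P := fun p => v p = 0)).2 fun g => ?_
  refine ae_eq_zero_of_forall_setIntegral_eq_of_sigmaFinite (fun A hA hμA => ?_) fun A hA hμA => ?_
  · have := Fact.mk hμA
    exact ((memLp_slice μ v g).restrict A).integrable (by norm_num)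
  · rw [← inner_indVec μ hA hμA.ne, h]

theorem eq_of_inner_indVec {v w : L2Prod Γ μ}
    (h : ∀ (A : Set Ω) (hA : MeasurableSet A) (hμA : μ A ≠ ∞) (g : Γ),
      ⟪indVec μ hA hμA g, v⟫_ℂ = ⟪indVec μ hA hμA g, w⟫_ℂ) : v = w := by
  rw [← sub_eq_zero]
  exact eq_zero_of_inner_indVec μ fun A hA hμA g => by rw [inner_sub_right, h, sub_self]

theorem span_indVec : (Submodule.span ℂ {v : L2Prod Γ μ | ∃ (A : Set Ω) (hA : MeasurableSet A)
    (hμA : μ A ≠ ∞) (g : Γ), v = indVec μ hA hμA g}).topologicalClosure = ⊤ := by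
  rw [Submodule.topologicalClosure_eq_top_iff, Submodule.eq_bot_iff]
  intro v hv
  refine eq_zero_of_inner_indVec μ fun A hA hμA g => ?_
  have hmem : indVec μ hA hμA g ∈ Submodule.span ℂ {v : L2Prod Γ μ | ∃ (A : Set Ω)
      (hA : MeasurableSet A) (hμA : μ A ≠ ∞) (g : Γ), v = indVec μ hA hμA g} :=
    Submodule.subset_span ⟨A, hA, hμA, g, rfl⟩
  exact Submodule.inner_right_of_mem_orthogonal hmem hv

theorem memLp_tensor (f : Lp ℂ 2 μ) (v : ell2 Γ) :
    MemLp (fun p : Ω × Γ => f p.1 * v p.2) 2 (prodMeasure Γ μ) := by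
  have hm : AEStronglyMeasurable (fun p : Ω × Γ => f p.1 * v p.2) (prodMeasure Γ μ) :=
    (Lp.aestronglyMeasurable f).comp_fst.mul (Lp.aestronglyMeasurable v).comp_snd
  rw [memLp_two_iff_integrable_sq_norm hm]
  have hf := (memLp_two_iff_integrable_sq_norm (Lp.aestronglyMeasurable f)).1 (Lp.memLp f)
  have hv := (memLp_two_iff_integrable_sq_norm (Lp.aestronglyMeasurable v)).1 (Lp.memLp v)
  refine (hf.mul_prod hv).congr (ae_of_all _ fun p => ?_)
  simp [mul_pow]

/-- The vector `f ⊗ v`. -/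
def tensor (f : Lp ℂ 2 μ) (v : ell2 Γ) : L2Prod Γ μ := (memLp_tensor μ f v).toLp _

theorem tensor_ae (f : Lp ℂ 2 μ) (v : ell2 Γ) :
    tensor μ f v =ᵐ[prodMeasure Γ μ] fun p => f p.1 * v p.2 :=
  (memLp_tensor μ f v).coeFn_toLp

theorem inner_tensor (f f' : Lp ℂ 2 μ) (v v' : ell2 Γ) :
    ⟪tensor μ f v, tensor μ f' v'⟫_ℂ = ⟪f, f'⟫_ℂ * ⟪v, v'⟫_ℂ := by
  rw [L2.inner_def, L2.inner_def, L2.inner_def, ← integral_prod_mul]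
  refine integral_congr_ae ?_
  filter_upwards [tensor_ae μ f v, tensor_ae μ f' v'] with p h1 h2
  rw [h1, h2]
  simp only [RCLike.inner_apply, map_mul]
  ring

theorem norm_tensor (f : Lp ℂ 2 μ) (v : ell2 Γ) : ‖tensor μ f v‖ = ‖f‖ * ‖v‖ := by
  have h := inner_tensor μ f f v v
  rw [inner_self_eq_norm_sq_to_K, inner_self_eq_norm_sq_to_K, inner_self_eq_norm_sq_to_K] at h
  have h' : ‖tensor μ f v‖ ^ 2 = (‖f‖ * ‖v‖) ^ 2 := by
    rw [mul_pow]
    exact_mod_cast h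
  exact (sq_eq_sq₀ (norm_nonneg _) (by positivity)).1 h'

theorem ell2_ext {v w : ell2 Γ} (h : ∀ g, v g = w g) : v = w :=
  Lp.ext (ae_of_all _ h)

theorem ell2_add_apply (v w : ell2 Γ) (g : Γ) : (v + w) g = v g + w g :=
  Measure.ae_count_iff.1 (Lp.coeFn_add v w) g

theorem ell2_smul_apply (c : ℂ) (v : ell2 Γ) (g : Γ) : (c • v) g = c * v g :=
  Measure.ae_count_iff.1 (Lp.coeFn_smul c v) g

theorem lam_apply (h : Γ) (v : ell2 Γ) (g : Γ) : lam h v g = v (h⁻¹ * g) :=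
  Measure.ae_count_iff.1 (compOp_ae _ _ _ v) g

theorem groupJ_apply (v : ell2 Γ) (g : Γ) : groupJ Γ v g = conj (v g⁻¹) :=
  Measure.ae_count_iff.1 (conjComp_ae _ _ _ v) g

/-- The operator `v ↦ f ⊗ v`. -/
def tensorL (f : Lp ℂ 2 μ) : ell2 Γ →L[ℂ] L2Prod Γ μ :=
  LinearMap.mkContinuous
    { toFun := tensor μ f
      map_add' := fun v w => by
        apply Lp.ext
        filter_upwards [tensor_ae μ f (v + w), tensor_ae μ f v, tensor_ae μ f w,
          Lp.coeFn_add (tensor μ f v) (tensor μ f w)] with p h1 h2 h3 h4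
        rw [h1, h4, Pi.add_apply, h2, h3, ell2_add_apply, mul_add]
      map_smul' := fun c v => by
        apply Lp.ext
        filter_upwards [tensor_ae μ f (c • v), tensor_ae μ f v,
          Lp.coeFn_smul c (tensor μ f v)] with p h1 h2 h3
        rw [h1, RingHom.id_apply, h3, Pi.smul_apply, h2, ell2_smul_apply, smul_eq_mul]
        ring }
    ‖f‖ (fun v => (norm_tensor μ f v).le)

/-- The basis vector `δ_g`. -/
def delta (g : Γ) : ell2 Γ :=
  indicatorConstLp 2 (s := {g}) (measurableSet_singleton g) (by simp) (1 : ℂ)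

theorem delta_apply [DecidableEq Γ] (g h : Γ) : delta g h = if h = g then 1 else 0 := by
  have := Measure.ae_count_iff.1 (indicatorConstLp_coeFn (p := 2) (s := {g})
    (hs := measurableSet_singleton g) (hμs := by simp) (c := (1 : ℂ)) (μ := Measure.count)) h
  refine this.trans ?_
  simp [Set.indicator_apply]

theorem inner_delta (g : Γ) (v : ell2 Γ) : ⟪delta g, v⟫_ℂ = v g := by
  rw [delta, L2.inner_indicatorConstLp_one]
  simp [Measure.restrict_singleton]

theorem norm_delta (g : Γ) : ‖delta g‖ = 1 := by
  rw [delta, norm_indicatorConstLp (by simp) (by simp)]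
  simp [Measure.real]

theorem span_delta : (Submodule.span ℂ (Set.range (delta (Γ := Γ)))).topologicalClosure = ⊤ := by
  rw [Submodule.topologicalClosure_eq_top_iff, Submodule.eq_bot_iff]
  intro v hv
  refine ell2_ext fun g => ?_
  have hmem : delta g ∈ Submodule.span ℂ (Set.range (delta (Γ := Γ))) :=
    Submodule.subset_span ⟨g, rfl⟩
  rw [← inner_delta, Submodule.inner_right_of_mem_orthogonal hmem hv, ← inner_delta,
    inner_zero_right]

theorem lam_delta (h g : Γ) : lam h (delta g) = delta (h * g) := by
  classical
  refine ell2_ext fun k => ?_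
  rw [lam_apply, delta_apply, delta_apply]
  simp [inv_mul_eq_iff_eq_mul]

theorem groupJ_delta (g : Γ) : groupJ Γ (delta g) = delta g⁻¹ := by
  classical
  refine ell2_ext fun k => ?_
  rw [groupJ_apply, delta_apply, delta_apply]
  simp [inv_eq_iff_eq_inv, apply_ite]

theorem indVec_eq_tensor {A : Set Ω} (hA : MeasurableSet A) (hμA : μ A ≠ ∞) (g : Γ) :
    indVec μ hA hμA g = tensor μ (indicatorConstLp 2 hA hμA (1 : ℂ)) (delta g) := by
  classical
  apply Lp.ext
  filter_upwards [indVec_ae μ hA hμA g, tensor_ae μ (indicatorConstLp 2 hA hμA (1 : ℂ)) (delta g),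
    (ae_prodMeasure_iff μ (P := fun p : Ω × Γ => indicatorConstLp 2 hA hμA (1 : ℂ) p.1 =
      A.indicator (fun _ => 1) p.1)).2 fun _ => indicatorConstLp_coeFn] with p h1 h2 h3
  rw [h1, h2, h3, delta_apply]
  by_cases hp : p.1 ∈ A <;> by_cases hg : p.2 = g <;> simp [hp, hg]

end Tensor

/-! ### The homomorphism associated with a cocycle -/

section Twisted

variable {Γ : Type*} [Group Γ] [Countable Γ] [MeasurableSpace Γ] [DiscreteMeasurableSpace Γ]
  {Ω : Type*} [MeasurableSpace Ω] [MulAction Γ Ω] [MeasurableConstSMul Γ Ω]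
  (μ : Measure Ω) [SigmaFinite μ] [SMulInvariantMeasure Γ Ω μ]

/-- The operator `f ↦ f ⊗ v`. -/
def tensorR (v : ell2 Γ) : Lp ℂ 2 μ →L[ℂ] L2Prod Γ μ :=
  LinearMap.mkContinuous
    { toFun := fun f => tensor μ f v
      map_add' := fun f f' => by
        apply Lp.ext
        filter_upwards [tensor_ae μ (f + f') v, tensor_ae μ f v, tensor_ae μ f' v,
          Lp.coeFn_add (tensor μ f v) (tensor μ f' v),
          (ae_prodMeasure_iff μ (P := fun p : Ω × Γ => (f + f') p.1 = f p.1 + f' p.1)).2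
            fun _ => Lp.coeFn_add f f'] with p h1 h2 h3 h4 h5
        rw [h1, h4, Pi.add_apply, h2, h3, h5, add_mul]
      map_smul' := fun c f => by
        apply Lp.ext
        filter_upwards [tensor_ae μ (c • f) v, tensor_ae μ f v,
          Lp.coeFn_smul c (tensor μ f v),
          (ae_prodMeasure_iff μ (P := fun p : Ω × Γ => (c • f) p.1 = c * f p.1)).2
            fun _ => Lp.coeFn_smul c f] with p h1 h2 h3 h4
        rw [h1, RingHom.id_apply, h3, Pi.smul_apply, h2, h4, smul_eq_mul]
        ring }
    ‖v‖ (fun f => (norm_tensor μ f v).le.trans (mul_comm _ _).le)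

theorem tensorR_apply (f : Lp ℂ 2 μ) (v : ell2 Γ) : tensorR μ v f = tensor μ f v := rfl

variable (κ : TorusCocycle Γ μ)

theorem TorusCocycle.bddMeas_twist :
    BddMeas (fun p : Ω × Γ => κ.toFun p.2 (p.2 • p.1)) :=
  ⟨measurable_from_prod_countable_left fun g =>
    (κ.measurable' g).comp (measurable_const_smul g), 1, fun _ => (κ.norm_eq_one' _ _).le⟩

/-- Multiplication by `(ω, h) ↦ κ_h(h • ω)`. -/
def twistOp : L2Prod Γ μ →L[ℂ] L2Prod Γ μ :=
  mulOp _ (fun p => κ.toFun p.2 (p.2 • p.1)) (κ.bddMeas_twist μ)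

theorem twistOp_ae (v : L2Prod Γ μ) :
    twistOp μ κ v =ᵐ[prodMeasure Γ μ] fun p => κ.toFun p.2 (p.2 • p.1) * v p :=
  mulOp_ae _ _ _ v

theorem TorusCocycle.conj_mul_self (g : Γ) (ω : Ω) :
    conj (κ.toFun g ω) * κ.toFun g ω = 1 := by
  rw [Complex.conj_mul', κ.norm_eq_one']
  simp

theorem TorusCocycle.mul_conj_self (g : Γ) (ω : Ω) :
    κ.toFun g ω * conj (κ.toFun g ω) = 1 := by
  rw [mul_comm, κ.conj_mul_self]

theorem star_twistOp_mul : star (twistOp μ κ) * twistOp μ κ = 1 := by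
  ext1 v
  apply Lp.ext
  rw [twistOp, star_mulOp]
  change mulOp _ _ (κ.bddMeas_twist μ).conj (twistOp μ κ v) =ᵐ[_] v
  filter_upwards [mulOp_ae _ _ (κ.bddMeas_twist μ).conj (twistOp μ κ v), twistOp_ae μ κ v]
    with p h1 h2
  rw [h1, h2, ← mul_assoc, κ.conj_mul_self, one_mul]

theorem twistOp_mul_star : twistOp μ κ * star (twistOp μ κ) = 1 := by
  ext1 v
  apply Lp.ext
  rw [twistOp, star_mulOp]
  change twistOp μ κ (mulOp _ _ (κ.bddMeas_twist μ).conj v) =ᵐ[_] v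
  filter_upwards [mulOp_ae _ _ (κ.bddMeas_twist μ).conj v,
    twistOp_ae μ κ (mulOp _ _ (κ.bddMeas_twist μ).conj v)] with p h1 h2
  rw [h2, h1, ← mul_assoc, κ.mul_conj_self, one_mul]

theorem inner_twistOp (u v : L2Prod Γ μ) : ⟪twistOp μ κ u, twistOp μ κ v⟫_ℂ = ⟪u, v⟫_ℂ := by
  rw [← ContinuousLinearMap.adjoint_inner_right, ← ContinuousLinearMap.star_eq_adjoint]
  exact congrArg (fun T : L2Prod Γ μ →L[ℂ] L2Prod Γ μ => ⟪u, T v⟫_ℂ) (star_twistOp_mul μ κ)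

/-- The operator `v ↦ ∑_h κ_h(h • ω) f(ω) v(h)`, which intertwines `ℒΓ` and its image under the
twisted homomorphism. -/
def twistTensor (f : Lp ℂ 2 μ) : ell2 Γ →L[ℂ] L2Prod Γ μ := twistOp μ κ ∘L tensorL μ f

theorem twistTensor_apply (f : Lp ℂ 2 μ) (v : ell2 Γ) :
    twistTensor μ κ f v = twistOp μ κ (tensor μ f v) := rfl

theorem twistTensor_ae (f : Lp ℂ 2 μ) (v : ell2 Γ) :
    twistTensor μ κ f v =ᵐ[prodMeasure Γ μ]
      fun p => κ.toFun p.2 (p.2 • p.1) * (f p.1 * v p.2) := by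
  filter_upwards [twistOp_ae μ κ (tensor μ f v), tensor_ae μ f v] with p h1 h2
  rw [twistTensor_apply, h1, h2]

theorem inner_twistTensor (f f' : Lp ℂ 2 μ) (v v' : ell2 Γ) :
    ⟪twistTensor μ κ f v, twistTensor μ κ f' v'⟫_ℂ = ⟪f, f'⟫_ℂ * ⟪v, v'⟫_ℂ := by
  rw [twistTensor_apply, twistTensor_apply, inner_twistOp, inner_tensor]

theorem norm_twistTensor (f : Lp ℂ 2 μ) (v : ell2 Γ) : ‖twistTensor μ κ f v‖ = ‖f‖ * ‖v‖ := by
  rw [← norm_tensor, norm_eq_sqrt_re_inner (𝕜 := ℂ), norm_eq_sqrt_re_inner (𝕜 := ℂ),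
    twistTensor_apply, inner_twistOp]

/-- Untwisting by the unitary `twistOp` reduces the claim to the vectors `1_A ⊗ δ_g`. -/
theorem eq_zero_of_inner_twistTensor {u : L2Prod Γ μ}
    (h : ∀ f v, ⟪twistTensor μ κ f v, u⟫_ℂ = 0) : u = 0 := by
  have h0 : star (twistOp μ κ) u = 0 := by
    refine eq_zero_of_inner_indVec μ fun A hA hμA g => ?_
    rw [indVec_eq_tensor, ContinuousLinearMap.star_eq_adjoint,
      ContinuousLinearMap.adjoint_inner_right]
    exact h _ _
  have := congrArg (fun T : L2Prod Γ μ →L[ℂ] L2Prod Γ μ => T u) (twistOp_mul_star μ κ)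
  change twistOp μ κ (star (twistOp μ κ) u) = u at this
  rw [← this, h0, map_zero]

variable {μ}

/-- The index set of a Hilbert basis of `L²(Ω)`. -/
def basisSet (μ : Measure Ω) : Set (Lp ℂ 2 μ) := (exists_hilbertBasis ℂ (Lp ℂ 2 μ)).choose

/-- A Hilbert basis of `L²(Ω)`. -/
def basisOf (μ : Measure Ω) : HilbertBasis (basisSet μ) ℂ (Lp ℂ 2 μ) :=
  (exists_hilbertBasis ℂ (Lp ℂ 2 μ)).choose_spec.choose

variable (μ)

/-- `twistTensor` as an isometry, for the vectors of the basis. -/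
def twistIsometry (i : basisSet μ) : ell2 Γ →ₗᵢ[ℂ] L2Prod Γ μ where
  toLinearMap := (twistTensor μ κ (basisOf μ i)).toLinearMap
  norm_map' v := by
    change ‖twistTensor μ κ (basisOf μ i) v‖ = ‖v‖
    rw [norm_twistTensor, (basisOf μ).orthonormal.1 i, one_mul]

/-- Orthogonality of the ranges is that of the basis of `L²(Ω)`, as the twist is unitary. For
totality, the coefficient against a fixed `u` is continuous and linear in `f`, so vanishing on the
basis extends to every `f`. -/
theorem isHilbertSum_twistIsometry :
    IsHilbertSum ℂ (fun _ : basisSet μ => ell2 Γ) (twistIsometry μ κ) := by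
  refine IsHilbertSum.mk (fun i j hij v w => ?_) ?_
  · change ⟪twistTensor μ κ (basisOf μ i) v, twistTensor μ κ (basisOf μ j) w⟫_ℂ = 0
    rw [inner_twistTensor, (basisOf μ).orthonormal.2 hij, zero_mul]
  · rw [top_le_iff, Submodule.topologicalClosure_eq_top_iff, Submodule.eq_bot_iff]
    intro u hu
    refine eq_zero_of_inner_twistTensor μ κ fun f v => ?_
    have hz : innerSL ℂ u ∘L (twistOp μ κ ∘L tensorR μ v) = 0 := by
      refine ContinuousLinearMap.ext_on
        (Submodule.dense_iff_topologicalClosure_eq_top.2 (basisOf μ).dense_span) ?_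
      rintro _ ⟨i, rfl⟩
      have hmem : twistIsometry μ κ i v ∈
          ⨆ i, LinearMap.range (twistIsometry μ κ i).toLinearMap :=
        Submodule.mem_iSup_of_mem i ⟨v, rfl⟩
      exact Submodule.inner_left_of_mem_orthogonal hmem hu
    have := congrArg (fun T => T f) hz
    rw [← inner_conj_symm]
    change conj (⟪u, twistTensor μ κ f v⟫_ℂ) = 0
    rw [show ⟪u, twistTensor μ κ f v⟫_ℂ = 0 from this, map_zero]

/-- The decomposition of `L²(Ω × Γ)` as an amplification of `ℓ²(Γ)`. -/
def twistEquiv : L2Prod Γ μ ≃ₗᵢ[ℂ] ampSpace (basisSet μ) (ell2 Γ) :=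
  (isHilbertSum_twistIsometry μ κ).linearIsometryEquiv

theorem twistEquiv_twistTensor (f : Lp ℂ 2 μ) (v : ell2 Γ) (i : basisSet μ) :
    twistEquiv μ κ (twistTensor μ κ f v) i = ⟪basisOf μ i, f⟫_ℂ • v := by
  classical
  refine ext_inner_left ℂ fun u : ell2 Γ => ?_
  rw [inner_smul_right, ← inner_twistTensor μ κ]
  refine (lp.inner_single_left (𝕜 := ℂ) (G := fun _ : basisSet μ => ell2 Γ) i u
    (twistEquiv μ κ (twistTensor μ κ f v))).symm.trans ?_
  rw [← LinearIsometryEquiv.inner_map_map (twistEquiv μ κ).symm,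
    LinearIsometryEquiv.symm_apply_apply]
  congr 1
  exact (isHilbertSum_twistIsometry μ κ).linearIsometryEquiv_symm_apply_single u

/-- The homomorphism `x ↦ D (1 ⊗ x) D*` on all operators. -/
def twistAmp : (ell2 Γ →L[ℂ] ell2 Γ) →⋆ₐ[ℂ] (L2Prod Γ μ →L[ℂ] L2Prod Γ μ) :=
  ((twistEquiv μ κ).symm.conjStarAlgEquiv : _ →⋆ₐ[ℂ] _).comp (ampHom (basisSet μ) (ell2 Γ))

theorem twistAmp_apply (x : ell2 Γ →L[ℂ] ell2 Γ) (u : L2Prod Γ μ) :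
    twistAmp μ κ x u = (twistEquiv μ κ).symm (amp (basisSet μ) x (twistEquiv μ κ u)) := rfl

/-- The left module property of `twistTensor`, exact for every `f`: the amplification acts on the
`ℓ²(Γ)` leg only. -/
theorem twistAmp_twistTensor (x : ell2 Γ →L[ℂ] ell2 Γ) (f : Lp ℂ 2 μ) (v : ell2 Γ) :
    twistAmp μ κ x (twistTensor μ κ f v) = twistTensor μ κ f (x v) := by
  rw [twistAmp_apply, LinearIsometryEquiv.symm_apply_eq]
  ext i : 2
  rw [amp_apply, twistEquiv_twistTensor, twistEquiv_twistTensor, map_smul]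

theorem ext_twistTensor {S T : L2Prod Γ μ →L[ℂ] L2Prod Γ μ}
    (h : ∀ f v, S (twistTensor μ κ f v) = T (twistTensor μ κ f v)) : S = T := by
  refine ext_of_span_closure (S := {u | ∃ f v, u = twistTensor μ κ f v}) ?_ ?_
  · rw [Submodule.topologicalClosure_eq_top_iff, Submodule.eq_bot_iff]
    intro u hu
    refine eq_zero_of_inner_twistTensor μ κ fun f v => ?_
    have hmem : twistTensor μ κ f v ∈ Submodule.span ℂ {u | ∃ f v, u = twistTensor μ κ f v} :=
      Submodule.subset_span ⟨f, v, rfl⟩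
    exact Submodule.inner_right_of_mem_orthogonal hmem hu
  · rintro _ ⟨f, v, rfl⟩
    exact h f v

/-- The cocycle identity for the pair `(g, g⁻¹h)`, read at the point `hω`. This is what makes
multiplication by `κ_h(hω)` carry `1 ⊗ λ_g` to `κ_g ⋊ λ_g`. -/
theorem TorusCocycle.twist_mul (g : Γ) : ∀ᵐ p ∂(prodMeasure Γ μ),
    κ.toFun p.2 (p.2 • p.1) =
      κ.toFun g (p.2 • p.1) * κ.toFun (g⁻¹ * p.2) ((g⁻¹ * p.2) • p.1) := by
  refine (ae_prodMeasure_iff μ (P := fun p : Ω × Γ => κ.toFun p.2 (p.2 • p.1) =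
      κ.toFun g (p.2 • p.1) * κ.toFun (g⁻¹ * p.2) ((g⁻¹ * p.2) • p.1))).2 fun h => ?_
  have := (measurePreserving_smul h μ).quasiMeasurePreserving.ae (κ.cocycle' g (g⁻¹ * h))
  filter_upwards [this] with ω hω
  rw [mul_inv_cancel_left] at hω
  rw [hω, mul_smul]

/-- The image of `λ_g` is `κ_g ⋊ λ_g`. -/
theorem twistAmp_lam (g : Γ) :
    twistAmp μ κ (lam g) = diagOp μ (κ.toFun g) (κ.bddMeas μ g) * translOp μ g := by
  refine ext_twistTensor μ κ fun f v => ?_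
  rw [twistAmp_twistTensor]
  apply Lp.ext
  have hT := (mp_snd μ (Equiv.mulLeft g⁻¹)).quasiMeasurePreserving.ae (twistTensor_ae μ κ f v)
  filter_upwards [twistTensor_ae μ κ f (lam g v), hT, κ.twist_mul μ g,
    compOp_ae _ _ (mp_snd μ (Equiv.mulLeft g⁻¹)) (twistTensor μ κ f v),
    mulOp_ae (prodMeasure Γ μ) _ ((κ.bddMeas μ g).comp measurable_act)
      (translOp μ g (twistTensor μ κ f v))] with p h1 h2 h3 h4 h5
  refine h1.trans (Eq.trans ?_ h5.symm)
  refine Eq.trans ?_ (congrArg (fun z => κ.toFun g (p.2 • p.1) * z) h4).symm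
  refine Eq.trans ?_ (congrArg (fun z => κ.toFun g (p.2 • p.1) * z) h2).symm
  simp only [Equiv.coe_mulLeft]
  rw [h3, lam_apply]
  ring

theorem star_mem_range_lam : ∀ a ∈ Set.range (lam (Γ := Γ)), star a ∈ Set.range (lam (Γ := Γ)) := by
  rintro _ ⟨g, rfl⟩
  exact ⟨g⁻¹, (star_lam g).symm⟩

/-- An operator commuting with the crossed product commutes with each `κ_g ⋊ λ_g`, that is, with the
amplification of `λ_g` after the decomposition `twistEquiv`. By `commute_amp` it then commutes with
the amplification of all of `ℒΓ`. -/
theorem twistAmp_mem {x : ell2 Γ →L[ℂ] ell2 Γ} (hx : x ∈ groupVN Γ) :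
    twistAmp μ κ x ∈ crossedVN Γ μ := by
  refine mem_vnGen_of_commute fun b hb => ?_
  let e : (L2Prod Γ μ →L[ℂ] L2Prod Γ μ) ≃⋆ₐ[ℂ] _ := (twistEquiv μ κ).conjStarAlgEquiv
  have he : ∀ y, e (twistAmp μ κ y) = amp (basisSet μ) y := fun y => by
    ext u : 1
    change twistEquiv μ κ ((twistEquiv μ κ).symm (amp (basisSet μ) y
      (twistEquiv μ κ ((twistEquiv μ κ).symm u)))) = _
    rw [LinearIsometryEquiv.apply_symm_apply, LinearIsometryEquiv.apply_symm_apply]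
  have hc : Commute (e b) (amp (basisSet μ) x) := by
    refine commute_amp star_mem_range_lam ?_ hx
    rintro _ ⟨g, rfl⟩
    rw [← he, twistAmp_lam]
    have h1 := hb _ (Or.inr ⟨κ.toFun g, κ.bddMeas μ g, rfl⟩)
    have h2 := hb _ (Or.inl ⟨g, rfl⟩)
    exact (h1.mul_left h2).map e
  rw [← he] at hc
  have := hc.map e.symm
  rwa [e.symm_apply_apply, e.symm_apply_apply] at this

/-- The normal homomorphism `π : ℒΓ → L^∞(Ω) ⋊ Γ` with `π(λ_g) = κ_g ⋊ λ_g`. -/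
def twistedHom : (groupVN Γ).toStarSubalgebra →⋆ₐ[ℂ] (crossedVN Γ μ).toStarSubalgebra :=
  ((twistAmp μ κ).comp (groupVN Γ).toStarSubalgebra.subtype).codRestrict _
    fun x => twistAmp_mem μ κ x.2

theorem isTwistedHom_twistedHom : IsTwistedHom μ κ (twistedHom μ κ) := by
  refine ⟨fun ξ => ?_, fun g => twistAmp_lam μ κ g⟩
  obtain ⟨ζ, h1, h2⟩ := exists_hasSum_amp (twistEquiv μ κ ξ)
  refine ⟨ζ, h1, fun x => ?_⟩
  have := h2 (x : ell2 Γ →L[ℂ] ell2 Γ)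
  rw [← LinearIsometryEquiv.inner_map_map (twistEquiv μ κ).symm,
    LinearIsometryEquiv.symm_apply_apply] at this
  exact this

/-- The operators `λ_g` form a self-adjoint monoid generating `ℒΓ`, so `IsNormal.ext` applies. -/
theorem IsTwistedHom.unique
    {π π' : (groupVN Γ).toStarSubalgebra →⋆ₐ[ℂ] (crossedVN Γ μ).toStarSubalgebra}
    (h : IsTwistedHom μ κ π) (h' : IsTwistedHom μ κ π') : π' = π := by
  have key : (fun x => (π' x : L2Prod Γ μ →L[ℂ] L2Prod Γ μ)) =
      fun x => (π x : L2Prod Γ μ →L[ℂ] L2Prod Γ μ) := by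
    refine IsNormal.ext (S := Set.range (lam (Γ := Γ))) ⟨1, ?_⟩ ?_ star_mem_range_lam h'.1 h.1 ?_
    · ext v : 1
      exact ell2_ext fun g => by rw [lam_apply]; simp
    · rintro _ ⟨g, rfl⟩ _ ⟨k, rfl⟩
      refine ⟨g * k, ?_⟩
      ext v : 1
      refine ell2_ext fun l => ?_
      change lam (g * k) v l = lam g (lam k v) l
      rw [lam_apply, lam_apply, lam_apply, mul_inv_rev, mul_assoc]
    · rintro _ ⟨g, rfl⟩
      exact (h'.2 g).trans (h.2 g).symm
  ext x : 1
  exact Subtype.ext (congrFun key x)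

end Twisted

/-! ### The standard form of the crossed product -/

section CrossedStandard

variable {Γ : Type*} [Group Γ] [Countable Γ] [MeasurableSpace Γ] [DiscreteMeasurableSpace Γ]
  {Ω : Type*} [MeasurableSpace Ω] [MulAction Γ Ω] [MeasurableConstSMul Γ Ω]
  (μ : Measure Ω) [SigmaFinite μ] [SMulInvariantMeasure Γ Ω μ]

theorem measure_preimage_smul_ne_top {A : Set Ω} (hμA : μ A ≠ ∞) (g : Γ) :
    μ ((fun ω => g • ω) ⁻¹' A) ≠ ∞ := by
  rwa [measure_preimage_smul]

theorem measure_inter_ne_top {A : Set Ω} (hμA : μ A ≠ ∞) (B : Set Ω) : μ (A ∩ B) ≠ ∞ :=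
  ne_top_of_le_ne_top hμA (measure_mono Set.inter_subset_left)

theorem indVec_congr {A B : Set Ω} (hA : MeasurableSet A) (hμA : μ A ≠ ∞) (hB : MeasurableSet B)
    (hμB : μ B ≠ ∞) {g h : Γ} (hAB : A = B) (hgh : g = h) :
    indVec μ hA hμA g = indVec μ hB hμB h := by
  subst hAB hgh; rfl

theorem cutVec_eq {A : Set Ω} (hA : MeasurableSet A) (hμA : μ A ≠ ∞) :
    cutVec Γ μ hA hμA = indVec μ hA hμA 1 := rfl

variable (Γ) in
/-- The projection `1_A ⋊ λ_e`. -/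
def projOp {A : Set Ω} (hA : MeasurableSet A) : L2Prod Γ μ →L[ℂ] L2Prod Γ μ :=
  diagOp μ (A.indicator fun _ => (1 : ℂ)) (BddMeas.indicator hA)

theorem projOp_mem {A : Set Ω} (hA : MeasurableSet A) : projOp Γ μ hA ∈ crossedGens Γ μ :=
  Or.inr ⟨_, _, rfl⟩

theorem translOp_mem (g : Γ) : translOp μ g ∈ crossedGens Γ μ := Or.inl ⟨g, rfl⟩

theorem translOp_indVec {A : Set Ω} (hA : MeasurableSet A) (hμA : μ A ≠ ∞) (g h : Γ) :
    translOp μ g (indVec μ hA hμA h) = indVec μ hA hμA (g * h) := by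
  classical
  apply Lp.ext
  have hT := (mp_snd μ (Equiv.mulLeft g⁻¹)).quasiMeasurePreserving.ae (indVec_ae μ hA hμA h)
  filter_upwards [compOp_ae _ _ (mp_snd μ (Equiv.mulLeft g⁻¹)) (indVec μ hA hμA h), hT,
    indVec_ae μ hA hμA (g * h)] with p h1 h2 h3
  refine h1.trans (h2.trans (Eq.trans ?_ h3.symm))
  simp [Set.indicator_apply, inv_mul_eq_iff_eq_mul]

theorem cutOp_indVec {A B : Set Ω} (hA : MeasurableSet A) (hμA : μ A ≠ ∞) (hB : MeasurableSet B)
    (g : Γ) : cutOp Γ μ hB (indVec μ hA hμA g) =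
      indVec μ (hA.inter hB) (measure_inter_ne_top μ hμA B) g := by
  classical
  apply Lp.ext
  filter_upwards [mulOp_ae (prodMeasure Γ μ) _ ((BddMeas.indicator hB).comp measurable_fst)
    (indVec μ hA hμA g), indVec_ae μ hA hμA g,
    indVec_ae μ (hA.inter hB) (measure_inter_ne_top μ hμA B) g] with p h1 h2 h3
  refine h1.trans ?_
  rw [h2, h3]
  by_cases ha : p.1 ∈ A <;> by_cases hb : p.1 ∈ B <;> simp [Set.indicator_apply, ha, hb]

theorem projOp_indVec {A B : Set Ω} (hA : MeasurableSet A) (hμA : μ A ≠ ∞) (hB : MeasurableSet B)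
    (g : Γ) : projOp Γ μ hB (indVec μ hA hμA g) =
      indVec μ (hA.inter (measurable_const_smul g hB)) (measure_inter_ne_top μ hμA _) g := by
  classical
  apply Lp.ext
  filter_upwards [mulOp_ae (prodMeasure Γ μ) _ ((BddMeas.indicator hB).comp measurable_act)
    (indVec μ hA hμA g), indVec_ae μ hA hμA g,
    indVec_ae μ (hA.inter (measurable_const_smul g hB)) (measure_inter_ne_top μ hμA _) g]
    with p h1 h2 h3
  refine h1.trans ?_
  rw [h2, h3]
  by_cases ha : p.1 ∈ A <;> by_cases hb : p.2 • p.1 ∈ B <;> by_cases hg : p.2 = g <;>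
    simp_all [Set.indicator_apply]

theorem crossedJ_indVec {A : Set Ω} (hA : MeasurableSet A) (hμA : μ A ≠ ∞) (g : Γ) :
    crossedJ Γ μ (indVec μ hA hμA g) =
      indVec μ (measurable_const_smul g⁻¹ hA) (measure_preimage_smul_ne_top μ hμA g⁻¹) g⁻¹ := by
  classical
  apply Lp.ext
  have hT := (mp_flip (Γ := Γ) μ).quasiMeasurePreserving.ae (indVec_ae μ hA hμA g)
  filter_upwards [conjComp_ae _ _ (mp_flip (Γ := Γ) μ) (indVec μ hA hμA g), hT,
    indVec_ae μ (measurable_const_smul g⁻¹ hA) (measure_preimage_smul_ne_top μ hμA g⁻¹) g⁻¹]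
    with p h1 h2 h3
  refine h1.trans ?_
  rw [h2, h3]
  by_cases hg : p.2 = g⁻¹
  · by_cases ha : p.2 • p.1 ∈ A <;> simp_all [Set.indicator_apply]
  · have hg' : p.2⁻¹ ≠ g := fun h => hg (by rw [← h, inv_inv])
    simp [hg, hg']

theorem crossedJ_cutVec {A : Set Ω} (hA : MeasurableSet A) (hμA : μ A ≠ ∞) :
    crossedJ Γ μ (cutVec Γ μ hA hμA) = cutVec Γ μ hA hμA := by
  rw [cutVec_eq, crossedJ_indVec]
  exact indVec_congr μ _ _ _ _ (by ext; simp) (by simp)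

/-- The left action of `1_A` multiplies by `1_A(gω)` and its right action by `1_A(ω)`; the flip `(ω,
g) ↦ (gω, g⁻¹)` inside `J` exchanges the two. -/
theorem conjBy_projOp {A : Set Ω} (hA : MeasurableSet A) :
    conjBy (crossedJ Γ μ) (projOp Γ μ hA) = cutOp Γ μ hA := by
  classical
  rw [projOp, conjBy_diagOp, cutOp]
  congr 1
  funext p
  by_cases h : p.1 ∈ A <;> simp [h]

theorem star_projOp {A : Set Ω} (hA : MeasurableSet A) :
    star (projOp Γ μ hA) = projOp Γ μ hA := by
  classical
  refine (star_mulOp _ _ ((BddMeas.indicator hA).comp measurable_act)).trans ?_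
  rw [projOp, diagOp]
  congr 1
  funext p
  by_cases h : p.2 • p.1 ∈ A <;> simp [h]

theorem star_cutOp {A : Set Ω} (hA : MeasurableSet A) :
    star (cutOp Γ μ hA) = cutOp Γ μ hA := by
  rw [← conjBy_projOp, star_conjBy (crossedJ_crossedJ μ), star_projOp]

theorem star_translOp (g : Γ) : star (translOp μ g) = translOp μ g⁻¹ :=
  star_compOp _ _ _ _ _ fun x => by simp

theorem crossedJ_projOp {A : Set Ω} (hA : MeasurableSet A) (v : L2Prod Γ μ) :
    crossedJ Γ μ (projOp Γ μ hA v) = cutOp Γ μ hA (crossedJ Γ μ v) := by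
  rw [← conjBy_projOp, conjBy_apply, crossedJ_crossedJ]

theorem crossedJ_cutOp {A : Set Ω} (hA : MeasurableSet A) (v : L2Prod Γ μ) :
    crossedJ Γ μ (cutOp Γ μ hA v) = projOp Γ μ hA (crossedJ Γ μ v) := by
  rw [← conjBy_projOp, conjBy_apply, crossedJ_crossedJ]

theorem commute_conj_of_mem {b a : L2Prod Γ μ →L[ℂ] L2Prod Γ μ} (hb : b ∈ crossedVN Γ μ)
    (ha : a ∈ crossedGens Γ μ) : Commute (conjBy (crossedJ Γ μ) a) b :=
  commute_of_mem_vnGen (star_mem_crossedGens μ) hb fun c hc =>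
    (crossedJ_commute μ a ha c hc).symm

theorem inner_star_apply {E : Type*} [NormedAddCommGroup E] [InnerProductSpace ℂ E]
    [CompleteSpace E] (T : E →L[ℂ] E) (u v : E) : ⟪star T u, v⟫_ℂ = ⟪u, T v⟫_ℂ := by
  rw [ContinuousLinearMap.star_eq_adjoint, ContinuousLinearMap.adjoint_inner_left]

theorem inner_apply_star {E : Type*} [NormedAddCommGroup E] [InnerProductSpace ℂ E]
    [CompleteSpace E] (T : E →L[ℂ] E) (u v : E) : ⟪u, star T v⟫_ℂ = ⟪T u, v⟫_ℂ := by
  rw [ContinuousLinearMap.star_eq_adjoint, ContinuousLinearMap.adjoint_inner_right]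

theorem apply_comm {E : Type*} [NormedAddCommGroup E] [NormedSpace ℂ E]
    {S T : E →L[ℂ] E} (h : Commute S T) (v : E) : S (T v) = T (S v) :=
  congrArg (fun R => R v) h.eq

/-- For an operator `T` in the commutant of the right action, `J T 1_B` and `T* 1_A` are related
as are the square integrable elements `T*` and `T`. -/
theorem cutOp_crossedJ_apply {T : L2Prod Γ μ →L[ℂ] L2Prod Γ μ}
    (hT : ∀ a ∈ crossedGens Γ μ, Commute (conjBy (crossedJ Γ μ) a) T)
    {A B : Set Ω} (hA : MeasurableSet A) (hμA : μ A ≠ ∞) (hB : MeasurableSet B) (hμB : μ B ≠ ∞) :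
    cutOp Γ μ hA (crossedJ Γ μ (T (cutVec Γ μ hB hμB))) =
      projOp Γ μ hB (star T (cutVec Γ μ hA hμA)) := by
  have hJ := crossedJ_crossedJ (Γ := Γ) μ
  have hT' : ∀ a ∈ crossedGens Γ μ, Commute (conjBy (crossedJ Γ μ) a) (star T) := fun a ha => by
    have := (hT _ (star_mem_crossedGens μ a ha)).star_star
    rwa [star_conjBy hJ, star_star] at this
  refine eq_of_inner_indVec μ fun E hE hμE g => ?_
  -- The test vector `1_E ⊗ δ_g`, cut down to `A`, is `λ_g` applied to the `J`-fixed vector `1_{A ∩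
  -- E} ⊗ δ_e`. Hence `J` of it is obtained by the right translation `J λ_g J`, which commutes with
  -- `T*`.
  have he : crossedJ Γ μ (cutOp Γ μ hE (cutVec Γ μ hA hμA)) =
      cutOp Γ μ hE (cutVec Γ μ hA hμA) := by
    rw [cutVec_eq, cutOp_indVec]
    exact crossedJ_cutVec μ (hA.inter hE) (measure_inter_ne_top μ hμA E)
  have hw : cutOp Γ μ hA (indVec μ hE hμE g) =
      translOp μ g (cutOp Γ μ hE (cutVec Γ μ hA hμA)) := by
    rw [cutVec_eq, cutOp_indVec, cutOp_indVec, translOp_indVec]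
    exact indVec_congr μ _ _ _ _ (Set.inter_comm _ _) (by simp)
  have hJw : crossedJ Γ μ (cutOp Γ μ hA (indVec μ hE hμE g)) =
      conjBy (crossedJ Γ μ) (translOp μ g) (cutOp Γ μ hE (cutVec Γ μ hA hμA)) := by
    rw [hw, conjBy_apply, he]
  have hE' : cutOp Γ μ hE (conjBy (crossedJ Γ μ) (translOp μ g⁻¹) (cutVec Γ μ hB hμB)) =
      projOp Γ μ hB (indVec μ hE hμE g) := by
    rw [conjBy_apply, crossedJ_cutVec, cutVec_eq, translOp_indVec, crossedJ_indVec, cutOp_indVec,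
      projOp_indVec]
    exact indVec_congr μ _ _ _ _ (by rw [Set.inter_comm]; simp) (by simp)
  have h1 := inner_conj_conj (crossedJ Γ μ) (crossedJ Γ μ (cutOp Γ μ hA (indVec μ hE hμE g)))
    (T (cutVec Γ μ hB hμB))
  rw [hJ] at h1
  rw [← star_cutOp, inner_apply_star, h1, hJw, ← inner_apply_star,
    ← apply_comm (hT' _ (translOp_mem μ g)), ← conjBy_projOp,
    ← apply_comm (hT' _ (projOp_mem μ hE)), conjBy_projOp, ← inner_star_apply,
    star_conjBy hJ, star_translOp, ← inner_star_apply, star_cutOp, hE',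
    ← inner_star_apply (projOp Γ μ hB), star_projOp]

/-- The commutant of the right action and the commutant of the left action commute. -/
theorem commute_of_commutants {S T : L2Prod Γ μ →L[ℂ] L2Prod Γ μ}
    (hT : ∀ a ∈ crossedGens Γ μ, Commute (conjBy (crossedJ Γ μ) a) T)
    (hS : ∀ a ∈ crossedGens Γ μ, Commute a S) : Commute S T := by
  have hJ := crossedJ_crossedJ (Γ := Γ) μ
  have hS' : ∀ a ∈ crossedGens Γ μ, Commute a (star S) := fun a ha => by
    have := (hS _ (star_mem_crossedGens μ a ha)).star_star
    rwa [star_star] at this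
  -- For a vector state at `e = 1_A ⊗ δ_e` commutation follows from `cutOp_crossedJ_apply`, which
  -- expresses `J T e` by `T* e`, and `J S* e` by `S e` through the operator `J S J`. This holds up
  -- to the projections for `A`; they can be inserted since `T e` is supported over `A` for the
  -- right action and `S* e` for the left one.
  have hvec : ∀ T : L2Prod Γ μ →L[ℂ] L2Prod Γ μ,
      (∀ a ∈ crossedGens Γ μ, Commute (conjBy (crossedJ Γ μ) a) T) →
      ∀ (A : Set Ω) (hA : MeasurableSet A) (hμA : μ A ≠ ∞),
      ⟪cutVec Γ μ hA hμA, S (T (cutVec Γ μ hA hμA))⟫_ℂ =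
        ⟪cutVec Γ μ hA hμA, T (S (cutVec Γ μ hA hμA))⟫_ℂ := by
    intro T hT A hA hμA
    set e := cutVec Γ μ hA hμA with he
    have hPe : projOp Γ μ hA e = e := by
      rw [he, cutVec_eq, projOp_indVec]
      exact indVec_congr μ _ _ _ _ (by simp) rfl
    have hQe : cutOp Γ μ hA e = e := by
      rw [he, cutVec_eq, cutOp_indVec]
      exact indVec_congr μ _ _ _ _ (by simp) rfl
    have hT' : ∀ a ∈ crossedGens Γ μ, Commute (conjBy (crossedJ Γ μ) a) (star T) := fun a ha => by
      have := (hT _ (star_mem_crossedGens μ a ha)).star_star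
      rwa [star_conjBy hJ, star_star] at this
    have hQT : cutOp Γ μ hA (T e) = T e := by
      rw [← conjBy_projOp, apply_comm (hT _ (projOp_mem μ hA)), conjBy_projOp, hQe]
    have hQT' : cutOp Γ μ hA (star T e) = star T e := by
      rw [← conjBy_projOp, apply_comm (hT' _ (projOp_mem μ hA)), conjBy_projOp, hQe]
    have hPS : projOp Γ μ hA (S e) = S e := by
      rw [apply_comm (hS _ (projOp_mem μ hA)), hPe]
    have hPS' : projOp Γ μ hA (star S e) = star S e := by
      rw [apply_comm (hS' _ (projOp_mem μ hA)), hPe]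
    have hPQ : Commute (cutOp Γ μ hA) (projOp Γ μ hA) := by
      rw [← conjBy_projOp]
      exact crossedJ_commute μ _ (projOp_mem μ hA) _ (projOp_mem μ hA)
    have hswap : ∀ u v, ⟪projOp Γ μ hA u, cutOp Γ μ hA v⟫_ℂ =
        ⟪cutOp Γ μ hA u, projOp Γ μ hA v⟫_ℂ := by
      intro u v
      rw [← inner_apply_star, star_projOp, ← apply_comm hPQ, ← star_cutOp, inner_apply_star,
        star_cutOp]
    have kT := cutOp_crossedJ_apply μ hT hA hμA hA hμA
    have kS := cutOp_crossedJ_apply μ (T := conjBy (crossedJ Γ μ) S) (fun a ha => by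
      have : conjBy (crossedJ Γ μ) (a * S) = conjBy (crossedJ Γ μ) (S * a) := by
        rw [(hS a ha).eq]
      rwa [conjBy_mul hJ, conjBy_mul hJ] at this) hA hμA hA hμA
    rw [star_conjBy hJ, conjBy_apply, conjBy_apply, hJ, crossedJ_cutVec] at kS
    rw [← he] at kT kS
    have h1 := inner_conj_conj (crossedJ Γ μ) (T e) (star S e)
    rw [← inner_star_apply, ← h1]
    conv_lhs => rw [← hQT, ← hPS']
    rw [crossedJ_projOp, crossedJ_cutOp, hswap, kT, ← kS, hswap, hQT', hPS, inner_star_apply]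
  refine ContinuousLinearMap.ext fun v => ?_
  have key : S ∘L T = T ∘L S := by
    refine ext_of_span_closure (span_indVec (Γ := Γ) μ) ?_
    rintro _ ⟨A, hA, hμA, g, rfl⟩
    refine eq_of_inner_indVec μ fun B hB hμB h => ?_
    -- A general coefficient is reduced to a vector state: `1_A ⊗ δ_g = x e` and `1_B ⊗ δ_h = y e`
    -- for the common vector `e = 1_{A ∪ B} ⊗ δ_e` with `x`, `y` in the crossed product. The
    -- operators `x` and `y*` commute with `S`, and `y* T x` again commutes with the right action.
    have hμC : μ (A ∪ B) ≠ ∞ :=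
      ((measure_union_le A B).trans_lt (ENNReal.add_lt_top.2 ⟨hμA.lt_top, hμB.lt_top⟩)).ne
    have hrep : ∀ (E : Set Ω) (hE : MeasurableSet E) (hμE : μ E ≠ ∞) (k : Γ), E ⊆ A ∪ B →
        indVec μ hE hμE k =
          (translOp μ k * projOp Γ μ hE) (cutVec Γ μ (hA.union hB) hμC) := by
      intro E hE hμE k hEC
      rw [mul_apply_eq_comp, cutVec_eq, projOp_indVec, translOp_indVec]
      refine indVec_congr μ _ _ _ _ ?_ (by simp)
      ext ω
      have := @hEC ω
      simp at this ⊢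
      tauto
    rw [hrep A hA hμA g Set.subset_union_left, hrep B hB hμB h Set.subset_union_right]
    set x := translOp μ g * projOp Γ μ hA with hx
    set y := translOp μ h * projOp Γ μ hB with hy
    have hxS : Commute x S := (hS _ (translOp_mem μ g)).mul_left (hS _ (projOp_mem μ hA))
    have hyS : Commute (star y) S := by
      rw [hy, star_mul]
      exact (hS _ (star_mem_crossedGens μ _ (projOp_mem μ hB))).mul_left
        (hS _ (star_mem_crossedGens μ _ (translOp_mem μ h)))
    have hyTx : ∀ a ∈ crossedGens Γ μ, Commute (conjBy (crossedJ Γ μ) a) (star y * T * x) := by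
      intro a ha
      refine ((Commute.mul_right ?_ (hT a ha)).mul_right ?_)
      · rw [hy, star_mul]
        exact (crossedJ_commute μ _ ha _ (star_mem_crossedGens μ _ (projOp_mem μ hB))).mul_right
          (crossedJ_commute μ _ ha _ (star_mem_crossedGens μ _ (translOp_mem μ h)))
      · exact (crossedJ_commute μ _ ha _ (translOp_mem μ g)).mul_right
          (crossedJ_commute μ _ ha _ (projOp_mem μ hA))
    have h2 := hvec _ hyTx (A ∪ B) (hA.union hB) hμC
    set e := cutVec Γ μ (hA.union hB) hμC with he
    change ⟪e, S (star y (T (x e)))⟫_ℂ = ⟪e, star y (T (x (S e)))⟫_ℂ at h2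
    rw [← apply_comm hyS, inner_apply_star, inner_apply_star, apply_comm hxS] at h2
    exact h2
  exact congrArg (fun R => R v) key

end CrossedStandard

/-! ### Verification of the axioms of the standard form. -/

section CrossedStandardForm

variable {Γ : Type*} [Group Γ] [Countable Γ] [MeasurableSpace Γ] [DiscreteMeasurableSpace Γ]
  {Ω : Type*} [MeasurableSpace Ω] [MulAction Γ Ω] [MeasurableConstSMul Γ Ω]
  (μ : Measure Ω) [SigmaFinite μ] [SMulInvariantMeasure Γ Ω μ]

theorem inner_cutOp {A : Set Ω} (hA : MeasurableSet A) (v : L2Prod Γ μ) :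
    ⟪v, cutOp Γ μ hA v⟫_ℂ = ∫ p, A.indicator (fun _ => (1 : ℂ)) p.1 * ⟪v p, v p⟫_ℂ
      ∂(prodMeasure Γ μ) := by
  rw [L2.inner_def]
  refine integral_congr_ae ?_
  filter_upwards [mulOp_ae (prodMeasure Γ μ) _ ((BddMeas.indicator hA).comp measurable_fst) v]
    with p hp
  rw [show (cutOp Γ μ hA v) p = _ from hp]
  simp only [RCLike.inner_apply]
  ring

theorem cutOp_cutOp {A : Set Ω} (hA : MeasurableSet A) (v : L2Prod Γ μ) :
    cutOp Γ μ hA (cutOp Γ μ hA v) = cutOp Γ μ hA v := by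
  apply Lp.ext
  filter_upwards [mulOp_ae (prodMeasure Γ μ) _ ((BddMeas.indicator hA).comp measurable_fst) v,
    mulOp_ae (prodMeasure Γ μ) _ ((BddMeas.indicator hA).comp measurable_fst)
      (cutOp Γ μ hA v)] with p h1 h2
  refine h2.trans ((congrArg _ h1).trans (Eq.trans ?_ h1.symm))
  by_cases h : p.1 ∈ A <;> simp [h]

/-- Since `cutOp` is a projection, `‖cut v - v‖² = ⟪v, v⟫ - ⟪v, cut v⟫`, and the last term converges
by dominated convergence. Such truncations are needed because `1 ⊗ δ_e` is not in `L²` when `μ` is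
infinite. -/
theorem tendsto_cutOp_spanningSets (v : L2Prod Γ μ) :
    Tendsto (fun n => cutOp Γ μ (measurableSet_spanningSets μ n) v) atTop (𝓝 v) := by
  have h1 : Tendsto (fun n => ⟪v, cutOp Γ μ (measurableSet_spanningSets μ n) v⟫_ℂ) atTop
      (𝓝 ⟪v, v⟫_ℂ) := by
    simp_rw [inner_cutOp]
    rw [L2.inner_def]
    refine tendsto_integral_of_dominated_convergence (fun p => ‖⟪v p, v p⟫_ℂ‖) (fun n => ?_)
      (L2.integrable_inner v v).norm (fun n => ae_of_all _ fun p => ?_) (ae_of_all _ fun p => ?_)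
    · exact (((BddMeas.indicator (measurableSet_spanningSets μ n)).comp
        measurable_fst).meas.aestronglyMeasurable).mul (L2.integrable_inner v v).1
    · by_cases h : p.1 ∈ spanningSets μ n <;> simp [h]
    · obtain ⟨n, hn⟩ := Set.mem_iUnion.1
        ((iUnion_spanningSets μ).symm ▸ Set.mem_univ p.1 : p.1 ∈ ⋃ n, spanningSets μ n)
      refine tendsto_const_nhds.congr' ?_
      filter_upwards [eventually_ge_atTop n] with m hm
      rw [Set.indicator_of_mem (monotone_spanningSets μ hm hn), one_mul]
  have h2 : ∀ n, ‖cutOp Γ μ (measurableSet_spanningSets μ n) v - v‖ ^ 2 =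
      RCLike.re ⟪v, v⟫_ℂ - RCLike.re ⟪v, cutOp Γ μ (measurableSet_spanningSets μ n) v⟫_ℂ := by
    intro n
    have h3 : RCLike.re ⟪cutOp Γ μ (measurableSet_spanningSets μ n) v, v⟫_ℂ =
      RCLike.re ⟪v, cutOp Γ μ (measurableSet_spanningSets μ n) v⟫_ℂ := inner_re_symm _ _
    have h4 : ‖cutOp Γ μ (measurableSet_spanningSets μ n) v‖ ^ 2 =
        RCLike.re ⟪v, cutOp Γ μ (measurableSet_spanningSets μ n) v⟫_ℂ := by
      rw [← inner_self_eq_norm_sq (𝕜 := ℂ), ← inner_star_apply, star_cutOp, cutOp_cutOp, h3]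
    rw [norm_sub_sq (𝕜 := ℂ), h3, h4, inner_self_eq_norm_sq (𝕜 := ℂ)]
    ring
  rw [tendsto_iff_norm_sub_tendsto_zero]
  have h5 : Tendsto (fun n => ‖cutOp Γ μ (measurableSet_spanningSets μ n) v - v‖ ^ 2) atTop
      (𝓝 0) := by
    simp_rw [h2]
    have := ((RCLike.continuous_re (K := ℂ)).tendsto _).comp h1
    simpa using this.const_sub (RCLike.re ⟪v, v⟫_ℂ)
  have h6 := h5.sqrt
  simpa [Real.sqrt_sq (norm_nonneg _)] using h6

theorem tendsto_projOp_spanningSets (v : L2Prod Γ μ) :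
    Tendsto (fun n => projOp Γ μ (measurableSet_spanningSets μ n) v) atTop (𝓝 v) := by
  have h := ((crossedJ Γ μ).continuous.tendsto _).comp
    (tendsto_cutOp_spanningSets μ (crossedJ Γ μ v))
  simpa only [Function.comp_def, crossedJ_cutOp, crossedJ_crossedJ] using h

theorem cutOp_ext {v w : L2Prod Γ μ} (h : ∀ (A : Set Ω) (hA : MeasurableSet A), μ A ≠ ∞ →
    cutOp Γ μ hA v = cutOp Γ μ hA w) : v = w :=
  tendsto_nhds_unique (tendsto_cutOp_spanningSets μ v)
    ((tendsto_cutOp_spanningSets μ w).congr fun n =>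
      (h _ _ (measure_spanningSets_lt_top μ n).ne).symm)

theorem commute_cutOp {b : L2Prod Γ μ →L[ℂ] L2Prod Γ μ} (hb : b ∈ crossedVN Γ μ) {A : Set Ω}
    (hA : MeasurableSet A) : Commute (cutOp Γ μ hA) b := by
  rw [← conjBy_projOp]
  exact commute_conj_of_mem μ hb (projOp_mem μ hA)

theorem commute_conjBy_of_mem {a b : L2Prod Γ μ →L[ℂ] L2Prod Γ μ} (ha : a ∈ crossedVN Γ μ)
    (hb : b ∈ crossedVN Γ μ) : Commute a (conjBy (crossedJ Γ μ) b) :=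
  conjBy_commute (star_mem_crossedGens μ) (crossedJ_crossedJ μ) (crossedJ_commute μ) ha hb

theorem GNSVec.mul_left {y : (crossedVN Γ μ).toStarSubalgebra} {v : L2Prod Γ μ}
    (h : GNSVec Γ μ y v) (b : (crossedVN Γ μ).toStarSubalgebra) :
    GNSVec Γ μ (b * y) ((b : L2Prod Γ μ →L[ℂ] L2Prod Γ μ) v) := by
  intro A hA hμA
  rw [apply_comm (commute_cutOp μ b.2 hA), ← h A hA hμA]
  rfl

/-- Over a finite part `Ω_n` the vector `v` is `y (1_{Ω_n} ⊗ δ_e)`; the right action of `b` commutes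
with `y`, and `cutOp_crossedJ_apply` rewrites `J b* (1_{Ω_n} ⊗ δ_e)`, cut to `A`, as `1_{Ω_n} · b
(1_A ⊗ δ_e)`. The claim is the limit over `n`. -/
theorem GNSVec.mul_right {y : (crossedVN Γ μ).toStarSubalgebra} {v : L2Prod Γ μ}
    (h : GNSVec Γ μ y v) (b : (crossedVN Γ μ).toStarSubalgebra) :
    GNSVec Γ μ (y * b)
      (conjBy (crossedJ Γ μ) (star (b : L2Prod Γ μ →L[ℂ] L2Prod Γ μ)) v) := by
  intro A hA hμA
  set R := conjBy (crossedJ Γ μ) (star (b : L2Prod Γ μ →L[ℂ] L2Prod Γ μ)) with hR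
  have hbs : star (b : L2Prod Γ μ →L[ℂ] L2Prod Γ μ) ∈ crossedVN Γ μ := star_mem b.2
  have key : ∀ n, cutOp Γ μ hA (R (cutOp Γ μ (measurableSet_spanningSets μ n) v)) =
      (y : L2Prod Γ μ →L[ℂ] L2Prod Γ μ) (projOp Γ μ (measurableSet_spanningSets μ n)
        ((b : L2Prod Γ μ →L[ℂ] L2Prod Γ μ) (cutVec Γ μ hA hμA))) := by
    intro n
    rw [← h _ _ (measure_spanningSets_lt_top μ n).ne,
      ← apply_comm (commute_conjBy_of_mem μ y.2 hbs), apply_comm (commute_cutOp μ y.2 hA)]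
    congr 1
    rw [conjBy_apply, crossedJ_cutVec, cutOp_crossedJ_apply μ
      (fun a ha => commute_conj_of_mem μ hbs ha) hA hμA, star_star]
  have h1 : Tendsto (fun n => cutOp Γ μ hA (R (cutOp Γ μ (measurableSet_spanningSets μ n) v)))
      atTop (𝓝 (cutOp Γ μ hA (R v))) :=
    ((cutOp Γ μ hA ∘L R).continuous.tendsto v).comp (tendsto_cutOp_spanningSets μ v)
  have h2 := ((y : L2Prod Γ μ →L[ℂ] L2Prod Γ μ).continuous.tendsto _).comp
    (tendsto_projOp_spanningSets μ ((b : L2Prod Γ μ →L[ℂ] L2Prod Γ μ) (cutVec Γ μ hA hμA)))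
  exact (tendsto_nhds_unique (h1.congr key) h2).symm

theorem GNSVec_transl_proj {A : Set Ω} (hA : MeasurableSet A) (hμA : μ A ≠ ∞) (g : Γ) :
    GNSVec Γ μ ⟨translOp μ g * projOp Γ μ hA,
      mul_mem (mem_vnGen (translOp_mem μ g)) (mem_vnGen (projOp_mem μ hA))⟩
      (indVec μ hA hμA g) := by
  intro B hB hμB
  change translOp μ g (projOp Γ μ hA (cutVec Γ μ hB hμB)) = _
  rw [cutVec_eq, projOp_indVec, translOp_indVec, cutOp_indVec]
  exact indVec_congr μ _ _ _ _ (by rw [Set.inter_comm]; simp) (by simp)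

theorem GNSVec.add {y y' : (crossedVN Γ μ).toStarSubalgebra} {v v' : L2Prod Γ μ}
    (h : GNSVec Γ μ y v) (h' : GNSVec Γ μ y' v') : GNSVec Γ μ (y + y') (v + v') := by
  intro A hA hμA
  rw [map_add, ← h A hA hμA, ← h' A hA hμA]
  rfl

theorem GNSVec.smul {y : (crossedVN Γ μ).toStarSubalgebra} {v : L2Prod Γ μ}
    (h : GNSVec Γ μ y v) (c : ℂ) : GNSVec Γ μ (c • y) (c • v) := by
  intro A hA hμA
  rw [map_smul, ← h A hA hμA]
  rfl

theorem crossedJ_apply_apply (a : L2Prod Γ μ →L[ℂ] L2Prod Γ μ) (v : L2Prod Γ μ) :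
    crossedJ Γ μ (a v) = conjBy (crossedJ Γ μ) (star (star a)) (crossedJ Γ μ v) := by
  rw [star_star, conjBy_apply, crossedJ_crossedJ]

theorem isStandardForm_L2Crossed :
    IsStandardForm (L2Crossed Γ μ) (GNSVec Γ μ) (crossedJ Γ μ) where
  zero A hA hμA := (map_zero (cutOp Γ μ hA)).symm
  add h h' := GNSVec.add μ h h'
  smul c _ _ h := GNSVec.smul μ h c
  unique {y v v'} h h' := cutOp_ext μ fun A hA hμA => (h A hA hμA).symm.trans (h' A hA hμA)
  dense := by
    rw [eq_top_iff]
    refine (span_indVec (Γ := Γ) μ).ge.trans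
      (Submodule.topologicalClosure_mono (Submodule.span_mono ?_))
    rintro _ ⟨A, hA, hμA, g, rfl⟩
    exact ⟨_, GNSVec_transl_proj μ hA hμA g⟩
  left b {y v} h := GNSVec.mul_left μ h b
  right b {y v} h := GNSVec.mul_right μ h b
  total := by
    rw [eq_top_iff]
    refine (span_indVec (Γ := Γ) μ).ge.trans
      (Submodule.topologicalClosure_mono (Submodule.span_mono ?_))
    rintro _ ⟨B, hB, hμB, g, rfl⟩
    -- The left action of `f` is multiplication by `f(gω)` on the slice over `g`, so the indicator
    -- of `gB = {ω | g⁻¹ω ∈ B}` fixes `1_B ⊗ δ_g`.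
    refine ⟨_, _, indVec μ hB hμB g, GNSVec_transl_proj μ (measurable_const_smul g⁻¹ hB)
      (measure_preimage_smul_ne_top μ hμB g⁻¹) 1, ?_⟩
    change _ = translOp μ 1 (projOp Γ μ _ (indVec μ hB hμB g))
    rw [projOp_indVec, translOp_indVec]
    exact indVec_congr μ _ _ _ _ (by ext; simp) (by simp)
  commutant T hT := by
    have hT' : ∀ b : (crossedVN Γ μ).toStarSubalgebra,
        Commute (T : L2Prod Γ μ →L[ℂ] L2Prod Γ μ)
          (conjBy (crossedJ Γ μ) (star (b : L2Prod Γ μ →L[ℂ] L2Prod Γ μ))) := hT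
    -- An operator commuting with the right action commutes with the whole commutant of the left
    -- action, hence lies in the bicommutant.
    refine ⟨⟨T, mem_vnGen_of_commute fun S hS => commute_of_commutants μ (fun a ha => ?_) hS⟩, rfl⟩
    have h1 := hT' ⟨star a, star_mem (mem_vnGen ha)⟩
    have h2 : star (star a) = a := star_star a
    exact h2 ▸ h1.symm
  conj_conj := crossedJ_crossedJ μ
  conj_left a v := crossedJ_apply_apply μ a v

end CrossedStandardForm

/-! ### Almost invariant vectors -/

section TotalSet

/-- Semilinear maps are allowed because the lemma is applied to operators involving the conjugate
linear `J`. -/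
theorem tendsto_zero_of_total {E F : Type*} [NormedAddCommGroup E] [InnerProductSpace ℂ E]
    [NormedAddCommGroup F] [InnerProductSpace ℂ F] {σ : ℂ →+* ℂ} {S : Set E}
    (hS : (Submodule.span ℂ S).topologicalClosure = ⊤) {A : ℕ → E →ₛₗ[σ] F} {C : ℝ}
    (hA : ∀ n u, ‖A n u‖ ≤ C * ‖u‖)
    (h : ∀ u ∈ S, Tendsto (fun n => A n u) atTop (𝓝 0)) (u : E) :
    Tendsto (fun n => A n u) atTop (𝓝 0) := by
  have hspan : ∀ u ∈ Submodule.span ℂ S, Tendsto (fun n => A n u) atTop (𝓝 0) := by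
    intro u hu
    induction hu using Submodule.span_induction with
    | mem u hu => exact h u hu
    | zero => simp
    | add u v _ _ hu hv =>
      simp_rw [map_add]
      simpa using hu.add hv
    | smul c u _ hu =>
      simp_rw [map_smulₛₗ]
      simpa using hu.const_smul (σ c)
  rw [Metric.tendsto_atTop]
  intro ε hε
  have hC : 0 < |C| + 1 := by positivity
  have hu : u ∈ closure (Submodule.span ℂ S : Set E) := by
    rw [← Submodule.topologicalClosure_coe, hS]
    trivial
  obtain ⟨v, hv, hd⟩ := Metric.mem_closure_iff.1 hu (ε / (2 * (|C| + 1))) (by positivity)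
  obtain ⟨N, hN⟩ := Metric.tendsto_atTop.1 (hspan v hv) (ε / 2) (by positivity)
  refine ⟨N, fun n hn => ?_⟩
  have h1 := hN n hn
  rw [dist_zero_right] at h1 ⊢
  have h2 : A n u = A n (u - v) + A n v := by rw [map_sub]; abel
  have h3 : ‖A n (u - v)‖ ≤ (|C| + 1) * ‖u - v‖ :=
    (hA n _).trans (mul_le_mul_of_nonneg_right ((le_abs_self C).trans (by linarith))
      (norm_nonneg _))
  rw [dist_eq_norm] at hd
  have h4 : (|C| + 1) * ‖u - v‖ < ε / 2 := by
    have := mul_lt_mul_of_pos_left hd hC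
    calc _ < (|C| + 1) * (ε / (2 * (|C| + 1))) := this
      _ = ε / 2 := by field_simp
  rw [h2]
  linarith [norm_add_le (A n (u - v)) (A n v)]

end TotalSet

section AlmostInvariant

variable {Γ : Type*} [Group Γ] [Countable Γ] [MeasurableSpace Γ] [DiscreteMeasurableSpace Γ]
  {Ω : Type*} [MeasurableSpace Ω] [MulAction Γ Ω] [MeasurableConstSMul Γ Ω]
  (μ : Measure Ω) [SigmaFinite μ] [SMulInvariantMeasure Γ Ω μ]

variable (Γ) in
/-- A sequence of real unit vectors in `L²(Ω)` which is asymptotically invariant. -/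
structure IsAlmostInvariant (f : ℕ → Lp ℂ 2 μ) : Prop where
  norm_eq_one : ∀ n, ‖f n‖ = 1
  real : ∀ n, ∀ᵐ ω ∂μ, conj (f n ω) = f n ω
  tendsto : ∀ g : Γ, Tendsto (fun n => compOp μ (fun ω => g⁻¹ • ω) (measurePreserving_smul g⁻¹ μ)
    (f n) - f n) atTop (𝓝 0)

variable (κ : TorusCocycle Γ μ)

theorem TorusCocycle.one_ae : ∀ᵐ ω ∂μ, κ.toFun 1 ω = 1 := by
  filter_upwards [κ.cocycle' 1 1] with ω h
  rw [inv_one, one_smul, mul_one] at h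
  have h0 : κ.toFun 1 ω ≠ 0 := fun h0 => by
    have := κ.norm_eq_one' 1 ω
    rw [h0, norm_zero] at this
    norm_num at this
  exact (mul_eq_left₀ h0).1 h.symm

theorem TorusCocycle.inv_ae (g : Γ) :
    ∀ᵐ ω ∂μ, κ.toFun g⁻¹ (g⁻¹ • ω) = conj (κ.toFun g ω) := by
  filter_upwards [κ.cocycle' g g⁻¹, κ.one_ae] with ω h h1
  rw [mul_inv_cancel, h1] at h
  calc _ = conj (κ.toFun g ω) * (κ.toFun g ω * κ.toFun g⁻¹ (g⁻¹ • ω)) := by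
        rw [← mul_assoc, κ.conj_mul_self, one_mul]
    _ = _ := by rw [← h, mul_one]

/-- By `inv_ae`, the conjugation in `J` turns the twist over `g` into the twist over `g⁻¹`, so the
cocycle drops out. What remains is `conj (θ_g f)` in place of `f`: the modular conjugations are
intertwined exactly to the extent that `f` is real and invariant. -/
theorem crossedJ_twistTensor_delta (f : Lp ℂ 2 μ) (g : Γ) :
    crossedJ Γ μ (twistTensor μ κ f (delta g)) =
      twistTensor μ κ (conjComp μ (fun ω => g⁻¹ • ω) (measurePreserving_smul g⁻¹ μ) f)
        (delta g⁻¹) := by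
  classical
  apply Lp.ext
  have hT := (mp_flip (Γ := Γ) μ).quasiMeasurePreserving.ae (twistTensor_ae μ κ f (delta g))
  filter_upwards [conjComp_ae _ _ (mp_flip (Γ := Γ) μ) (twistTensor μ κ f (delta g)), hT,
    twistTensor_ae μ κ (conjComp μ (fun ω => g⁻¹ • ω) (measurePreserving_smul g⁻¹ μ) f)
      (delta g⁻¹),
    (ae_prodMeasure_iff μ (P := fun p : Ω × Γ => κ.toFun g⁻¹ (g⁻¹ • p.1) =
      conj (κ.toFun g p.1))).2 fun _ => κ.inv_ae μ g,
    (ae_prodMeasure_iff μ (P := fun p : Ω × Γ =>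
      conjComp μ (fun ω => g⁻¹ • ω) (measurePreserving_smul g⁻¹ μ) f p.1 =
        conj (f (g⁻¹ • p.1)))).2 fun _ => conjComp_ae _ _ _ f] with p h1 h2 h3 h4 h5
  refine h1.trans ?_
  rw [h2, h3, h5, delta_apply, delta_apply]
  by_cases hp : p.2 = g⁻¹
  · simp [hp, h4]
  · have hp' : p.2⁻¹ ≠ g := fun h => hp (by rw [← h, inv_inv])
    simp [hp, hp']

theorem twistTensor_sub (f f' : Lp ℂ 2 μ) (v : ell2 Γ) :
    twistTensor μ κ (f - f') v = twistTensor μ κ f v - twistTensor μ κ f' v := by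
  rw [twistTensor_apply, twistTensor_apply, twistTensor_apply, ← map_sub, ← tensorR_apply,
    ← tensorR_apply, ← tensorR_apply, map_sub]

variable {μ}

theorem IsAlmostInvariant.conjComp_eq {f : ℕ → Lp ℂ 2 μ} (hf : IsAlmostInvariant Γ μ f) (n : ℕ)
    (g : Γ) : conjComp μ (fun ω => g⁻¹ • ω) (measurePreserving_smul g⁻¹ μ) (f n) =
      compOp μ (fun ω => g⁻¹ • ω) (measurePreserving_smul g⁻¹ μ) (f n) := by
  apply Lp.ext
  filter_upwards [conjComp_ae _ _ (measurePreserving_smul g⁻¹ μ) (f n),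
    compOp_ae _ _ (measurePreserving_smul g⁻¹ μ) (f n),
    (measurePreserving_smul g⁻¹ μ).quasiMeasurePreserving.ae (hf.real n)] with ω h1 h2 h3
  rw [h1, h2, h3]

/-- The operators `twistTensor (f n)` asymptotically intertwine the modular conjugations. -/
theorem IsAlmostInvariant.tendsto_conj {f : ℕ → Lp ℂ 2 μ} (hf : IsAlmostInvariant Γ μ f)
    (u : ell2 Γ) : Tendsto (fun n => crossedJ Γ μ (twistTensor μ κ (f n) u) -
      twistTensor μ κ (f n) (groupJ Γ u)) atTop (𝓝 0) := by
  refine tendsto_zero_of_total (σ := starRingEnd ℂ) (C := 2) span_delta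
    (A := fun n => (crossedJ Γ μ).toLinearMap.comp (twistTensor μ κ (f n)).toLinearMap -
      (twistTensor μ κ (f n)).toLinearMap.comp (groupJ Γ).toLinearMap) ?_ ?_ u
  · intro n u
    refine (norm_sub_le _ _).trans ?_
    change ‖crossedJ Γ μ (twistTensor μ κ (f n) u)‖ + ‖twistTensor μ κ (f n) (groupJ Γ u)‖ ≤ _
    rw [LinearIsometry.norm_map, norm_twistTensor, norm_twistTensor, LinearIsometry.norm_map,
      hf.norm_eq_one]
    linarith
  · rintro _ ⟨g, rfl⟩
    have h1 : ∀ n, crossedJ Γ μ (twistTensor μ κ (f n) (delta g)) -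
        twistTensor μ κ (f n) (groupJ Γ (delta g)) = twistTensor μ κ
          (compOp μ (fun ω => g⁻¹ • ω) (measurePreserving_smul g⁻¹ μ) (f n) - f n)
          (delta g⁻¹) := fun n => by
      rw [crossedJ_twistTensor_delta, groupJ_delta, twistTensor_sub, hf.conjComp_eq]
    refine Tendsto.congr (fun n => (h1 n).symm) ?_
    rw [tendsto_zero_iff_norm_tendsto_zero]
    simp_rw [norm_twistTensor, norm_delta, mul_one]
    exact tendsto_zero_iff_norm_tendsto_zero.1 (hf.tendsto g)

/-- The operators `twistTensor (f n)` asymptotically intertwine the right actions. -/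
theorem IsAlmostInvariant.tendsto_right {f : ℕ → Lp ℂ 2 μ} (hf : IsAlmostInvariant Γ μ f)
    (y : ell2 Γ →L[ℂ] ell2 Γ) (u : ell2 Γ) :
    Tendsto (fun n => conjBy (crossedJ Γ μ) (twistAmp μ κ y) (twistTensor μ κ (f n) u) -
      twistTensor μ κ (f n) (conjBy (groupJ Γ) y u)) atTop (𝓝 0) := by
  have h1 := hf.tendsto_conj κ u
  have h2 := hf.tendsto_conj κ (y (groupJ Γ u))
  -- `J` is moved through the isometry twice: once before `π(y)`, the error being carried along by
  -- the fixed operator `J π(y)`, and once after it.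
  have h3 := (((crossedJ Γ μ).continuous.comp (twistAmp μ κ y).continuous).tendsto 0).comp h1
  have h4 := h3.add h2
  simp only [Function.comp_def, map_zero, add_zero] at h4
  refine h4.congr fun n => ?_
  rw [map_sub, map_sub, twistAmp_twistTensor]
  simp only [conjBy_apply]
  abel

/-- Almost invariant vectors give sequences in `L²(Ω × Γ)` which are asymptotically invariant. -/
theorem IsAlmostInvariant.asympInvariant {f : ℕ → Lp ℂ 2 μ} (hf : IsAlmostInvariant Γ μ f) :
    AsympInvariant μ κ fun n => tensor μ (f n) (delta 1) := by
  classical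
  intro h
  have key : ∀ n, eLpNorm (fun p : Ω × Γ => tensor μ (f n) (delta 1) (h⁻¹ • p.1, h⁻¹ * p.2 * h)
      - conj (κ.toFun h p.1) * κ.toFun h (p.2⁻¹ • p.1) * tensor μ (f n) (delta 1) p) 2
        (prodMeasure Γ μ) = ‖tensor μ (compOp μ (fun ω => h⁻¹ • ω)
          (measurePreserving_smul h⁻¹ μ) (f n) - f n) (delta (1 : Γ))‖ₑ := by
    intro n
    rw [Lp.enorm_def]
    refine eLpNorm_congr_ae ?_
    have hm := (mp_prod μ h⁻¹ ((Equiv.mulLeft h⁻¹).trans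
      (Equiv.mulRight h))).quasiMeasurePreserving.ae (tensor_ae μ (f n) (delta (1 : Γ)))
    filter_upwards [hm, tensor_ae μ (f n) (delta (1 : Γ)),
      tensor_ae μ (compOp μ (fun ω => h⁻¹ • ω) (measurePreserving_smul h⁻¹ μ) (f n) - f n)
        (delta (1 : Γ)),
      (ae_prodMeasure_iff μ (P := fun p : Ω × Γ =>
        (compOp μ (fun ω => h⁻¹ • ω) (measurePreserving_smul h⁻¹ μ) (f n) - f n) p.1 =
          f n (h⁻¹ • p.1) - f n p.1)).2 fun _ => by
        filter_upwards [compOp_ae μ _ (measurePreserving_smul h⁻¹ μ) (f n),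
          Lp.coeFn_sub (compOp μ (fun ω => h⁻¹ • ω) (measurePreserving_smul h⁻¹ μ) (f n)) (f n)]
          with ω h1 h2
        rw [h2, Pi.sub_apply, h1]] with p h1 h2 h3 h4
    simp only [Equiv.trans_apply, Equiv.coe_mulLeft, Equiv.coe_mulRight] at h1
    rw [h1, h2, h3, h4, delta_apply, delta_apply]
    -- Over `g = e` the multiplier `ϖ_h` is `conj κ_h · κ_h = 1`, and conjugation by `h` moves no
    -- other element onto `e`.
    by_cases hp : p.2 = 1
    · simp [hp, κ.conj_mul_self]
    · have hp' : h⁻¹ * p.2 * h ≠ 1 := fun h' => hp (by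
        have : p.2 = h * (h⁻¹ * p.2 * h) * h⁻¹ := by group
        rw [this, h']; simp)
      simp [hp, hp']
  simp_rw [key]
  have h0 := hf.tendsto h
  rw [tendsto_zero_iff_norm_tendsto_zero] at h0
  have h1 : ∀ n, ‖tensor μ (compOp μ (fun ω => h⁻¹ • ω)
      (measurePreserving_smul h⁻¹ μ) (f n) - f n) (delta (1 : Γ))‖ₑ = ENNReal.ofReal
        ‖compOp μ (fun ω => h⁻¹ • ω) (measurePreserving_smul h⁻¹ μ) (f n) - f n‖ := fun n => by
    rw [← ofReal_norm, norm_tensor, norm_delta, mul_one]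
  simp_rw [h1]
  simpa using ENNReal.tendsto_ofReal h0

/-- A summand is nonzero only if `g = e` and `hg = e`, so only `h = e` contributes; there `κ_e = 1`
almost everywhere and the integral is `‖f‖²`. -/
theorem traceCoeff_tensor (f : Lp ℂ 2 μ) (hf : ‖f‖ = 1) (h : Γ) :
    traceCoeff μ κ (tensor μ f (delta 1)) h = Set.indicator {1} 1 h := by
  classical
  have hae : ∀ᵐ ω ∂μ, ∀ g : Γ, tensor μ f (delta 1) (ω, g) = f ω * delta 1 g :=
    ae_all_iff.2 fun g => (ae_prodMeasure_iff μ).1 (tensor_ae μ f (delta 1)) g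
  have hae' := (measurePreserving_smul h⁻¹ μ).quasiMeasurePreserving.ae hae
  rw [traceCoeff]
  by_cases hh : h = 1
  · subst hh
    rw [Set.indicator_of_mem (Set.mem_singleton _), Pi.one_apply]
    have h1 : ⟪f, f⟫_ℂ = 1 := by
      rw [inner_self_eq_norm_sq_to_K, hf]; simp
    rw [← h1, L2.inner_def]
    refine integral_congr_ae ?_
    filter_upwards [hae, κ.one_ae] with ω h2 h3
    rw [h3, tsum_eq_single 1, inv_one, one_smul, mul_one, h2, delta_apply]
    · simp [Complex.mul_conj', mul_comm]
    · intro g hg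
      rw [one_mul, h2, delta_apply, if_neg hg]
      simp
  · rw [Set.indicator_of_notMem (by simpa using hh)]
    refine (integral_congr_ae (g := fun _ => 0) ?_).trans (by simp)
    filter_upwards [hae, hae'] with ω h2 h3
    have : ∀ g : Γ, conj (tensor μ f (delta 1) (ω, h * g)) *
        tensor μ f (delta 1) (h⁻¹ • ω, g) = 0 := by
      intro g
      rw [h2, h3, delta_apply, delta_apply]
      by_cases hg : g = 1
      · simp [hg, hh]
      · simp [hg]
    simp [this]

end AlmostInvariant

/-! ### Almost invariant vectors, weak containment and ultrapowers -/

section Ultra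

/-- This map reindexes a sequence by `ι`: convergence along `atTop` becomes convergence along `U`.
-/
theorem exists_tendsto_atTop_of_not_countableInterFilter {ι : Type*} (U : Ultrafilter ι)
    (hU : ¬ CountableInterFilter (U : Filter ι)) :
    ∃ k : ι → ℕ, Tendsto k (U : Filter ι) atTop := by
  have h1 : ∃ S : Set (Set ι), S.Countable ∧ (∀ s ∈ S, s ∈ U) ∧ ⋂₀ S ∉ U := by
    by_contra! h
    exact hU ⟨fun S hS hSU => h S hS hSU⟩
  obtain ⟨S, hS, hSU, hn⟩ := h1
  have hne : S.Nonempty := by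
    by_contra! h
    rw [h, Set.sInter_empty] at hn
    exact hn univ_mem
  obtain ⟨A, rfl⟩ := hS.exists_eq_range hne
  -- The first `n` with `i ∉ A n`. For `i` in all the `A n` the infimum takes the default value `0`,
  -- but these `i` form a set whose complement is in `U`.
  refine ⟨fun i => sInf {n | i ∉ A n}, tendsto_atTop.2 fun n => ?_⟩
  have h2 : ∀ᶠ i in (U : Filter ι), ∀ m ∈ Finset.range n, i ∈ A m :=
    (Filter.eventually_all_finset _).2 fun m _ => hSU _ ⟨m, rfl⟩
  have h3 : ∀ᶠ i in (U : Filter ι), i ∈ (⋂₀ Set.range A)ᶜ := Ultrafilter.compl_mem_iff_notMem.2 hn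
  filter_upwards [h2, h3] with i h4 h5
  have h6 : {n | i ∉ A n}.Nonempty := by
    simpa [Set.Nonempty] using h5
  refine le_csInf h6 fun m hm => ?_
  by_contra! h
  exact hm (h4 m (Finset.mem_range.2 h))

variable {ι : Type*} (U : Ultrafilter ι) {H K : Type*} [NormedAddCommGroup H]
  [InnerProductSpace ℂ H] [NormedAddCommGroup K] [InnerProductSpace ℂ K]

/-- The bounded family `(W i v)_i`. -/
def isometryFamily (W : ι → H →ₗᵢ[ℂ] K) : H →ₗ[ℂ] lp (fun _ : ι => K) ∞ where
  toFun v := ⟨fun i => W i v, memℓp_infty_iff.2 ⟨‖v‖, by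
    rintro _ ⟨i, rfl⟩
    exact ((W i).norm_map v).le⟩⟩
  map_add' x y := by
    ext i
    exact map_add (W i) _ _
  map_smul' c x := by
    ext i
    exact map_smul (W i) _ _

theorem ultrapower_mk_eq {x y : lp (fun _ : ι => K) ∞}
    (h : Tendsto (fun i => x i - y i) (U : Filter ι) (𝓝 0)) :
    (nullFamilies U K).mkQ x = (nullFamilies U K).mkQ y :=
  (Submodule.Quotient.eq (nullFamilies U K)).2 h

/-- The isometry of `H` into the ultrapower of `K` defined by a family of isometries. -/
def ultraIsometry (W : ι → H →ₗᵢ[ℂ] K) : H →ₗᵢ[ℂ] Ultrapower U K where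
  toLinearMap := (nullFamilies U K).mkQ ∘ₗ isometryFamily W
  norm_map' v := by
    apply le_antisymm
    · exact (Submodule.Quotient.norm_mk_le _ _).trans
        (lp.norm_le_of_forall_le (norm_nonneg _) fun i => ((W i).norm_map v).le)
    -- Any other representative `m` differs from `W i v` by a family tending to `0` along `U`, and
    -- each `W i v` has norm `‖v‖`, so the quotient norm cannot be smaller.
    · refine QuotientAddGroup.le_norm_iff.2 fun m hm => ?_
      have h0 : Tendsto (fun i => m i - W i v) (U : Filter ι) (𝓝 0) :=
        (Submodule.Quotient.eq (nullFamilies U K)).1 hm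
      have h1 : Tendsto (fun i => ‖m‖ + ‖m i - W i v‖) (U : Filter ι) (𝓝 (‖m‖ + 0)) :=
        tendsto_const_nhds.add (tendsto_zero_iff_norm_tendsto_zero.1 h0)
      rw [add_zero] at h1
      refine ge_of_tendsto h1 (Eventually.of_forall fun i => ?_)
      have h2 : ‖m i‖ ≤ ‖m‖ := lp.norm_apply_le_norm (by simp) m i
      have h3 : W i v = m i - (m i - W i v) := by abel
      calc ‖v‖ = ‖W i v‖ := ((W i).norm_map v).symm
        _ = ‖m i - (m i - W i v)‖ := by rw [← h3]
        _ ≤ ‖m i‖ + ‖m i - W i v‖ := norm_sub_le _ _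
        _ ≤ _ := by gcongr

end Ultra

/-! ### Consequences of almost invariant vectors for the twisted bimodule. -/

section Amenable

variable {Γ : Type*} [Group Γ] [Countable Γ] [MeasurableSpace Γ] [DiscreteMeasurableSpace Γ]
  {Ω : Type*} [MeasurableSpace Ω] [MulAction Γ Ω] [MeasurableConstSMul Γ Ω]
  (μ : Measure Ω) [SigmaFinite μ] [SMulInvariantMeasure Γ Ω μ] (κ : TorusCocycle Γ μ)

theorem isNormal_twistedHom_left :
    IsNormal (groupVN Γ) (fun x => (L2Crossed Γ μ).left (twistedHom μ κ x)) :=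
  (isTwistedHom_twistedHom μ κ).1

theorem isNormal_twistedHom_right : IsNormal (groupVN Γ) (fun y =>
    ((L2Crossed Γ μ).comapLeft (twistedHom μ κ) (isNormal_twistedHom_left μ κ)).right
      (MulOpposite.op (twistedHom μ κ y))) := by
  intro (ξ : L2Prod Γ μ)
  obtain ⟨ζ, h1, h2⟩ := (isTwistedHom_twistedHom μ κ).1 (crossedJ Γ μ ξ)
  refine ⟨ζ, h1, fun x => ?_⟩
  have h3 : ⟪ξ, conjBy (crossedJ Γ μ) (star (twistAmp μ κ x)) ξ⟫_ℂ =
      ⟪crossedJ Γ μ ξ, twistAmp μ κ x (crossedJ Γ μ ξ)⟫_ℂ := by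
    rw [conjBy_apply, ← inner_conj_conj (crossedJ Γ μ), crossedJ_crossedJ,
      ContinuousLinearMap.star_eq_adjoint, ContinuousLinearMap.adjoint_inner_left]
  have h4 : HasSum (fun n => ⟪ζ n, (x : ell2 Γ →L[ℂ] ell2 Γ) (ζ n)⟫_ℂ)
      ⟪crossedJ Γ μ ξ, twistAmp μ κ x (crossedJ Γ μ ξ)⟫_ℂ :=
    h2 x
  rw [← h3] at h4
  exact h4

/-- The `ℒΓ`-bimodule `L²(Ω ⋊ Γ)`, with the actions given by the twisted homomorphism. -/
def twistedCorr : Correspondence (groupVN Γ) (groupVN Γ) :=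
  ((L2Crossed Γ μ).comapLeft (twistedHom μ κ) (isNormal_twistedHom_left μ κ)).comapRight
    (twistedHom μ κ) (isNormal_twistedHom_right μ κ)

theorem twistedCorr_act (x y : (groupVN Γ).toStarSubalgebra) (ξ : L2Prod Γ μ) :
    (twistedCorr μ κ).act x ξ y =
      twistAmp μ κ x (conjBy (crossedJ Γ μ) (twistAmp μ κ (star (y : ell2 Γ →L[ℂ] ell2 Γ))) ξ) := by
  rw [map_star]
  rfl

theorem L2Group_act (x y : (groupVN Γ).toStarSubalgebra) (ζ : ell2 Γ) :
    (L2Group Γ).act x ζ y = (x : ell2 Γ →L[ℂ] ell2 Γ)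
      (conjBy (groupJ Γ) (star (y : ell2 Γ →L[ℂ] ell2 Γ)) ζ) := rfl

theorem isAmenableHom_iff :
    IsAmenableHom μ (twistedHom μ κ) ↔ WeaklyContained (L2Group Γ) (twistedCorr μ κ) :=
  ⟨fun h => (isStandardForm_L2Crossed μ).weaklyContained_of_isAmenableMap _ _ _ h,
    fun h => (isStandardForm_L2Crossed μ).isAmenableMap_of_weaklyContained _ _ _ h⟩

theorem norm_inner_sub_inner_twistTensor_le {f : Lp ℂ 2 μ} (hf : ‖f‖ = 1) (ζ w : ell2 Γ)
    (u : L2Prod Γ μ) :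
    ‖⟪ζ, w⟫_ℂ - ⟪twistTensor μ κ f ζ, u⟫_ℂ‖ ≤ ‖ζ‖ * ‖u - twistTensor μ κ f w‖ := by
  have h2 : ⟪ζ, w⟫_ℂ = ⟪twistTensor μ κ f ζ, twistTensor μ κ f w⟫_ℂ := by
    rw [inner_twistTensor, inner_self_eq_norm_sq_to_K, hf]
    simp
  rw [h2, ← inner_sub_right, norm_sub_rev u]
  refine (norm_inner_le_norm _ _).trans ?_
  rw [norm_twistTensor, hf, one_mul]

variable {μ}

theorem IsAlmostInvariant.tendsto_act {f : ℕ → Lp ℂ 2 μ} (hf : IsAlmostInvariant Γ μ f)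
    (x y : (groupVN Γ).toStarSubalgebra) (ζ : ell2 Γ) :
    Tendsto (fun n => twistAmp μ κ x (conjBy (crossedJ Γ μ)
        (twistAmp μ κ (star (y : ell2 Γ →L[ℂ] ell2 Γ))) (twistTensor μ κ (f n) ζ)) -
      twistTensor μ κ (f n) ((L2Group Γ).act x ζ y)) atTop (𝓝 0) := by
  have h1 := hf.tendsto_right κ (star (y : ell2 Γ →L[ℂ] ell2 Γ)) ζ
  have h2 := ((twistAmp μ κ x).continuous.tendsto 0).comp h1
  rw [map_zero] at h2
  refine h2.congr fun n => ?_
  simp only [Function.comp_apply]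
  rw [map_sub, twistAmp_twistTensor, L2Group_act]

/-- A single vector `twistTensor (f n) ζ` with `n` large approximates the coefficients of `ζ`,
because `twistTensor (f n)` is an isometry and asymptotically bimodular. -/
theorem IsAlmostInvariant.weaklyContained {f : ℕ → Lp ℂ 2 μ} (hf : IsAlmostInvariant Γ μ f) :
    WeaklyContained (L2Group Γ) (twistedCorr μ κ) := by
  intro ε hε E F (ζ : ell2 Γ) hζ
  have hζ' : ‖ζ‖ = 1 := hζ
  have key : ∀ x y : (groupVN Γ).toStarSubalgebra, ∀ᶠ n in atTop,
      ‖⟪ζ, ((L2Group Γ).act x ζ y : ell2 Γ)⟫_ℂ - ⟪twistTensor μ κ (f n) ζ,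
        twistAmp μ κ x (conjBy (crossedJ Γ μ) (twistAmp μ κ (star (y : ell2 Γ →L[ℂ] ell2 Γ)))
          (twistTensor μ κ (f n) ζ))⟫_ℂ‖ < ε := by
    intro x y
    have h1 := (tendsto_zero_iff_norm_tendsto_zero.1 (hf.tendsto_act κ x y ζ)).eventually_lt_const hε
    filter_upwards [h1] with n hn
    refine lt_of_le_of_lt ?_ hn
    have h2 := norm_inner_sub_inner_twistTensor_le μ κ (hf.norm_eq_one n) ζ
      ((L2Group Γ).act x ζ y) (twistAmp μ κ x (conjBy (crossedJ Γ μ)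
        (twistAmp μ κ (star (y : ell2 Γ →L[ℂ] ell2 Γ))) (twistTensor μ κ (f n) ζ)))
    rw [hζ', one_mul] at h2
    exact h2
  have h3 : ∀ᶠ n in atTop, ∀ x ∈ E, ∀ y ∈ F, _ :=
    (Filter.eventually_all_finset _).2 fun x _ => (Filter.eventually_all_finset _).2 fun y _ =>
      key x y
  obtain ⟨n, hn⟩ := h3.exists
  refine ⟨1, fun _ => twistTensor μ κ (f n) ζ, fun x hx y hy => ?_⟩
  rw [Fin.sum_univ_one, twistedCorr_act]
  exact hn x hx y hy

theorem IsAlmostInvariant.isAmenableHom {f : ℕ → Lp ℂ 2 μ} (hf : IsAlmostInvariant Γ μ f) :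
    IsAmenableHom μ (twistedHom μ κ) :=
  (isAmenableHom_iff μ κ).2 (hf.weaklyContained κ)

theorem crossedMultiplier_twistTensor {m : Γ → ℂ} (hm : m ∈ fourierStieltjes Γ) (f : Lp ℂ 2 μ)
    (v : ell2 Γ) : crossedMultiplier μ hm (twistTensor μ κ f v) =
      twistTensor μ κ f (groupMultiplier hm v) := by
  apply Lp.ext
  filter_upwards [mulOp_ae (prodMeasure Γ μ) (fun p : Ω × Γ => m p.2)
      ((bddMeas_fourierStieltjes hm).comp (T := Prod.snd) measurable_snd) (twistTensor μ κ f v),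
    twistTensor_ae μ κ f v, twistTensor_ae μ κ f (groupMultiplier hm v)] with p h1 h2 h3
  refine h1.trans ?_
  have h4 : groupMultiplier hm v p.2 = m p.2 * v p.2 :=
    Measure.ae_count_iff.1 (mulOp_ae _ _ _ v) p.2
  rw [h2, h3, h4]
  ring

/-- Almost invariant vectors give a bimodular isometry into the ultrapower. -/
theorem IsAlmostInvariant.exists_isometry {f : ℕ → Lp ℂ 2 μ} (hf : IsAlmostInvariant Γ μ f)
    {ι : Type*} (U : Ultrafilter ι) (hU : ¬ CountableInterFilter (U : Filter ι)) :
    ∃ J : ell2 Γ →ₗᵢ[ℂ] Ultrapower U (L2Prod Γ μ),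
      IsBimodular μ (twistedHom μ κ) U J ∧ IntertwinesMultipliers μ U J := by
  obtain ⟨k, hk⟩ := exists_tendsto_atTop_of_not_countableInterFilter U hU
  let W : ι → ell2 Γ →ₗᵢ[ℂ] L2Prod Γ μ := fun i =>
    { toLinearMap := (twistTensor μ κ (f (k i))).toLinearMap
      norm_map' := fun v => by
        change ‖twistTensor μ κ (f (k i)) v‖ = ‖v‖
        rw [norm_twistTensor, hf.norm_eq_one, one_mul] }
  refine ⟨ultraIsometry U W, fun x y ζ => ?_, fun m hm ζ => ?_⟩
  · refine (ultrapower_mk_eq U (K := L2Prod Γ μ) (x := lpMap ι (twistAmp μ κ x) (lpMap ι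
      (conjBy (crossedJ Γ μ) (twistAmp μ κ (star (y : ell2 Γ →L[ℂ] ell2 Γ))))
        (isometryFamily W ζ))) (y := isometryFamily W ((L2Group Γ).act x ζ y)) ?_).symm.trans ?_
    · exact (hf.tendsto_act κ x y ζ).comp hk
    · rw [map_star]
      rfl
  · refine congrArg (nullFamilies U (L2Prod Γ μ)).mkQ ?_
    ext i : 2
    exact (crossedMultiplier_twistTensor κ hm (f (k i)) ζ).symm

end Amenable

/-! ### Invariant means from asymptotically invariant vectors -/

section Mean

variable {Γ : Type*} [Group Γ] [Countable Γ] [MeasurableSpace Γ] [DiscreteMeasurableSpace Γ]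
  {Ω : Type*} [MeasurableSpace Ω] [MulAction Γ Ω] [MeasurableConstSMul Γ Ω]
  (μ : Measure Ω) [SigmaFinite μ] [SMulInvariantMeasure Γ Ω μ]

theorem ae_norm_le_norm_top {X : Type*} [MeasurableSpace X] {ν : Measure X} (F : Lp ℂ ∞ ν) :
    ∀ᵐ x ∂ν, ‖F x‖ ≤ ‖F‖ := by
  filter_upwards [ae_le_eLpNormEssSup (f := F) (μ := ν)] with x hx
  rw [Lp.norm_def, eLpNorm_exponent_top, ← toReal_enorm]
  exact ENNReal.toReal_mono (by simpa using Lp.eLpNorm_ne_top F) hx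

theorem memLp_fst (F : Lp ℂ ∞ μ) : MemLp (fun p : Ω × Γ => F p.1) ∞ (prodMeasure Γ μ) := by
  refine memLp_top_of_bound (Lp.aestronglyMeasurable F).comp_fst ‖F‖ ?_
  exact (ae_prodMeasure_iff μ (P := fun p : Ω × Γ => ‖F p.1‖ ≤ ‖F‖)).2 fun _ =>
    ae_norm_le_norm_top F

variable (Γ) in
/-- Multiplication by `F ⊗ 1`, for `F ∈ L^∞(Ω)`. -/
def fstOp (F : Lp ℂ ∞ μ) : L2Prod Γ μ →L[ℂ] L2Prod Γ μ :=
  (ContinuousLinearMap.mul ℂ ℂ).holderL (prodMeasure Γ μ) ∞ 2 2 ((memLp_fst μ F).toLp _)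

theorem fstOp_ae (F : Lp ℂ ∞ μ) (v : L2Prod Γ μ) :
    fstOp Γ μ F v =ᵐ[prodMeasure Γ μ] fun p => F p.1 * v p := by
  have h := (ContinuousLinearMap.mul ℂ ℂ).coeFn_holder (r := 2)
    ((memLp_fst (Γ := Γ) μ F).toLp _) v
  filter_upwards [h, (memLp_fst (Γ := Γ) μ F).coeFn_toLp] with x hx hx'
  refine hx.trans ?_
  rw [hx']
  rfl

theorem norm_fstOp_apply_le (F : Lp ℂ ∞ μ) (v : L2Prod Γ μ) :
    ‖fstOp Γ μ F v‖ ≤ ‖F‖ * ‖v‖ := by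
  refine Lp.norm_le_mul_norm_of_ae_le_mul ?_
  filter_upwards [fstOp_ae μ F v, (ae_prodMeasure_iff μ
    (P := fun p : Ω × Γ => ‖F p.1‖ ≤ ‖F‖)).2 fun _ => ae_norm_le_norm_top F] with p h1 h2
  rw [h1, norm_mul]
  gcongr

theorem fstOp_add (F G : Lp ℂ ∞ μ) : fstOp Γ μ (F + G) = fstOp Γ μ F + fstOp Γ μ G := by
  rw [fstOp, fstOp, fstOp, ← map_add, ← MemLp.toLp_add]
  congr 1
  refine MemLp.toLp_congr _ _ ?_
  exact (ae_prodMeasure_iff μ (P := fun p : Ω × Γ => (F + G) p.1 = F p.1 + G p.1)).2 fun _ =>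
    Lp.coeFn_add F G

theorem fstOp_smul (c : ℂ) (F : Lp ℂ ∞ μ) : fstOp Γ μ (c • F) = c • fstOp Γ μ F := by
  rw [fstOp, fstOp, ← map_smul, ← MemLp.toLp_const_smul]
  congr 1
  refine MemLp.toLp_congr _ _ ?_
  exact (ae_prodMeasure_iff μ (P := fun p : Ω × Γ => (c • F) p.1 = c • F p.1)).2 fun _ =>
    Lp.coeFn_smul c F

theorem fstOp_one_apply (v : L2Prod Γ μ) :
    fstOp Γ μ ((memLp_top_const (1 : ℂ)).toLp (fun _ => (1 : ℂ))) v = v := by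
  apply Lp.ext
  filter_upwards [fstOp_ae μ ((memLp_top_const (1 : ℂ)).toLp (fun _ => (1 : ℂ))) v,
    (ae_prodMeasure_iff μ (P := fun p : Ω × Γ =>
      ((memLp_top_const (1 : ℂ)).toLp (fun _ => (1 : ℂ)) : Lp ℂ ∞ μ) p.1 = 1)).2 fun _ =>
      (memLp_top_const (1 : ℂ)).coeFn_toLp] with p h1 h2
  rw [h1, h2, one_mul]

theorem inner_fstOp_nonneg {F : Lp ℂ ∞ μ} (hF : 0 ≤ᵐ[μ] F) (v : L2Prod Γ μ) :
    0 ≤ ⟪v, fstOp Γ μ F v⟫_ℂ := by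
  rw [L2.inner_def]
  refine integral_nonneg_of_ae ?_
  filter_upwards [fstOp_ae μ F v, (ae_prodMeasure_iff μ
    (P := fun p : Ω × Γ => 0 ≤ F p.1)).2 fun _ => hF] with p h1 h2
  rw [h1, RCLike.inner_apply, mul_assoc, Complex.mul_conj']
  exact mul_nonneg h2 (by exact_mod_cast sq_nonneg ‖v p‖)

/-- The operator `(θ_h ⊗ Ad_h)(v)(ω, g) = v(h⁻¹ω, h⁻¹gh)`. -/
def adOp (h : Γ) : L2Prod Γ μ →L[ℂ] L2Prod Γ μ :=
  compOp _ (fun p => (h⁻¹ • p.1, h⁻¹ * p.2 * h))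
    (mp_prod μ h⁻¹ ((Equiv.mulLeft h⁻¹).trans (Equiv.mulRight h)))

theorem adOp_ae (h : Γ) (v : L2Prod Γ μ) : adOp μ h v =ᵐ[prodMeasure Γ μ]
    fun p => v (h⁻¹ • p.1, h⁻¹ * p.2 * h) :=
  compOp_ae _ _ (mp_prod μ h⁻¹ ((Equiv.mulLeft h⁻¹).trans (Equiv.mulRight h))) v

theorem inner_adOp (h : Γ) (u v : L2Prod Γ μ) : ⟪adOp μ h u, adOp μ h v⟫_ℂ = ⟪u, v⟫_ℂ :=
  LinearIsometry.inner_map_map (𝕜 := ℂ) (E := L2Prod Γ μ) (E' := L2Prod Γ μ)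
    (Lp.compMeasurePreservingₗᵢ ℂ _
      (mp_prod μ h⁻¹ ((Equiv.mulLeft h⁻¹).trans (Equiv.mulRight h)))) _ _

theorem fstOp_adOp (h : Γ) (F : Lp ℂ ∞ μ) (v : L2Prod Γ μ) :
    fstOp Γ μ (Lp.compMeasurePreserving (fun ω => h⁻¹ • ω) (measurePreserving_smul h⁻¹ μ) F)
      (adOp μ h v) = adOp μ h (fstOp Γ μ F v) := by
  apply Lp.ext
  filter_upwards [fstOp_ae μ (Lp.compMeasurePreserving (fun ω => h⁻¹ • ω)
      (measurePreserving_smul h⁻¹ μ) F) (adOp μ h v), adOp_ae μ h v,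
    adOp_ae μ h (fstOp Γ μ F v),
    (mp_prod μ h⁻¹ ((Equiv.mulLeft h⁻¹).trans (Equiv.mulRight h))).quasiMeasurePreserving.ae
      (fstOp_ae μ F v),
    (ae_prodMeasure_iff μ (P := fun p : Ω × Γ => Lp.compMeasurePreserving (fun ω => h⁻¹ • ω)
      (measurePreserving_smul h⁻¹ μ) F p.1 = F (h⁻¹ • p.1))).2 fun _ =>
      Lp.coeFn_compMeasurePreserving F (measurePreserving_smul h⁻¹ μ)] with p h1 h2 h3 h4 h5
  rw [h1, h2, h3, h5]
  exact h4.symm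

/-- The coefficient is the integral of `F |v|²`, which only depends on the modulus of `v`. This is
why the cocycle plays no role for invariant means. -/
theorem inner_mulOp_fstOp {w : Ω × Γ → ℂ} (hw : BddMeas w) (hw1 : ∀ p, ‖w p‖ = 1)
    (F : Lp ℂ ∞ μ) (v : L2Prod Γ μ) :
    ⟪mulOp (prodMeasure Γ μ) w hw v, fstOp Γ μ F (mulOp (prodMeasure Γ μ) w hw v)⟫_ℂ =
      ⟪v, fstOp Γ μ F v⟫_ℂ := by
  rw [L2.inner_def, L2.inner_def]
  refine integral_congr_ae ?_
  filter_upwards [mulOp_ae _ w hw v, fstOp_ae μ F v,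
    fstOp_ae μ F (mulOp (prodMeasure Γ μ) w hw v)] with p h1 h2 h3
  rw [h3, h2, h1]
  simp only [RCLike.inner_apply, map_mul]
  have : w p * conj (w p) = 1 := by rw [Complex.mul_conj', hw1]; simp
  linear_combination (F p.1 * v p * conj (v p)) * this

theorem norm_inner_apply_sub_le {H : Type*} [NormedAddCommGroup H] [InnerProductSpace ℂ H]
    {T : H →L[ℂ] H} {C : ℝ} (hT : ∀ v, ‖T v‖ ≤ C * ‖v‖) (a b : H) :
    ‖⟪a, T a⟫_ℂ - ⟪b, T b⟫_ℂ‖ ≤ C * (‖a‖ + ‖b‖) * ‖a - b‖ := by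
  have h : ⟪a, T a⟫_ℂ - ⟪b, T b⟫_ℂ = ⟪a - b, T a⟫_ℂ + ⟪b, T (a - b)⟫_ℂ := by
    rw [map_sub, inner_sub_left, inner_sub_right]
    ring
  rw [h]
  refine (norm_add_le _ _).trans ?_
  have h1 := (norm_inner_le_norm (𝕜 := ℂ) (a - b) (T a)).trans
    (mul_le_mul_of_nonneg_left (hT a) (norm_nonneg _))
  have h2 := (norm_inner_le_norm (𝕜 := ℂ) b (T (a - b))).trans
    (mul_le_mul_of_nonneg_left (hT (a - b)) (norm_nonneg _))
  linarith

theorem norm_mulOp_of_norm_eq_one {X : Type*} [MeasurableSpace X] (ν : Measure X) {w : X → ℂ}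
    (hw : BddMeas w) (hw1 : ∀ p, ‖w p‖ = 1) (v : Lp ℂ 2 ν) : ‖mulOp ν w hw v‖ = ‖v‖ := by
  rw [Lp.norm_def, Lp.norm_def]
  congr 1
  refine eLpNorm_congr_norm_ae ?_
  filter_upwards [mulOp_ae ν w hw v] with x h
  rw [h, norm_mul, hw1, one_mul]

/-- The mean is the limit of `⟪v_n, (F ⊗ 1) v_n⟫` along an ultrafilter. The weights `w` are kept
arbitrary so that the lemma serves both descriptions of `L²(Ω ⋊ Γ)`, whose unimodular factors are
evaluated at `g⁻¹ω` and at `gω` respectively. -/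
theorem hasInvariantMean_of_tendsto {v : ℕ → L2Prod Γ μ} (hv : ∀ n, ‖v n‖ = 1)
    {w : Γ → Ω × Γ → ℂ} (hw : ∀ h, BddMeas (w h)) (hw1 : ∀ h p, ‖w h p‖ = 1)
    (ht : ∀ h, Tendsto (fun n => adOp μ h (v n) - mulOp (prodMeasure Γ μ) (w h) (hw h) (v n))
      atTop (𝓝 0)) :
    HasInvariantMean Γ μ := by
  have hex : ∀ F : Lp ℂ ∞ μ, ∃ z : ℂ, Tendsto (fun n => ⟪v n, fstOp Γ μ F (v n)⟫_ℂ)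
      (hyperfilter ℕ : Filter ℕ) (𝓝 z) := by
    intro F
    have hb : ∀ n, ⟪v n, fstOp Γ μ F (v n)⟫_ℂ ∈ Metric.closedBall (0 : ℂ) ‖F‖ := fun n => by
      rw [mem_closedBall_zero_iff]
      refine (norm_inner_le_norm _ _).trans ?_
      rw [hv, one_mul]
      refine (norm_fstOp_apply_le μ F (v n)).trans ?_
      rw [hv, mul_one]
    obtain ⟨z, -, hz⟩ := (isCompact_closedBall (0 : ℂ) ‖F‖).ultrafilter_le_nhds
      ((hyperfilter ℕ).map fun n => ⟪v n, fstOp Γ μ F (v n)⟫_ℂ)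
      (le_principal_iff.2 (Ultrafilter.mem_map.2 (univ_mem' hb)))
    exact ⟨z, hz⟩
  choose φ hφ using hex
  refine ⟨⟨⟨φ, fun F G => ?_⟩, fun c F => ?_⟩, fun F hF => ?_, ?_, fun g F => ?_⟩
  · refine tendsto_nhds_unique (hφ _) (((hφ F).add (hφ G)).congr fun n => ?_)
    rw [fstOp_add, _root_.add_apply, inner_add_right]
  · refine tendsto_nhds_unique (hφ _) (((hφ F).const_mul c).congr fun n => ?_)
    rw [fstOp_smul, _root_.smul_apply, inner_smul_right]
  · exact ge_of_tendsto' (hφ F) fun n => inner_fstOp_nonneg μ hF _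
  · refine tendsto_nhds_unique (hφ _) ?_
    refine tendsto_const_nhds.congr fun n => ?_
    rw [fstOp_one_apply, inner_self_eq_norm_sq_to_K, hv]
    simp
  · refine tendsto_nhds_unique (hφ _) ?_
    set G := Lp.compMeasurePreserving (fun ω => g⁻¹ • ω) (measurePreserving_smul g⁻¹ μ) F
    -- Since `Ad` carries `F ⊗ 1` to `G ⊗ 1`, the first coefficient is that of `G` at `adOp v`; the
    -- second is that of `G` at `w v`. The two vectors are asymptotically equal.
    have h1 : ∀ n, ‖⟪v n, fstOp Γ μ F (v n)⟫_ℂ - ⟪v n, fstOp Γ μ G (v n)⟫_ℂ‖ ≤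
        ‖G‖ * (1 + 1) * ‖adOp μ g (v n) - mulOp (prodMeasure Γ μ) (w g) (hw g) (v n)‖ := by
      intro n
      have h2 := norm_inner_apply_sub_le (norm_fstOp_apply_le (Γ := Γ) μ G) (adOp μ g (v n))
        (mulOp (prodMeasure Γ μ) (w g) (hw g) (v n))
      rw [inner_mulOp_fstOp μ (hw g) (hw1 g), fstOp_adOp, inner_adOp,
        norm_mulOp_of_norm_eq_one _ _ (hw1 g), hv] at h2
      have h3 : ‖adOp μ g (v n)‖ = 1 := by
        rw [norm_eq_sqrt_re_inner (𝕜 := ℂ), inner_adOp, ← norm_eq_sqrt_re_inner, hv]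
      rwa [h3] at h2
    have h4 : Tendsto (fun n => ⟪v n, fstOp Γ μ F (v n)⟫_ℂ - ⟪v n, fstOp Γ μ G (v n)⟫_ℂ)
        atTop (𝓝 0) := by
      refine squeeze_zero_norm h1 ?_
      simpa using (tendsto_zero_iff_norm_tendsto_zero.1 (ht g)).const_mul (‖G‖ * (1 + 1))
    have h5 := (hφ F).sub (h4.mono_left Nat.hyperfilter_le_atTop)
    simpa using h5

theorem AsympInvariant.hasInvariantMean {κ : TorusCocycle Γ μ} {ξ : ℕ → L2Prod Γ μ}
    (hξ : ∀ n, ‖ξ n‖ = 1) (h : AsympInvariant μ κ ξ) : HasInvariantMean Γ μ := by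
  have hw : ∀ h, BddMeas fun p : Ω × Γ => conj (κ.toFun h p.1) * κ.toFun h (p.2⁻¹ • p.1) :=
    fun h => ⟨((κ.bddMeas μ h).conj.meas.comp measurable_fst).mul
      (measurable_from_prod_countable_left fun g =>
        (κ.measurable' h).comp (measurable_const_smul g⁻¹)), 1, fun p => by
        simp [κ.norm_eq_one']⟩
  refine hasInvariantMean_of_tendsto μ hξ hw (fun h p => by simp [κ.norm_eq_one']) fun k => ?_
  rw [tendsto_zero_iff_norm_tendsto_zero]
  have h1 := (ENNReal.tendsto_toReal (by simp)).comp (h k)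
  refine h1.congr fun n => ?_
  rw [Function.comp_apply, Lp.norm_def]
  congr 1
  refine eLpNorm_congr_ae ?_
  filter_upwards [adOp_ae μ k (ξ n), mulOp_ae (prodMeasure Γ μ) _ (hw k) (ξ n),
    Lp.coeFn_sub (adOp μ k (ξ n)) (mulOp (prodMeasure Γ μ) _ (hw k) (ξ n))] with p h2 h3 h4
  rw [h4, Pi.sub_apply, h2, h3]

/-- Extraction of almost fixed unit vectors from almost fixed finite families. -/
theorem exists_unit_almost_fixed {K ι : Type*} [NormedAddCommGroup K] [InnerProductSpace ℂ K]
    (s : Finset ι) {u : ι → K →L[ℂ] K} (hu : ∀ i v, ‖u i v‖ ≤ ‖v‖)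
    (H : ∀ ε : ℝ, 0 < ε → ∃ (m : ℕ) (η : Fin m → K), ‖1 - ∑ j, ⟪η j, η j⟫_ℂ‖ < ε ∧
      ∀ i ∈ s, ‖1 - ∑ j, ⟪η j, u i (η j)⟫_ℂ‖ < ε) {δ : ℝ} (hδ : 0 < δ) :
    ∃ ξ : K, ‖ξ‖ = 1 ∧ ∀ i ∈ s, ‖u i ξ - ξ‖ < δ := by
  -- The bound `1/2` keeps `∑ ‖η_j‖²` above `1/2`; the other bound makes the total displacement `4
  -- |s| ε` smaller than `δ²/2`.
  set ε : ℝ := min (1 / 2) (δ ^ 2 / (16 * (s.card + 1))) with hε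
  have hε0 : 0 < ε := lt_min (by norm_num) (by positivity)
  obtain ⟨m, η, h1, h2⟩ := H ε hε0
  have e1 : ∑ j, ‖η j‖ ^ 2 > 1 - ε ∧ ∑ j, ‖η j‖ ^ 2 < 1 + ε := by
    have h3 : (∑ j, ⟪η j, η j⟫_ℂ) = ((∑ j, ‖η j‖ ^ 2 : ℝ) : ℂ) := by
      push_cast
      exact Finset.sum_congr rfl fun j _ => inner_self_eq_norm_sq_to_K _
    rw [h3, ← Complex.ofReal_one, ← Complex.ofReal_sub, Complex.norm_real, Real.norm_eq_abs,
      abs_lt] at h1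
    constructor <;> linarith
  -- For a contraction, `‖uη - η‖² ≤ 2‖η‖² - 2 Re ⟪η, uη⟫`; summed over `j` this is at most `2(1 +
  -- ε) - 2(1 - ε)`.
  have e2 : ∀ i ∈ s, ∑ j, ‖u i (η j) - η j‖ ^ 2 ≤ 4 * ε := by
    intro i hi
    have h3 := (Complex.abs_re_le_norm _).trans_lt (h2 i hi)
    rw [Complex.sub_re, Complex.one_re, Complex.re_sum, abs_lt] at h3
    have h4 : ∑ j, ‖u i (η j) - η j‖ ^ 2 ≤
        ∑ j, (2 * ‖η j‖ ^ 2 - 2 * (⟪η j, u i (η j)⟫_ℂ).re) := by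
      refine Finset.sum_le_sum fun j _ => ?_
      have h5 := norm_sub_sq (𝕜 := ℂ) (η j) (u i (η j))
      rw [norm_sub_rev] at h5
      have h6 : ‖u i (η j)‖ ^ 2 ≤ ‖η j‖ ^ 2 := by
        have := hu i (η j)
        gcongr
      have h7 : RCLike.re ⟪η j, u i (η j)⟫_ℂ = (⟪η j, u i (η j)⟫_ℂ).re := rfl
      rw [h7] at h5
      linarith
    rw [Finset.sum_sub_distrib, ← Finset.mul_sum, ← Finset.mul_sum] at h4
    linarith
  have e3 : ∑ j, ∑ i ∈ s, ‖u i (η j) - η j‖ ^ 2 ≤ s.card * (4 * ε) := by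
    rw [Finset.sum_comm]
    refine (Finset.sum_le_sum e2).trans ?_
    simp
  have e4 : (s.card : ℝ) * (4 * ε) < ∑ j, δ ^ 2 * ‖η j‖ ^ 2 := by
    rw [← Finset.mul_sum]
    have h3 : ε ≤ 1 / 2 := min_le_left _ _
    have h4 : ε ≤ δ ^ 2 / (16 * (s.card + 1)) := min_le_right _ _
    rw [le_div_iff₀ (by positivity)] at h4
    have h5 : (0 : ℝ) ≤ s.card * ε := by positivity
    have h6 : 0 < δ ^ 2 := by positivity
    have h7 : δ ^ 2 * (1 / 2) ≤ δ ^ 2 * ∑ j, ‖η j‖ ^ 2 := by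
      gcongr
      linarith
    nlinarith
  -- Pigeonhole: some `η_j` is displaced little, relative to its own norm, by all the `u i` at once.
  -- The strict inequality also forces `η_j ≠ 0`.
  obtain ⟨j, -, hj⟩ := Finset.exists_lt_of_sum_lt (e3.trans_lt e4)
  have hsum : ∀ i ∈ s, ‖u i (η j) - η j‖ ^ 2 < δ ^ 2 * ‖η j‖ ^ 2 := fun i hi =>
    (Finset.single_le_sum (f := fun i => ‖u i (η j) - η j‖ ^ 2) (fun _ _ => sq_nonneg _)
      hi).trans_lt hj
  have hη : 0 < ‖η j‖ := by
    rw [norm_pos_iff]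
    rintro h0
    rw [h0] at hj
    simp at hj
  refine ⟨((‖η j‖⁻¹ : ℝ) : ℂ) • η j, ?_, fun i hi => ?_⟩
  · rw [norm_smul, Complex.norm_real, Real.norm_eq_abs, abs_of_pos (inv_pos.2 hη),
      inv_mul_cancel₀ hη.ne']
  · rw [map_smul, ← smul_sub, norm_smul, Complex.norm_real, Real.norm_eq_abs,
      abs_of_pos (inv_pos.2 hη), inv_mul_lt_iff₀ hη]
    have := hsum i hi
    rw [← mul_pow] at this
    rw [mul_comm]
    exact lt_of_pow_lt_pow_left₀ 2 (by positivity) this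

theorem exists_seq_of_forall_finset {Γ : Type*} [Countable Γ] [Nonempty Γ] {X : Type*}
    {P : X → Prop} {d : Γ → X → ℝ} (hd : ∀ g x, 0 ≤ d g x)
    (h : ∀ (s : Finset Γ) (δ : ℝ), 0 < δ → ∃ x, P x ∧ ∀ g ∈ s, d g x < δ) :
    ∃ x : ℕ → X, (∀ n, P (x n)) ∧ ∀ g, Tendsto (fun n => d g (x n)) atTop (𝓝 0) := by
  classical
  obtain ⟨e, he⟩ := exists_surjective_nat Γ
  choose x hx hx' using fun n : ℕ =>
    h ((Finset.range (n + 1)).image e) (1 / ((n : ℝ) + 1)) (by positivity)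
  refine ⟨x, hx, fun g => ?_⟩
  obtain ⟨k, rfl⟩ := he g
  refine squeeze_zero' (Eventually.of_forall fun n => hd _ _) ?_
    (tendsto_one_div_add_atTop_nhds_zero_nat (𝕜 := ℝ))
  filter_upwards [eventually_ge_atTop k] with n hn
  exact (hx' n _ (Finset.mem_image_of_mem _ (Finset.mem_range.2 (by omega)))).le

variable (κ : TorusCocycle Γ μ)

theorem TorusCocycle.bddMeas_conjTwist (h : Γ) :
    BddMeas fun p : Ω × Γ => conj (κ.toFun h (p.2 • p.1)) * κ.toFun h p.1 :=
  ⟨((κ.bddMeas μ h).conj.meas.comp measurable_act).mul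
    ((κ.measurable' h).comp measurable_fst), 1, fun p => by simp [κ.norm_eq_one']⟩

/-- At `(ω, g)` the bimodule conjugation by `λ_h` is `κ_h(gω) conj (κ_h(ω)) v(h⁻¹ω, h⁻¹gh)`;
multiplying by the conjugate of the unimodular factor leaves `θ_h ⊗ Ad_h`. -/
theorem mulOp_twistAmp_lam (h : Γ) (v : L2Prod Γ μ) :
    mulOp (prodMeasure Γ μ) _ (κ.bddMeas_conjTwist μ h)
      (twistAmp μ κ (lam h) (conjBy (crossedJ Γ μ) (twistAmp μ κ (lam h)) v)) = adOp μ h v := by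
  rw [twistAmp_lam, conjBy_mul (crossedJ_crossedJ μ), conjBy_translOp, conjBy_diagOp]
  set a := compOp _ (fun p => (h⁻¹ • p.1, p.2 * h)) (mp_prod μ h⁻¹ (Equiv.mulRight h)) v with ha
  set b := mulOp (prodMeasure Γ μ) (fun p : Ω × Γ => conj (κ.toFun h p.1))
    ((κ.bddMeas μ h).conj.comp (T := Prod.fst) measurable_fst) a with hb
  change mulOp (prodMeasure Γ μ) _ (κ.bddMeas_conjTwist μ h)
    (diagOp μ (κ.toFun h) (κ.bddMeas μ h) (translOp μ h b)) = _
  apply Lp.ext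
  have hq := (mp_snd μ (Equiv.mulLeft h⁻¹)).quasiMeasurePreserving
  filter_upwards [mulOp_ae (prodMeasure Γ μ) _ (κ.bddMeas_conjTwist μ h)
      (diagOp μ (κ.toFun h) (κ.bddMeas μ h) (translOp μ h b)),
    mulOp_ae (prodMeasure Γ μ) _ ((κ.bddMeas μ h).comp measurable_act) (translOp μ h b),
    compOp_ae _ _ (mp_snd μ (Equiv.mulLeft h⁻¹)) b,
    hq.ae (mulOp_ae (prodMeasure Γ μ) (fun p : Ω × Γ => conj (κ.toFun h p.1))
      ((κ.bddMeas μ h).conj.comp (T := Prod.fst) measurable_fst) a),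
    hq.ae (compOp_ae _ _ (mp_prod μ h⁻¹ (Equiv.mulRight h)) v), adOp_ae μ h v]
    with p h1 h2 h3 h4 h5 h6
  have h2' : diagOp μ (κ.toFun h) (κ.bddMeas μ h) (translOp μ h b) p =
    κ.toFun h (p.2 • p.1) * translOp μ h b p := h2
  have h3' : translOp μ h b p = b (p.1, h⁻¹ * p.2) := h3
  have h4' : b (p.1, h⁻¹ * p.2) = conj (κ.toFun h p.1) * a (p.1, h⁻¹ * p.2) := h4
  have h5' : a (p.1, h⁻¹ * p.2) = v (h⁻¹ • p.1, h⁻¹ * p.2 * h) := h5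
  rw [h1, h2', h3', h4', h5', h6]
  have e1 := κ.conj_mul_self μ h (p.2 • p.1)
  have e2 := κ.mul_conj_self μ h p.1
  linear_combination (κ.toFun h p.1 * conj (κ.toFun h p.1) * v (h⁻¹ • p.1, h⁻¹ * p.2 * h)) * e1 +
    v (h⁻¹ • p.1, h⁻¹ * p.2 * h) * e2

end Mean

/-! ### An invariant mean from weak containment. -/

section AmenableMean

variable {Γ : Type*} [Group Γ] [Countable Γ] [MeasurableSpace Γ] [DiscreteMeasurableSpace Γ]
  {Ω : Type*} [MeasurableSpace Ω] [MulAction Γ Ω] [MeasurableConstSMul Γ Ω]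
  (μ : Measure Ω) [SigmaFinite μ] [SMulInvariantMeasure Γ Ω μ] (κ : TorusCocycle Γ μ)

/-- The operator `η ↦ π(λ_h) · η · π(λ_h)*`. -/
def twistAd (h : Γ) : L2Prod Γ μ →L[ℂ] L2Prod Γ μ :=
  twistAmp μ κ (lam h) * conjBy (crossedJ Γ μ) (twistAmp μ κ (lam h))

theorem mulOp_twistAd (h : Γ) (v : L2Prod Γ μ) :
    mulOp (prodMeasure Γ μ) _ (κ.bddMeas_conjTwist μ h) (twistAd μ κ h v) = adOp μ h v :=
  mulOp_twistAmp_lam μ κ h v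

theorem norm_adOp (h : Γ) (v : L2Prod Γ μ) : ‖adOp μ h v‖ = ‖v‖ := by
  rw [norm_eq_sqrt_re_inner (𝕜 := ℂ), inner_adOp, ← norm_eq_sqrt_re_inner]

theorem norm_conjTwist (h : Γ) (p : Ω × Γ) :
    ‖conj (κ.toFun h (p.2 • p.1)) * κ.toFun h p.1‖ = 1 := by
  simp [κ.norm_eq_one']

theorem norm_twistAd (h : Γ) (v : L2Prod Γ μ) : ‖twistAd μ κ h v‖ = ‖v‖ := by
  rw [← norm_adOp μ h v, ← mulOp_twistAd μ κ h v,
    norm_mulOp_of_norm_eq_one _ _ (norm_conjTwist μ κ h)]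

theorem L2Group_act_delta (h : Γ) :
    (L2Group Γ).act (lamVN h) (delta 1 : ell2 Γ) (lamVN h⁻¹) = (delta 1 : ell2 Γ) := by
  have h1 : lam h (conjBy (groupJ Γ) (star (lam h⁻¹)) (delta 1)) = delta (1 : Γ) := by
    rw [star_lam, inv_inv, conjBy_apply, groupJ_delta, lam_delta, groupJ_delta, lam_delta]
    simp
  exact h1

theorem twistedCorr_act_lam (h : Γ) (η : L2Prod Γ μ) :
    (twistedCorr μ κ).act (lamVN h) η (lamVN h⁻¹) = twistAd μ κ h η := by
  have h1 : star ((lamVN h⁻¹ : (groupVN Γ).toStarSubalgebra) : ell2 Γ →L[ℂ] ell2 Γ) = lam h := by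
    have h2 := star_lam h⁻¹
    rw [inv_inv] at h2
    exact h2
  rw [twistedCorr_act, h1]
  rfl

theorem twistAd_one (η : L2Prod Γ μ) : twistAd μ κ 1 η = η := by
  have h1 : lam (1 : Γ) = 1 := by
    ext v : 1
    exact ell2_ext fun g => by
      rw [lam_apply, inv_one, one_mul]
      rfl
  rw [twistAd, h1, map_one]
  exact crossedJ_crossedJ μ η

theorem hasInvariantMean_of_weaklyContained
    (hw : WeaklyContained (L2Group Γ) (twistedCorr μ κ)) : HasInvariantMean Γ μ := by
  classical
  have H : ∀ (s : Finset Γ) (ε : ℝ), 0 < ε → ∃ (m : ℕ) (η : Fin m → L2Prod Γ μ),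
      ‖1 - ∑ j, ⟪η j, η j⟫_ℂ‖ < ε ∧ ∀ h ∈ s, ‖1 - ∑ j, ⟪η j, twistAd μ κ h (η j)⟫_ℂ‖ < ε := by
    intro s ε hε
    -- The pairs `(λ_h, λ_h⁻¹)` conjugate `δ_e` to itself, so all these coefficients are `1`.
    -- Including `h = 1` makes `∑ ‖η_j‖²` close to `1`.
    obtain ⟨m, (η : Fin m → L2Prod Γ μ), hη⟩ := hw ε hε ((insert 1 s).image lamVN)
      ((insert 1 s).image fun h => lamVN h⁻¹) (delta 1 : ell2 Γ) (norm_delta 1)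
    have h1 : ∀ h ∈ insert 1 s, ‖1 - ∑ j, ⟪(η j : L2Prod Γ μ), twistAd μ κ h (η j)⟫_ℂ‖ < ε := by
      intro h hh
      have h2 := hη _ (Finset.mem_image_of_mem _ hh) _ (Finset.mem_image_of_mem _ hh)
      have h3 : ⟪(delta 1 : ell2 Γ), ((L2Group Γ).act (lamVN h) (delta 1 : ell2 Γ)
          (lamVN h⁻¹) : ell2 Γ)⟫_ℂ = 1 := by
        refine (congrArg (fun z : ell2 Γ => ⟪delta 1, z⟫_ℂ) (L2Group_act_delta h)).trans ?_
        rw [inner_self_eq_norm_sq_to_K, norm_delta]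
        simp
      have h4 : ∀ j, ⟪(η j : L2Prod Γ μ), twistAd μ κ h (η j)⟫_ℂ =
          ⟪η j, (twistedCorr μ κ).act (lamVN h) (η j) (lamVN h⁻¹)⟫_ℂ := fun j =>
        (congrArg (fun z : L2Prod Γ μ => ⟪(η j : L2Prod Γ μ), z⟫_ℂ)
          (twistedCorr_act_lam μ κ h (η j))).symm
      rw [Finset.sum_congr rfl fun j _ => h4 j, ← h3]
      exact h2
    refine ⟨m, η, ?_, fun h hh => h1 h (Finset.mem_insert_of_mem hh)⟩
    have h5 := h1 1 (Finset.mem_insert_self _ _)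
    simpa only [twistAd_one] using h5
  obtain ⟨v, hv, ht⟩ := exists_seq_of_forall_finset (P := fun v : L2Prod Γ μ => ‖v‖ = 1)
    (d := fun h v => ‖twistAd μ κ h v - v‖) (fun _ _ => norm_nonneg _)
    fun s δ hδ => exists_unit_almost_fixed s (fun h v => (norm_twistAd μ κ h v).le) (H s) hδ
  refine hasInvariantMean_of_tendsto μ hv (κ.bddMeas_conjTwist μ) (norm_conjTwist μ κ) fun h => ?_
  rw [tendsto_zero_iff_norm_tendsto_zero]
  refine (ht h).congr fun n => ?_
  rw [← mulOp_twistAd μ κ, ← map_sub, norm_mulOp_of_norm_eq_one _ _ (norm_conjTwist μ κ h)]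

end AmenableMean

/-! ### Almost invariant vectors from an invariant mean -/

section Supersolution

/-- `F` is the Neumann series `∑ β⁻ⁿ Bⁿ x₀`, which converges since `b < β`, and `B F = β (F - x₀) ≤
β F`. Only the norm of `B` on the positive cone enters, because all iterates are positive. -/
theorem exists_supersolution {E : Type*} [NormedAddCommGroup E] [Lattice E] [HasSolidNorm E]
    [IsOrderedAddMonoid E] [NormedSpace ℝ E] [CompleteSpace E]
    (hsmul : ∀ (c : ℝ) (x : E), 0 ≤ c → 0 ≤ x → 0 ≤ c • x) {B : E →L[ℝ] E}
    (hpos : ∀ x, 0 ≤ x → 0 ≤ B x) {b β : ℝ} (hb : 0 ≤ b) (hβ : b < β)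
    (hB : ∀ x, 0 ≤ x → ‖B x‖ ≤ b * ‖x‖) {x₀ : E} (hx₀ : 0 ≤ x₀) :
    ∃ F : E, x₀ ≤ F ∧ B F ≤ β • F := by
  have hβ0 : 0 < β := hb.trans_lt hβ
  let u : ℕ → E := fun n => Nat.rec x₀ (fun _ v => β⁻¹ • B v) n
  have hu : ∀ n, u (n + 1) = β⁻¹ • B (u n) := fun n => rfl
  have hu0 : ∀ n, 0 ≤ u n := by
    intro n
    induction n with
    | zero => exact hx₀
    | succ n ih => exact hsmul _ _ (inv_nonneg.2 hβ0.le) (hpos _ ih)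
  have hn : ∀ n, ‖u n‖ ≤ (b / β) ^ n * ‖x₀‖ := by
    intro n
    induction n with
    | zero => simp [u]
    | succ n ih =>
      rw [hu, norm_smul, norm_inv, Real.norm_eq_abs, abs_of_pos hβ0]
      calc β⁻¹ * ‖B (u n)‖ ≤ β⁻¹ * (b * ((b / β) ^ n * ‖x₀‖)) := by
            gcongr
            exact (hB _ (hu0 n)).trans (by gcongr)
        _ = _ := by rw [pow_succ]; field_simp
  have hs : Summable u := by
    refine Summable.of_norm_bounded (g := fun n => (b / β) ^ n * ‖x₀‖) ?_ hn
    exact (summable_geometric_of_lt_one (by positivity) ((div_lt_one hβ0).2 hβ)).mul_right _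
  have h1 : ∑' n, u n = x₀ + ∑' n, u (n + 1) := hs.tsum_eq_zero_add
  have h2 : β • ∑' n, u (n + 1) = B (∑' n, u n) := by
    rw [B.map_tsum hs]
    simp_rw [hu]
    rw [tsum_const_smul'', smul_smul, mul_inv_cancel₀ hβ0.ne', one_smul]
  refine ⟨∑' n, u n, ?_, ?_⟩
  · rw [h1]
    exact le_add_of_nonneg_right (tsum_nonneg fun n => hu0 (n + 1))
  · rw [← h2, h1, smul_add]
    exact le_add_of_nonneg_left (hsmul _ _ hβ0.le hx₀)

theorem Lp_smul_nonneg {X : Type*} [MeasurableSpace X] {ν : Measure X} (c : ℝ) (x : Lp ℝ 2 ν)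
    (hc : 0 ≤ c) (hx : 0 ≤ x) : 0 ≤ c • x := by
  rw [← Lp.coeFn_nonneg] at hx ⊢
  filter_upwards [hx, Lp.coeFn_smul c x] with ω h1 h2
  rw [h2]
  exact mul_nonneg hc h1

theorem exists_pos_Lp {X : Type*} [MeasurableSpace X] (ν : Measure X) [SigmaFinite ν] :
    ∃ x : Lp ℝ 2 ν, ∀ᵐ ω ∂ν, 0 < x ω := by
  obtain ⟨g, hg0, hgm, hg⟩ := exists_pos_lintegral_lt_of_sigmaFinite ν (ε := 1) one_ne_zero
  have hm : MemLp (fun ω => Real.sqrt (g ω)) 2 ν := by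
    have hms : AEStronglyMeasurable (fun ω => Real.sqrt (g ω)) ν :=
      (hgm.coe_nnreal_real.sqrt).aestronglyMeasurable
    rw [memLp_two_iff_integrable_sq hms]
    refine (integrable_congr (ae_of_all _ fun ω => Real.sq_sqrt (g ω).2)).2 ⟨
      hgm.coe_nnreal_real.aestronglyMeasurable, ?_⟩
    rw [hasFiniteIntegral_iff_enorm]
    simpa using hg.trans ENNReal.one_lt_top
  refine ⟨hm.toLp _, ?_⟩
  filter_upwards [hm.coeFn_toLp] with ω h
  rw [h]
  exact Real.sqrt_pos.2 (hg0 ω)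

end Supersolution

/-! ### Almost invariant vectors by contradiction with an invariant mean. -/

section MeanToVectors

variable {Γ : Type*} [Group Γ] [Countable Γ] [MeasurableSpace Γ] [DiscreteMeasurableSpace Γ]
  {Ω : Type*} [MeasurableSpace Ω] [MulAction Γ Ω] [MeasurableConstSMul Γ Ω]
  (μ : Measure Ω) [SigmaFinite μ] [SMulInvariantMeasure Γ Ω μ]

/-- The translation `(θ_h x)(ω) = x(h⁻¹ω)` on real functions. -/
def realTransl (h : Γ) : Lp ℝ 2 μ →L[ℝ] Lp ℝ 2 μ :=
  (Lp.compMeasurePreservingₗᵢ ℝ _ (measurePreserving_smul h⁻¹ μ)).toContinuousLinearMap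

theorem realTransl_ae (h : Γ) (x : Lp ℝ 2 μ) : realTransl μ h x =ᵐ[μ] fun ω => x (h⁻¹ • ω) :=
  Lp.coeFn_compMeasurePreserving x (measurePreserving_smul h⁻¹ μ)

theorem norm_realTransl (h : Γ) (x : Lp ℝ 2 μ) : ‖realTransl μ h x‖ = ‖x‖ :=
  (Lp.compMeasurePreservingₗᵢ ℝ _ (measurePreserving_smul h⁻¹ μ)).norm_map x

theorem realTransl_nonneg (h : Γ) {x : Lp ℝ 2 μ} (hx : 0 ≤ x) : 0 ≤ realTransl μ h x := by
  rw [← Lp.coeFn_nonneg] at hx ⊢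
  filter_upwards [realTransl_ae μ h x, (measurePreserving_smul h⁻¹ μ).quasiMeasurePreserving.ae hx]
    with ω h1 h2
  rw [h1]
  exact h2

/-- The parallelogram law gives `‖x + θ_h x‖² ≤ (4 - δ²)‖x‖² ≤ (2 - δ²/4)²‖x‖²` for the one
displaced translate; each other summand is at most `2‖x‖`. -/
theorem norm_sum_add_realTransl_le {s : Finset Γ} {δ : ℝ} (hδ : 0 < δ) (hδ1 : δ ≤ 1)
    {x : Lp ℝ 2 μ} {h : Γ} (hh : h ∈ s) (hx : δ * ‖x‖ ≤ ‖realTransl μ h x - x‖) :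
    ‖∑ g ∈ s, (x + realTransl μ g x)‖ ≤ (2 * s.card - δ ^ 2 / 4) * ‖x‖ := by
  classical
  have h1 : ‖x + realTransl μ h x‖ ≤ (2 - δ ^ 2 / 4) * ‖x‖ := by
    have h2 := parallelogram_law_with_norm ℝ x (realTransl μ h x)
    rw [norm_realTransl, norm_sub_rev] at h2
    have h3 : δ ^ 2 * ‖x‖ ^ 2 ≤ ‖realTransl μ h x - x‖ ^ 2 := by
      rw [← mul_pow]
      gcongr
    refine abs_le_of_sq_le_sq' (a := ‖x + realTransl μ h x‖) ?_ ?_ |>.2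
    · have : 0 ≤ (δ ^ 2 / 4) ^ 2 * ‖x‖ ^ 2 := by positivity
      nlinarith
    · exact mul_nonneg (by nlinarith) (norm_nonneg _)
  have h2 : ∀ g ∈ s, ‖x + realTransl μ g x‖ ≤
      2 * ‖x‖ - (if g = h then δ ^ 2 / 4 * ‖x‖ else 0) := by
    intro g _
    split_ifs with hg
    · rw [hg]
      linarith
    · have := norm_add_le x (realTransl μ g x)
      rw [norm_realTransl] at this
      linarith
  refine (norm_sum_le _ _).trans ((Finset.sum_le_sum h2).trans ?_)
  rw [Finset.sum_sub_distrib, Finset.sum_ite_eq' s h, if_pos hh, Finset.sum_const, nsmul_eq_mul]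
  linarith

/-- A positive function `F` with `∑_{h ∈ s} θ_h F ≤ c |s| F`, `c < 1`, for a finite symmetric set
`s`, is incompatible with an invariant mean. -/
theorem HasInvariantMean.not_supersolution (hm : HasInvariantMean Γ μ) {s : Finset Γ}
    (hs : s.Nonempty) (hsi : ∀ h ∈ s, h⁻¹ ∈ s) {F : Ω → ℝ} (hF : Measurable F)
    (hF0 : ∀ᵐ ω ∂μ, 0 < F ω) {c : ℝ} (hc0 : 0 < c) (hc1 : c < 1) :
    ¬ ∀ᵐ ω ∂μ, ∑ h ∈ s, F (h⁻¹ • ω) ≤ c * s.card * F ω := by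
  classical
  intro hsup
  obtain ⟨φ, hpos, hone, hinv⟩ := hm
  have hcard : (0 : ℝ) < s.card := by exact_mod_cast hs.card_pos
  have hF0' : ∀ h : Γ, ∀ᵐ ω ∂μ, 0 < F (h • ω) := fun h =>
    (measurePreserving_smul h μ).quasiMeasurePreserving.ae hF0
  set C : ℝ := c * s.card with hC
  have hle : ∀ h ∈ s, ∀ᵐ ω ∂μ, F (h⁻¹ • ω) ≤ C * F ω := by
    intro h hh
    filter_upwards [hsup, ae_all_iff.2 hF0'] with ω h1 h2
    exact (Finset.single_le_sum (f := fun h : Γ => F (h⁻¹ • ω)) (fun g _ => (h2 g⁻¹).le) hh).trans h1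
  have hCpos : 0 < C := mul_pos hc0 hcard
  -- The coboundary of `log F`. It is bounded for `h ∈ s` because the supersolution inequality at
  -- `h` and at `h⁻¹` bounds `F(h⁻¹ω)/F(ω)` from both sides.
  let G : Γ → Ω → ℂ := fun h ω => ((Real.log (F (h⁻¹ • ω)) - Real.log (F ω) : ℝ) : ℂ)
  have hGm : ∀ h, Measurable (G h) := fun h => Complex.measurable_ofReal.comp
    ((hF.comp (measurable_const_smul h⁻¹)).log.sub hF.log)
  have hG : ∀ h ∈ s, MemLp (G h) ∞ μ := by
    intro h hh
    refine memLp_top_of_bound (hGm h).aestronglyMeasurable (Real.log C) ?_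
    have h2 := (measurePreserving_smul h⁻¹ μ).quasiMeasurePreserving.ae (hle _ (hsi h hh))
    filter_upwards [hle h hh, h2, hF0, hF0' h⁻¹] with ω h3 h4 h5 h6
    rw [inv_inv, smul_inv_smul] at h4
    have h7 := Real.log_le_log h6 h3
    have h8 := Real.log_le_log h5 h4
    rw [Real.log_mul hCpos.ne' h5.ne'] at h7
    rw [Real.log_mul hCpos.ne' h6.ne'] at h8
    rw [Complex.norm_real, Real.norm_eq_abs, abs_le]
    constructor <;> linarith
  let Λ : Γ → Lp ℂ ∞ μ := fun h => if hh : h ∈ s then (hG h hh).toLp _ else 0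
  have hΛ : ∀ h ∈ s, Λ h =ᵐ[μ] G h := fun h hh => by
    simp only [Λ, dif_pos hh]
    exact (hG h hh).coeFn_toLp
  -- `log F` need not be bounded, so the mean cannot be applied to it. Instead `θ_h G_{h⁻¹} = -G_h`
  -- makes `h ↦ φ(G_h)` odd, and its sum over the symmetric set `s` vanishes.
  have hneg : ∀ h ∈ s, φ (Λ h⁻¹) = -φ (Λ h) := by
    intro h hh
    rw [← hinv h (Λ h⁻¹), ← map_neg φ]
    refine congrArg φ (Lp.ext ?_)
    filter_upwards [Lp.coeFn_compMeasurePreserving (Λ h⁻¹) (measurePreserving_smul h⁻¹ μ),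
      (measurePreserving_smul h⁻¹ μ).quasiMeasurePreserving.ae (hΛ _ (hsi h hh)),
      Lp.coeFn_neg (Λ h), hΛ h hh] with ω h1 h2 h3 h4
    rw [h1, h3, Pi.neg_apply, h4, Function.comp_apply, h2]
    simp only [G, inv_inv, smul_inv_smul]
    push_cast
    ring
  have hsum : ∑ h ∈ s, φ (Λ h) = 0 := by
    have h1 : ∑ h ∈ s, φ (Λ h⁻¹) = ∑ h ∈ s, φ (Λ h) :=
      Finset.sum_nbij' (fun h => h⁻¹) (fun h => h⁻¹) hsi hsi (by simp) (by simp) (by simp)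
    have h2 := h1.symm.trans (Finset.sum_congr rfl hneg)
    rw [Finset.sum_neg_distrib] at h2
    exact self_eq_neg.1 h2
  set e : Lp ℂ ∞ μ := (memLp_top_const (1 : ℂ)).toLp (fun _ => (1 : ℂ)) with he
  have hkey : (0 : Lp ℂ ∞ μ) ≤ᵐ[μ] (((s.card * Real.log c : ℝ) : ℂ) • e - ∑ h ∈ s, Λ h : Lp ℂ ∞ μ) := by
    have hsumae : (∑ h ∈ s, Λ h : Lp ℂ ∞ μ) =ᵐ[μ] fun ω => ∑ h ∈ s, G h ω := by
      have h1 : ∀ᵐ ω ∂μ, ∀ h ∈ s, Λ h ω = G h ω := (ae_ball_iff s.countable_toSet).2 hΛ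
      filter_upwards [Lp.coeFn_finsetSum s Λ, h1] with ω h2 h3
      rw [h2]
      simp only [Finset.sum_apply]
      exact Finset.sum_congr rfl h3
    filter_upwards [Lp.coeFn_sub (((s.card * Real.log c : ℝ) : ℂ) • e) (∑ h ∈ s, Λ h),
      Lp.coeFn_smul ((s.card * Real.log c : ℝ) : ℂ) e, hsumae,
      (memLp_top_const (1 : ℂ)).coeFn_toLp (μ := μ), hsup, hF0, ae_all_iff.2 hF0',
      Lp.coeFn_zero ℂ ∞ μ] with ω h1 h2 h3 h4 h5 h6 h7 h8
    -- This is `log t ≤ t - 1` at `t = F(h⁻¹ω) / (c F(ω))`. The sum of these `t` over `s` is at most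
    -- `|s|`, so the sum of the `G_h` is at most `|s| log c`.
    have h9 : ∀ h ∈ s, Real.log (F (h⁻¹ • ω)) - Real.log (F ω) ≤
        c⁻¹ * (F ω)⁻¹ * F (h⁻¹ • ω) - 1 + Real.log c := by
      intro h hh
      have h10 := Real.log_le_sub_one_of_pos
        (mul_pos (mul_pos (inv_pos.2 hc0) (inv_pos.2 h6)) (h7 h⁻¹))
      rw [Real.log_mul (by positivity) (h7 h⁻¹).ne', Real.log_mul (by positivity) (by positivity),
        Real.log_inv, Real.log_inv] at h10
      linarith
    have h10 := Finset.sum_le_sum h9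
    simp only [Finset.sum_add_distrib, Finset.sum_sub_distrib, ← Finset.mul_sum,
      Finset.sum_const, nsmul_eq_mul, mul_one] at h10
    have h11 : c⁻¹ * (F ω)⁻¹ * ∑ h ∈ s, F (h⁻¹ • ω) ≤ s.card := by
      calc _ ≤ c⁻¹ * (F ω)⁻¹ * (c * s.card * F ω) := by gcongr
        _ = s.card := by field_simp
    rw [h8, h1, Pi.sub_apply, h2, Pi.smul_apply, h3, he, h4]
    simp only [G, smul_eq_mul, mul_one, Pi.zero_apply]
    rw [← Complex.ofReal_sum, ← Complex.ofReal_sub, Complex.zero_le_real]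
    simp only [Finset.sum_sub_distrib, Finset.sum_const, nsmul_eq_mul]
    linarith
  have hfin := hpos _ ((Lp.coeFn_zero ℂ ∞ μ).symm.trans_le hkey)
  rw [map_sub, map_sum, hsum, sub_zero, map_smul, hone, smul_eq_mul, mul_one,
    Complex.zero_le_real] at hfin
  nlinarith [Real.log_neg hc0 hc1]

theorem HasInvariantMean.exists_almost_invariant (hm : HasInvariantMean Γ μ) (s : Finset Γ)
    {δ : ℝ} (hδ : 0 < δ) (hδ1 : δ ≤ 1) :
    ∃ x : Lp ℝ 2 μ, ‖x‖ = 1 ∧ ∀ h ∈ s, ‖realTransl μ h x - x‖ < δ := by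
  classical
  by_contra! hcon
  -- `s` is symmetrised for the oddness argument; adding `1` makes the set nonempty.
  set S : Finset Γ := insert 1 (s ∪ s.image (·⁻¹)) with hS
  have hSne : S.Nonempty := ⟨1, Finset.mem_insert_self _ _⟩
  have hcard : (1 : ℝ) ≤ S.card := by exact_mod_cast hSne.card_pos
  have hSi : ∀ h ∈ S, h⁻¹ ∈ S := by
    intro h hh
    simp only [hS, Finset.mem_insert, Finset.mem_union, Finset.mem_image] at hh ⊢
    rcases hh with rfl | hh | ⟨g, hg, rfl⟩
    · exact Or.inl inv_one
    · exact Or.inr (Or.inr ⟨h, hh, rfl⟩)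
    · exact Or.inr (Or.inl (by rwa [inv_inv]))
  have hcon' : ∀ x : Lp ℝ 2 μ, x ≠ 0 → ∃ h ∈ S, δ * ‖x‖ ≤ ‖realTransl μ h x - x‖ := by
    intro x hx
    have hx0 := norm_pos_iff.2 hx
    obtain ⟨h, hh, hle⟩ := hcon (‖x‖⁻¹ • x) (norm_smul_inv_norm (𝕜 := ℝ) hx)
    refine ⟨h, Finset.mem_insert_of_mem (Finset.mem_union_left _ hh), ?_⟩
    rw [map_smul, ← smul_sub, norm_smul, norm_inv, norm_norm, inv_mul_eq_div,
      le_div_iff₀ hx0] at hle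
    exact hle
  let B : Lp ℝ 2 μ →L[ℝ] Lp ℝ 2 μ := ∑ g ∈ S, (ContinuousLinearMap.id ℝ _ + realTransl μ g)
  have hBapp : ∀ x, B x = ∑ g ∈ S, (x + realTransl μ g x) := fun x => by
    simp only [B, _root_.sum_apply]
    rfl
  have hsq : δ ^ 2 ≤ 1 := by nlinarith
  have hsq0 : 0 < δ ^ 2 := by positivity
  obtain ⟨x₀, hx₀⟩ := exists_pos_Lp μ
  have hx₀' : 0 ≤ x₀ := by
    rw [← Lp.coeFn_nonneg]
    filter_upwards [hx₀] with ω h using h.le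
  -- The norm bound `2|S| - δ²/4` leaves room for `β = 2|S| - δ²/8`. Removing the contribution `|S|
  -- F` of the identities turns `B F ≤ β F` into `∑ θ_g F ≤ (|S| - δ²/8) F`, that is, `c = 1 -
  -- δ²/(8|S|)`. Starting from an a.e. positive `x₀ ≤ F` makes `F` a.e. positive.
  obtain ⟨F, hF, hBF⟩ := exists_supersolution Lp_smul_nonneg (B := B)
    (fun x hx => by
      rw [hBapp]
      exact Finset.sum_nonneg fun g _ => add_nonneg hx (realTransl_nonneg μ g hx))
    (b := 2 * S.card - δ ^ 2 / 4) (β := 2 * S.card - δ ^ 2 / 8) (by linarith) (by linarith)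
    (fun x _ => by
      by_cases hx0 : x = 0
      · simp [hx0]
      · obtain ⟨h, hh, hle⟩ := hcon' x hx0
        rw [hBapp]
        exact norm_sum_add_realTransl_le μ hδ hδ1 hh hle) hx₀'
  have hcpos : 0 < (S.card - δ ^ 2 / 8) / (S.card : ℝ) := div_pos (by linarith) (by linarith)
  refine hm.not_supersolution μ hSne hSi (Lp.stronglyMeasurable F).measurable
    (c := (S.card - δ ^ 2 / 8) / S.card) ?_ hcpos
    ((div_lt_one (by linarith)).2 (by linarith)) ?_
  · filter_upwards [hx₀, Lp.coeFn_le x₀ F |>.2 hF] with ω h1 h2 using h1.trans_le h2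
  · have hae : ∀ᵐ ω ∂μ, ∀ g ∈ S, (F + realTransl μ g F) ω = F ω + F (g⁻¹ • ω) :=
      (ae_ball_iff S.countable_toSet).2 fun g _ => by
        filter_upwards [Lp.coeFn_add F (realTransl μ g F), realTransl_ae μ g F] with ω h1 h2
        rw [h1, Pi.add_apply, h2]
    rw [hBapp, ← Lp.coeFn_le] at hBF
    filter_upwards [hBF, Lp.coeFn_smul (2 * S.card - δ ^ 2 / 8 : ℝ) F,
      Lp.coeFn_finsetSum S fun g => F + realTransl μ g F, hae] with ω h1 h2 h3 h4
    rw [h2, h3, Finset.sum_apply, Finset.sum_congr rfl h4, Finset.sum_add_distrib,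
      Finset.sum_const, nsmul_eq_mul, Pi.smul_apply, smul_eq_mul] at h1
    rw [div_mul_cancel₀ _ (by linarith)]
    linarith

/-- An invariant mean gives almost invariant vectors in `L²(Ω)`. -/
theorem HasInvariantMean.exists_isAlmostInvariant (hm : HasInvariantMean Γ μ) :
    ∃ f : ℕ → Lp ℂ 2 μ, IsAlmostInvariant Γ μ f := by
  obtain ⟨x, hx, ht⟩ := exists_seq_of_forall_finset (P := fun x : Lp ℝ 2 μ => ‖x‖ = 1)
    (d := fun h x => ‖realTransl μ h x - x‖) (fun _ _ => norm_nonneg _) fun s δ hδ => by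
      obtain ⟨x, h1, h2⟩ := hm.exists_almost_invariant μ s (lt_min hδ one_pos) (min_le_right _ _)
      exact ⟨x, h1, fun h hh => (h2 h hh).trans_le (min_le_left _ _)⟩
  have hae : ∀ y : Lp ℝ 2 μ, Complex.ofRealCLM.compLp y =ᵐ[μ] fun ω => (y ω : ℂ) := fun y =>
    Complex.ofRealCLM.coeFn_compLp y
  have hnorm : ∀ y : Lp ℝ 2 μ, ‖Complex.ofRealCLM.compLp y‖ = ‖y‖ := by
    intro y
    rw [Lp.norm_def, Lp.norm_def]
    congr 1
    refine eLpNorm_congr_norm_ae ?_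
    filter_upwards [hae y] with ω h
    rw [h, Complex.norm_real]
  refine ⟨fun n => Complex.ofRealCLM.compLp (x n), fun n => (hnorm _).trans (hx n), fun n => ?_,
    fun g => ?_⟩
  · filter_upwards [hae (x n)] with ω h
    rw [h, Complex.conj_ofReal]
  · rw [tendsto_zero_iff_norm_tendsto_zero]
    refine (ht g).congr fun n => ?_
    rw [← hnorm]
    congr 1
    apply Lp.ext
    filter_upwards [hae (realTransl μ g (x n) - x n), Lp.coeFn_sub (realTransl μ g (x n)) (x n),
      realTransl_ae μ g (x n), Lp.coeFn_sub (compOp μ (fun ω => g⁻¹ • ω)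
        (measurePreserving_smul g⁻¹ μ) (Complex.ofRealCLM.compLp (x n)))
        (Complex.ofRealCLM.compLp (x n)),
      compOp_ae μ _ (measurePreserving_smul g⁻¹ μ) (Complex.ofRealCLM.compLp (x n)),
      (measurePreserving_smul g⁻¹ μ).quasiMeasurePreserving.ae (hae (x n)), hae (x n)]
      with ω h1 h2 h3 h4 h5 h6 h7
    rw [h1, h2, Pi.sub_apply, h3, h4, Pi.sub_apply, h5, h6, h7]
    push_cast
    rfl

end MeanToVectors

end AmenableHom

end

/-! ### The equivalences, assembled through the invariant mean. -/

theorem mainTheorem4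
    {Γ : Type*} [Group Γ] [Countable Γ] [MeasurableSpace Γ] [DiscreteMeasurableSpace Γ]
    {Ω : Type*} [MeasurableSpace Ω] [MulAction Γ Ω] [MeasurableConstSMul Γ Ω]
    (μ : Measure Ω) [SigmaFinite μ] [SMulInvariantMeasure Γ Ω μ]
    (κ : AmenableHom.TorusCocycle Γ μ) :
    ∃ π : (AmenableHom.groupVN Γ).toStarSubalgebra →⋆ₐ[ℂ]
        (AmenableHom.crossedVN Γ μ).toStarSubalgebra,
      -- `π` is the normal homomorphism associated with `κ`, and it is the only one
      AmenableHom.IsTwistedHom μ κ π ∧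
      (∀ π', AmenableHom.IsTwistedHom μ κ π' → π' = π) ∧
      -- (i), with the normalisation imposed exactly
      (AmenableHom.IsAmenableHom μ π ↔
        ∃ ξ : ℕ → AmenableHom.L2Prod Γ μ, (∀ n, ‖ξ n‖ = 1) ∧
          AmenableHom.AsympInvariant μ κ ξ ∧
          ∀ (n : ℕ) (h : Γ), AmenableHom.traceCoeff μ κ (ξ n) h = Set.indicator {1} 1 h) ∧
      -- (i), with the normalisation imposed in the limit
      (AmenableHom.IsAmenableHom μ π ↔
        ∃ ξ : ℕ → AmenableHom.L2Prod Γ μ, (∀ n, ‖ξ n‖ = 1) ∧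
          AmenableHom.AsympInvariant μ κ ξ ∧
          ∀ h : Γ, Tendsto (fun n => AmenableHom.traceCoeff μ κ (ξ n) h) atTop
            (𝓝 (Set.indicator {1} 1 h))) ∧
      -- (ii), for every countably incomplete ultrafilter
      ∀ {ι : Type*} (U : Ultrafilter ι), ¬ CountableInterFilter (U : Filter ι) →
        ((AmenableHom.IsAmenableHom μ π ∧
            ∃ J : AmenableHom.ell2 Γ →ₗᵢ[ℂ]
                AmenableHom.Ultrapower U (AmenableHom.L2Prod Γ μ),
              AmenableHom.IsBimodular μ π U J ∧ AmenableHom.IntertwinesMultipliers μ U J) ↔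
          AmenableHom.HasInvariantMean Γ μ) := by
  open AmenableHom in
  have hmean : IsAmenableHom μ (twistedHom μ κ) → HasInvariantMean Γ μ := fun h =>
    hasInvariantMean_of_weaklyContained μ κ ((isAmenableHom_iff μ κ).1 h)
  have hamen : HasInvariantMean Γ μ → IsAmenableHom μ (twistedHom μ κ) := fun h => by
    obtain ⟨f, hf⟩ := h.exists_isAlmostInvariant
    exact hf.isAmenableHom κ
  have hseq : IsAmenableHom μ (twistedHom μ κ) → ∃ ξ : ℕ → L2Prod Γ μ, (∀ n, ‖ξ n‖ = 1) ∧
      AsympInvariant μ κ ξ ∧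
        ∀ (n : ℕ) (h : Γ), traceCoeff μ κ (ξ n) h = Set.indicator {1} 1 h := fun h => by
    obtain ⟨f, hf⟩ := (hmean h).exists_isAlmostInvariant
    refine ⟨fun n => tensor μ (f n) (delta 1), fun n => ?_, hf.asympInvariant κ,
      fun n => traceCoeff_tensor κ (f n) (hf.norm_eq_one n)⟩
    rw [norm_tensor, norm_delta, hf.norm_eq_one, one_mul]
  refine ⟨twistedHom μ κ, isTwistedHom_twistedHom μ κ,
    fun π' h' => (isTwistedHom_twistedHom μ κ).unique μ κ h', ⟨hseq, ?_⟩, ⟨fun h => ?_, ?_⟩,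
    fun U hU => ⟨fun h => hmean h.1, fun h => ⟨hamen h, ?_⟩⟩⟩
  · rintro ⟨ξ, h1, h2, -⟩
    exact hamen (h2.hasInvariantMean μ h1)
  · obtain ⟨ξ, h1, h2, h3⟩ := hseq h
    exact ⟨ξ, h1, h2, fun h => tendsto_const_nhds.congr fun n => (h3 n h).symm⟩
  · rintro ⟨ξ, h1, h2, -⟩
    exact hamen (h2.hasInvariantMean μ h1)
  · obtain ⟨f, hf⟩ := h.exists_isAlmostInvariant
    exact hf.exists_isometry κ U hU
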